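/- Let $T=T[1..n]$, $n\ge 1$, be a text over the integer alphabet $\{1,\dots,\sigma\}$ with $\sigma\le (n+1)^{\kappa}$, let $\$=0$ be a delimiter smaller than all characters, and let $T=T_1\cdots T_t$ be the Lyndon factorization of $T$ (Lyndon words $T_1\succeq_{\rm lex}\dots\succeq_{\rm lex}T_t$). The array $\mathrm{BWT}$ of $T\$$ consists of the last characters of the lexicographically sorted conjugates of $T\$$. The array $\mathrm{BBWT}$ of a text consists of the last characters of the conjugates of all its Lyndon factors, sorted by the order $u\prec_\omega v :\Leftrightarrow u^\omega<_{\rm lex}v^\omega$. For an array $A$ let $\mathrm{First}$ be the sorted array, $\mathrm{LF}[i]=\mathrm{First.select}_{A[i]}(A.\mathrm{rank}_{A[i]}(i))$ the backward step and $\mathrm{FL}[i]=A.\mathrm{select}_{\mathrm{First}[i]}(\mathrm{First.rank}_{\mathrm{First}[i]}(i))$ the forward step. The model is a word RAM whose memory consists of the input array, which is rewriteable only by exchanging two entries, and a constant number of registers of $O(\log n)$ bits (with register contents at most $(n+1)^{\kappa+O(1)}$). (1) There is a fixed program, using elementary instructions only, that converts the $\mathrm{BWT}$ of every $T\$$ in-place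 in $O(n^2)$ time into the $\mathrm{BBWT}$ of $T\$$, which is $\$$ followed by the $\mathrm{BBWT}$ of $T$. (2) The conversion can be done on the fly, without decoding the text: there is a fixed program for the same in-place conversion that executes $O(n^2)$ instructions, $O(n)$ of which are lookups of an entry $\mathrm{First}[i]$ (so that the total time is $O(n^2)$ whenever a lookup is charged $O(n)$ time), and that treats the factors $T_1,\dots,T_t$ one after the other as follows. Let $A_x$ be the array of the last characters of the $\prec_\omega$-sorted conjugates of the words $T_1,\dots,T_x$ and $T_{x+1}\cdots T_t\$$; so $A_0$ is the $\mathrm{BWT}$ of $T\$$ and $A_t$ the $\mathrm{BBWT}$ of $T\$$. The sequence of all exchanges executed by the program is a concatenation $S_1\cdots S_t$, where $S_x$ transforms $A_{x-1}$ into $A_x$ and has the following form. Write $w=T_x$, $m=|w|$, and in $A=A_{x-1}$ let $i_\$$ be the position of $\$$ and $p_k=\mathrm{FL}^{k-1}[i_\$]$ for $1\le k\le m+1$. (a) The factor is found by forward steps: $\mathrm{First}[p_k]=w[k]$ for $1\le k\le m$, and $i_{\mathtt f}:=p_{m+1}$ is the position of the last character of $w$, $A[i_{\mathtt f}]=w[m]$;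 moreover $i_{\mathtt f}<i_\$$, while $p_k>i_\$$ for $2\le k\le m$. (b) $S_x$ starts with the exchange of $A[i_\$]$ with $A[i_{\mathtt f}]$. Then, for $k=m,m-1,\dots,1$, it performs the $c_k$ swaps of the entries at positions $p_k+j$ and $p_k+j+1$, $j=0,\dots,c_k-1$, all of them inside the $w[k]$-interval of $\mathrm{First}$. The numbers of swaps are counts of entries of $A$: $c_m=|\{i\in(i_{\mathtt f},\,i_\$+c_1] : A[i]=w[m]\}|$ and $c_k=|\{i\in(p_{k+1},\,p_{k+1}+c_{k+1}] : A[i]=w[k]\}|$ for $1\le k<m$. (c) In $A_x$ the factor has its own $\mathrm{LF}$-cycle: the position $q=i_\$+c_1$ lies on an $\mathrm{LF}$-cycle of length exactly $m$, and $A_x[\mathrm{LF}^{k}[q]]=w[m-k]$ for $0\le k<m$. -/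

import Mathlib

/-! ## Strings, Lyndon words and the transforms

Characters are natural numbers.  Texts are nonempty lists over `{1, 2, 3, ...}`; the character `0` is
the delimiter `$`, smaller than every character of a text.  The order `<` on `List ℕ` is the
lexicographic order.  Positions are 0-based. -/

/-- A Lyndon word: a nonempty word smaller than each of its proper nonempty suffixes. -/
def IsLyndon (w : List ℕ) : Prop :=
  w ≠ [] ∧ ∀ s : List ℕ, s <:+ w → s ≠ [] → s ≠ w → w < s

/-- `fs = [T_1, ..., T_t]` is the Lyndon factorization of `T`: a factorization of `T` into
lexicographically non-increasing Lyndon words. -/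
def IsLyndonFactorization (T : List ℕ) (fs : List (List ℕ)) : Prop :=
  fs.flatten = T ∧ (∀ w ∈ fs, IsLyndon w) ∧ fs.Pairwise (fun u v => v ≤ u)

/-- The infinite word `w w w ...` (for `w ≠ []`), in the lexicographically ordered type of infinite
words. -/
def omegaWord (w : List ℕ) : Lex (ℕ → ℕ) := toLex fun i => w.getD (i % w.length) 0

/-- The list of all conjugates (rotations) `w.rotate 0, ..., w.rotate (|w| - 1)` of a word. -/
def conjugates (w : List ℕ) : List (List ℕ) := (List.range w.length).map w.rotate

/-- The last characters of the conjugates of the words in `fs`, sorted by the order of their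
infinite powers. -/
noncomputable def ebwt (fs : List (List ℕ)) : List ℕ :=
  open Classical in
  ((fs.flatMap conjugates).mergeSort (fun u v => decide (omegaWord u ≤ omegaWord v))).map
    fun u => u.getLastD 0

/-- `B` is the bijective Burrows-Wheeler transform of `T`. -/
def IsBBWT (T B : List ℕ) : Prop := ∃ fs, IsLyndonFactorization T fs ∧ B = ebwt fs

/-- The last characters of the lexicographically sorted conjugates of `w`.  The Burrows-Wheeler
transform of a text `T` is `bwt (T ++ [0])`. -/
def bwt (w : List ℕ) : List ℕ :=
  ((conjugates w).mergeSort (fun u v => decide (u ≤ v))).map fun u => u.getLastD 0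

/-! ## The LF and FL mappings of an array -/

/-- The sorted array: `(firstColumn A)[i]` is the `i`-th smallest entry of `A`. -/
def firstColumn (A : List ℕ) : List ℕ := A.mergeSort (fun a b => decide (a ≤ b))

/-- The number of occurrences of `c` among the first `i` entries of `A`. -/
def rank (A : List ℕ) (c i : ℕ) : ℕ := (A.take i).count c

/-- The position of the occurrence of `c` in `A` that has exactly `k` occurrences of `c` before it. -/
def select (A : List ℕ) (c k : ℕ) : ℕ :=
  ((List.range A.length).filter fun j => A.getD j 0 = c).getD k 0

/-- Backward step. -/
def lf (A : List ℕ) (i : ℕ) : ℕ := select (firstColumn A) (A.getD i 0) (rank A (A.getD i 0) i)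

/-- Forward step. -/
def fl (A : List ℕ) (i : ℕ) : ℕ :=
  select A ((firstColumn A).getD i 0) (rank (firstColumn A) ((firstColumn A).getD i 0) i)

/-! ## Cutting a Lyndon factor out of the array by exchanges -/

/-- Exchange two entries of an array. -/
def exchange (A : List ℕ) (i j : ℕ) : List ℕ :=
  if i < A.length ∧ j < A.length then (A.set i (A.getD j 0)).set j (A.getD i 0) else A

/-- Perform a sequence of exchanges. -/
def exchanges (A : List ℕ) (S : List (ℕ × ℕ)) : List ℕ := S.foldl (fun B s => exchange B s.1 s.2) A

/-- The number of positions `i` with `a < i ≤ b` and `A[i] = c`. -/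
def countIn (A : List ℕ) (c a b : ℕ) : ℕ := ((Finset.Ioc a b).filter fun i => A.getD i 0 = c).card

/-- The swaps of the entries at `p, p + 1`, then `p + 1, p + 2`, ..., then `p + c - 1, p + c`. -/
def swapRun (p c : ℕ) : List (ℕ × ℕ) := (List.range c).map fun j => (p + j, p + j + 1)

/-- The sequence `S` of exchanges cuts the word `w` out of the cycle of the delimiter of `A` and
results in the array `B`.

With `d` the position of `$` and `p k` reached from `d` by `k` forward steps, `w` is read off the
first column at `p 0, ..., p (m - 1)`, and `p m` (the position of the last character of `w`) is the
first position reached that is smaller than `d`.  `S` consists of the exchange of the entries at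
`p m` and `d`, followed by `c k` swaps moving the entry at `p k` downwards inside the `w[k]`-interval
of the first column, for `k = m - 1, ..., 0`; the numbers `c k` are obtained by counting entries.
In `B` the word `w` has its own LF cycle, which contains the position `d + c 0`. -/
def IsCut (A w : List ℕ) (S : List (ℕ × ℕ)) (B : List ℕ) : Prop :=
  let m := w.length
  let d := A.idxOf 0
  let p : ℕ → ℕ := fun k => (fl A)^[k] d
  (∀ k < m, (firstColumn A).getD (p k) 0 = w.getD k 0) ∧
  p m < d ∧ A.getD (p m) 0 = w.getLastD 0 ∧ (∀ k, 1 ≤ k → k < m → d < p k) ∧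
  ∃ c : ℕ → ℕ,
    c (m - 1) = countIn A (w.getLastD 0) (p m) (d + c 0) ∧
    (∀ k, k + 1 < m → c k = countIn A (w.getD k 0) (p (k + 1)) (p (k + 1) + c (k + 1))) ∧
    (∀ k < m, p k + c k < A.length ∧ (firstColumn A).getD (p k + c k) 0 = w.getD k 0) ∧
    S = (p m, d) :: (List.range m).reverse.flatMap (fun k => swapRun (p k) (c k)) ∧
    B = exchanges A S ∧
    (lf B)^[m] (d + c 0) = d + c 0 ∧
    (∀ k, 1 ≤ k → k < m → (lf B)^[k] (d + c 0) ≠ d + c 0) ∧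
    (∀ k < m, B.getD ((lf B)^[k] (d + c 0)) 0 = w.getD (m - 1 - k) 0)

/-- The array after the first `x` factors have been cut out: the transform of the words
`T_1, ..., T_x` and `T_{x+1} ... T_t $`. -/
noncomputable def stage (fs : List (List ℕ)) (x : ℕ) : List ℕ :=
  ebwt (fs.take x ++ [(fs.drop x).flatten ++ [0]])

/-! ## The machine: a RAM whose only memory besides finitely many registers is the input array -/

/-- Instructions.  Arguments named `r`, `s`, `t`, `i`, `j` are register numbers, `c` is a constant,
`l` is an instruction number.  The array can be changed only by `swap`. -/
inductive Instr
  | const (r c : ℕ)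
  | move (r s : ℕ)
  | add (r s t : ℕ)
  | sub (r s t : ℕ)
  | mul (r s t : ℕ)
  | div (r s t : ℕ)
  | jump (l : ℕ)
  | jumpLt (r s l : ℕ)
  | jumpEq (r s l : ℕ)
  /-- read the array entry whose position is in register `i` into register `r` -/
  | load (r i : ℕ)
  /-- exchange the array entries whose positions are in registers `i` and `j` -/
  | swap (i j : ℕ)
  /-- lookup in the first column: with `v` the content of register `i`, store the `v`-th smallest
  array entry in register `r` -/
  | first (r i : ℕ)

/-- Configurations.  The components `swaps` (the list of exchanges executed so far) and `lookups` (the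
number of `first` instructions executed so far) are a record for the analysis; programs cannot read
them. -/
structure Config where
  pc : ℕ
  reg : ℕ → ℕ
  arr : List ℕ
  swaps : List (ℕ × ℕ)
  lookups : ℕ

/-- Assign a register and go to the next instruction. -/
def Config.assign (s : Config) (r v : ℕ) : Config :=
  { s with pc := s.pc + 1, reg := Function.update s.reg r v }

/-- The effect of one instruction. -/
def Instr.exec (s : Config) : Instr → Config
  | .const r c => s.assign r c
  | .move r a => s.assign r (s.reg a)
  | .add r a b => s.assign r (s.reg a + s.reg b)
  | .sub r a b => s.assign r (s.reg a - s.reg b)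
  | .mul r a b => s.assign r (s.reg a * s.reg b)
  | .div r a b => s.assign r (s.reg a / s.reg b)
  | .jump l => { s with pc := l }
  | .jumpLt r a l => { s with pc := if s.reg r < s.reg a then l else s.pc + 1 }
  | .jumpEq r a l => { s with pc := if s.reg r = s.reg a then l else s.pc + 1 }
  | .load r i => s.assign r (s.arr.getD (s.reg i) 0)
  | .swap i j =>
    { s with
      pc := s.pc + 1
      arr := exchange s.arr (s.reg i) (s.reg j)
      swaps := s.swaps ++ [(s.reg i, s.reg j)] }
  | .first r i =>
    { s.assign r ((firstColumn s.arr).getD (s.reg i) 0) with lookups := s.lookups + 1 }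

/-- A program; it is fixed, so it uses a constant number of registers. -/
abbrev Program := List Instr

/-- The program uses no first-column lookups, only elementary instructions. -/
def Program.Elementary (P : Program) : Prop := ∀ r i : ℕ, Instr.first r i ∉ P

/-- One step; the machine stops when the instruction number is outside the program. -/
def Program.step (P : Program) (s : Config) : Config :=
  match P[s.pc]? with
  | none => s
  | some ins => ins.exec s

/-- At the start register `0` holds the length of the array, and all other registers hold `0`. -/
def startConfig (A : List ℕ) : Config :=
  { pc := 0, reg := Function.update (fun _ => 0) 0 A.length, arr := A, swaps := [], lookups := 0 }

/-- The configuration after `k` steps on the input array `A`. -/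
def Program.run (P : Program) (A : List ℕ) (k : ℕ) : Config := P.step^[k] (startConfig A)

/-- On input `A` the program stops after at most `b` steps, no register ever exceeds `W`, and the
final configuration has property `Q`. -/
def Program.Computes (P : Program) (A : List ℕ) (b W : ℕ) (Q : Config → Prop) : Prop :=
  ∃ k ≤ b, P.length ≤ (P.run A k).pc ∧ (∀ j ≤ k, ∀ r, (P.run A j).reg r ≤ W) ∧ Q (P.run A k)

/-- `T` is a nonempty text over the alphabet `{1, ..., (n + 1)^κ}`, where `n` is its length. -/
def IsText (κ : ℕ) (T : List ℕ) : Prop :=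
  T ≠ [] ∧ ∀ c ∈ T, 1 ≤ c ∧ c ≤ (T.length + 1) ^ κ

/-- `A` is the bijective transform of `T$`, i.e. `$` followed by the bijective transform of `T`. -/
def IsOutput (T A : List ℕ) : Prop := IsBBWT (T ++ [0]) A ∧ ∃ B, A = 0 :: B ∧ IsBBWT T B

/-! Every conjugate becomes a row: an infinite word as key and its last character as label. Each
array in question lists the labels in the order of the keys (`SortedArr`), and each position is a
number of rows below some key. In the keys of the conjugates of `V$` everything behind the delimiter
may be replaced by zeros (`trunc`), so these keys are the suffixes of `V` padded with zeros.
Prepending its label to every key permutes the keys, up to the treatment of the delimiter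
(`stageRows_scons`). Hence a backward step `lfc` with the character `c` sends the number of rows
below `X` to the number of rows below `cX`, and likewise with "at most" instead of "below"
(`SortedArr.lfc_keyCount`, `keyCount_stageRows_lt`, `keyCount_stageRows_le`).

Let `w` be the next factor and `V` the text behind it, so that `V$ < wV$`. Cutting out `w` exchanges
the labels of the rows `V$` and `wV$` and replaces each key `w[k..]V$` by the larger key
`w[k..]w^ω`. By `CutContext.newKey_lt_oldKey` a new key never overtakes a larger old key of another
row of `w`. So the rows of `w` can be moved one at a time, the last one first, by runs of adjacent
swaps whose start `rowPos` and end `rowEnd` are those of the original array. Both obey backward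
steps with the characters of `w`, and their differences are the counts in the statement. Since `w^ω`
is the new key at `0` as well as at `|w|`, the counts close up, and so does the LF-cycle of `w`.

The conversion on the fly must find the number of rows up to `w^ω`. Reading `w` backward once turns
the number of rows below `w^j V$` into that for `w^(j+1) V$`, and these numbers increase until they
are stable. If `w` repeats the preceding factor, the value found there is still right, and one pass
recognizes this. A pass costs `O(n|w|)`, so quadratic time requires that the sum of (number of
passes) times `|w|` be linear. A pass number of at least two forces an equally long power of `w`
inside a later factor (`CutContext.le_passCount_runIn`). Charge the length of this power to its
place in a shortest factor containing it. Places charged by different words are disjoint, because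
intervals up to next smaller suffixes are laminar, and overlapping runs would put one run inside a
shorter factor (`sum_run_length_le`).

The conversion by elementary instructions decodes the text into the array itself, finds each factor
as the stretch up to the next smaller suffix, and inserts its rows by backward steps into a growing
transform at the front.

Both programs are written in a small structured language with a step-counting semantics (`Exec`,
`Spec`) and compiled to jumps (`Exec.reach`). -/

/-! ## Infinite words -/

/-- Infinite words with the lexicographic order. -/
def InfWord : Type := Lex (ℕ → ℕ)

noncomputable instance : LinearOrder InfWord := inferInstanceAs (LinearOrder (Lex (ℕ → ℕ)))

def InfWord.mk (f : ℕ → ℕ) : InfWord := toLex f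

def InfWord.get (X : InfWord) (i : ℕ) : ℕ := ofLex X i

@[simp] theorem InfWord.get_mk (f : ℕ → ℕ) (i : ℕ) : (InfWord.mk f).get i = f i := rfl

/-- The infinite power of a word. -/
def omegaKey (w : List ℕ) : InfWord := omegaWord w

theorem omegaKey_get (w : List ℕ) (i : ℕ) : (omegaKey w).get i = w.getD (i % w.length) 0 := rfl

/-- Prepend a character. -/
def scons (c : ℕ) (X : InfWord) : InfWord := .mk fun i => Nat.casesOn i c fun j => X.get j

/-- Prepend a finite word. -/
def app (u : List ℕ) (X : InfWord) : InfWord := u.foldr scons X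

def zeroWord : InfWord := .mk fun _ => 0

/-- The word `V` followed by zeros only. -/
def dollarKey (V : List ℕ) : InfWord := app V zeroWord

@[simp] theorem app_nil (X : InfWord) : app [] X = X := rfl

@[simp] theorem app_cons (c : ℕ) (u : List ℕ) (X : InfWord) : app (c :: u) X = scons c (app u X) := rfl

theorem app_append (u v : List ℕ) (X : InfWord) : app (u ++ v) X = app u (app v X) := by
  simp [app]

theorem infWord_lt_iff {X Y : InfWord} :
    X < Y ↔ ∃ i, (∀ j < i, X.get j = Y.get j) ∧ X.get i < Y.get i := Iff.rfl

theorem infWord_ext {X Y : InfWord} (h : ∀ i, X.get i = Y.get i) : X = Y :=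
  funext h

theorem scons_lt_scons {c d : ℕ} {X Y : InfWord} :
    scons c X < scons d Y ↔ c < d ∨ c = d ∧ X < Y := by
  constructor
  · rintro ⟨i, h1, h2⟩
    cases i with
    | zero => exact Or.inl h2
    | succ i =>
      exact Or.inr ⟨h1 0 (Nat.succ_pos i), i, fun j hj => h1 (j + 1) (Nat.succ_lt_succ hj), h2⟩
  · rintro (h | ⟨rfl, i, h1, h2⟩)
    · exact ⟨0, fun j hj => absurd hj (Nat.not_lt_zero j), h⟩
    · refine ⟨i + 1, fun j hj => ?_, h2⟩
      cases j with
      | zero => rfl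
      | succ j => exact h1 j (Nat.lt_of_succ_lt_succ hj)

theorem scons_inj {c d : ℕ} {X Y : InfWord} : scons c X = scons d Y ↔ c = d ∧ X = Y := by
  constructor
  · intro h
    exact ⟨congrFun (congrArg InfWord.get h) 0,
      infWord_ext fun i => congrFun (congrArg InfWord.get h) (i + 1)⟩
  · rintro ⟨rfl, rfl⟩; rfl

theorem scons_le_scons {c d : ℕ} {X Y : InfWord} :
    scons c X ≤ scons d Y ↔ c < d ∨ c = d ∧ X ≤ Y := by
  rw [le_iff_lt_or_eq, scons_lt_scons, scons_inj, le_iff_lt_or_eq]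
  tauto

theorem app_lt_app {u : List ℕ} {X Y : InfWord} : app u X < app u Y ↔ X < Y := by
  induction u with
  | nil => rfl
  | cons c u ih => simp [scons_lt_scons, ih]

theorem app_le_app {u : List ℕ} {X Y : InfWord} : app u X ≤ app u Y ↔ X ≤ Y := by
  rw [← not_lt, ← not_lt, app_lt_app]

theorem app_apply (u : List ℕ) (X : InfWord) (i : ℕ) :
    (app u X).get i = if i < u.length then u.getD i 0 else X.get (i - u.length) := by
  induction u generalizing i with
  | nil => simp
  | cons c u ih =>
    cases i with
    | zero => simp [scons]
    | succ i =>
      have : (app (c :: u) X).get (i + 1) = (app u X).get i := rfl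
      rw [this, ih]; simp

theorem scons_zero_zeroWord : scons 0 zeroWord = zeroWord := by
  apply infWord_ext; intro i; cases i <;> rfl

theorem zeroWord_le (X : InfWord) : zeroWord ≤ X := by
  by_contra h
  obtain ⟨i, -, h⟩ := not_le.1 h
  exact Nat.not_lt_zero _ h

/-- `a` is smaller than `b` because of a mismatch. -/
def StrongLt (a b : List ℕ) : Prop :=
  (∀ X Y, app a X < app b Y) ∧ ∀ s t, a ++ s < b ++ t

/-- The first mismatch, if there is one, decides the comparison for all finite and infinite
continuations; otherwise one word is a prefix of the other. Most comparisons below split into these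
four cases. -/
theorem strongLt_or (a b : List ℕ) : StrongLt a b ∨ StrongLt b a ∨ a <+: b ∨ b <+: a := by
  induction a generalizing b with
  | nil => simp
  | cons c a ih =>
    cases b with
    | nil => simp
    | cons d b =>
      rcases lt_trichotomy c d with h | rfl | h
      · exact Or.inl ⟨fun X Y => scons_lt_scons.2 (Or.inl h), fun s t => List.cons_lt_cons_iff.2 (Or.inl h)⟩
      · rcases ih b with h | h | h | h
        · exact Or.inl ⟨fun X Y => scons_lt_scons.2 (Or.inr ⟨rfl, h.1 X Y⟩),
            fun s t => List.cons_lt_cons_iff.2 (Or.inr ⟨rfl, h.2 s t⟩)⟩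
        · exact Or.inr (Or.inl ⟨fun X Y => scons_lt_scons.2 (Or.inr ⟨rfl, h.1 X Y⟩),
            fun s t => List.cons_lt_cons_iff.2 (Or.inr ⟨rfl, h.2 s t⟩)⟩)
        · exact Or.inr (Or.inr (Or.inl (List.cons_prefix_cons.2 ⟨rfl, h⟩)))
        · exact Or.inr (Or.inr (Or.inr (List.cons_prefix_cons.2 ⟨rfl, h⟩)))
      · exact Or.inr (Or.inl ⟨fun X Y => scons_lt_scons.2 (Or.inl h), fun s t => List.cons_lt_cons_iff.2 (Or.inl h)⟩)

theorem StrongLt.lt {a b : List ℕ} (h : StrongLt a b) : a < b := by simpa using h.2 [] []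

theorem append_lt_append_iff {a s t : List ℕ} : a ++ s < a ++ t ↔ s < t := by
  induction a with
  | nil => rfl
  | cons c a ih => simp [ih]

theorem lt_append_self {a s : List ℕ} (h : s ≠ []) : a < a ++ s := by
  have : a ++ [] < a ++ s := by
    rw [append_lt_append_iff]
    cases s with
    | nil => exact absurd rfl h
    | cons c s => exact List.nil_lt_cons c s
  simpa using this

theorem prefix_le {a b : List ℕ} (h : a <+: b) : a ≤ b := by
  obtain ⟨s, rfl⟩ := h
  by_cases hs : s = []
  · simp [hs]
  · exact le_of_lt (lt_append_self hs)

/-- A smaller word without a mismatch would be a prefix of the larger one. Here `w` is too long to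
be a prefix of `z`, and a prefix `z` of `w` would not be larger than `w`. -/
theorem IsLyndon.strongLt {w z : List ℕ} (hw : IsLyndon w) (hz : z <:+ w) (h0 : z ≠ []) (h1 : z ≠ w) :
    StrongLt w z := by
  have hlt := hw.2 z hz h0 h1
  rcases strongLt_or w z with h | h | h | h
  · exact h
  · exact absurd h.lt (lt_asymm hlt)
  · exact absurd (hz.eq_of_length_le h.length_le) h1
  · exact absurd (prefix_le h) (not_le.2 hlt)

/-- Powers of a word. -/
def wordPow (w : List ℕ) : ℕ → List ℕ
  | 0 => []
  | j + 1 => w ++ wordPow w j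

theorem wordPow_length (w : List ℕ) (j : ℕ) : (wordPow w j).length = j * w.length := by
  induction j with
  | zero => simp [wordPow]
  | succ j ih => simp [wordPow, ih, Nat.succ_mul, Nat.add_comm]

theorem wordPow_add (w : List ℕ) (i j : ℕ) : wordPow w (i + j) = wordPow w i ++ wordPow w j := by
  induction i with
  | zero => simp [wordPow]
  | succ i ih => rw [Nat.succ_add]; simp [wordPow, ih]

theorem wordPow_one (w : List ℕ) : wordPow w 1 = w := by simp [wordPow]

theorem wordPow_succ' (w : List ℕ) (j : ℕ) : wordPow w (j + 1) = wordPow w j ++ w := by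
  rw [wordPow_add, wordPow_one]

/-! ### Comparison with the infinite power of a word -/

theorem omegaKey_eq_app {w : List ℕ} (hw : w ≠ []) : omegaKey w = app w (omegaKey w) := by
  have hl : 0 < w.length := List.length_pos_iff.2 hw
  apply infWord_ext
  intro i
  rw [app_apply]
  simp only [omegaKey_get]
  split_ifs with h
  · rw [Nat.mod_eq_of_lt h]
  · rw [← Nat.mod_eq_sub_mod (not_lt.1 h)]

theorem eq_app_wordPow {w : List ℕ} {X : InfWord} (h : X = app w X) (j : ℕ) :
    X = app (wordPow w j) X := by
  induction j with
  | zero => rfl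
  | succ j ih => rw [wordPow, app_append, ← ih, ← h]

theorem omegaKey_eq_app_wordPow {w : List ℕ} (hw : w ≠ []) (j : ℕ) :
    omegaKey w = app (wordPow w j) (omegaKey w) := eq_app_wordPow (omegaKey_eq_app hw) j

theorem app_apply_congr {u : List ℕ} {X Y : InfWord} {i : ℕ} (h : i < u.length) :
    (app u X).get i = (app u Y).get i := by
  rw [app_apply, app_apply, if_pos h, if_pos h]

theorem lt_wordPow_length {w : List ℕ} (hw : w ≠ []) (i : ℕ) : i < (wordPow w (i + 1)).length := by
  rw [wordPow_length]
  have : 0 < w.length := List.length_pos_iff.2 hw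
  nlinarith

/-- The comparison is decided by the first mismatch, which lies within finitely many copies of `w`;
what follows these copies is irrelevant. -/
theorem exists_lt_app_wordPow {w : List ℕ} (hw : w ≠ []) {y : InfWord} (h : y < omegaKey w) :
    ∃ j, ∀ X, y < app (wordPow w j) X := by
  obtain ⟨i, h1, h2⟩ := h
  refine ⟨i + 1, fun X => ⟨i, fun j hj => ?_, ?_⟩⟩
  · rw [h1 j hj, omegaKey_eq_app_wordPow hw (i + 1)]
    exact app_apply_congr (hj.trans (lt_wordPow_length hw i))
  · rw [omegaKey_eq_app_wordPow hw (i + 1)] at h2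
    exact h2.trans_eq (app_apply_congr (lt_wordPow_length hw i))

theorem exists_app_wordPow_lt {w : List ℕ} (hw : w ≠ []) {y : InfWord} (h : omegaKey w < y) :
    ∃ j, ∀ X, app (wordPow w j) X < y := by
  obtain ⟨i, h1, h2⟩ := h
  refine ⟨i + 1, fun X => ⟨i, fun j hj => ?_, ?_⟩⟩
  · rw [← h1 j hj, omegaKey_eq_app_wordPow hw (i + 1)]
    exact app_apply_congr (hj.trans (lt_wordPow_length hw i))
  · rw [omegaKey_eq_app_wordPow hw (i + 1)] at h2
    exact (app_apply_congr (lt_wordPow_length hw i)).trans_lt h2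

theorem le_app_wordPow {w : List ℕ} {X : InfWord} (h : X ≤ app w X) (j : ℕ) :
    X ≤ app (wordPow w j) X := by
  induction j with
  | zero => exact le_rfl
  | succ j ih => rw [wordPow, app_append]; exact h.trans (app_le_app.2 ih)

theorem app_wordPow_le {w : List ℕ} {X : InfWord} (h : app w X ≤ X) (j : ℕ) :
    app (wordPow w j) X ≤ X := by
  induction j with
  | zero => exact le_rfl
  | succ j ih => rw [wordPow, app_append]; exact (app_le_app.2 ih).trans h

/-- Iterating the hypothesis gives `X ≤ w^j X` for all `j`. If `X` were above `w^ω`, some `w^j X`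
would already be below `X`. -/
theorem lt_omegaKey {w : List ℕ} (hw : w ≠ []) {X : InfWord} (h : X < app w X) :
    X < omegaKey w := by
  rcases lt_trichotomy X (omegaKey w) with h' | h' | h'
  · exact h'
  · rw [h', ← omegaKey_eq_app hw] at h; exact absurd h (lt_irrefl _)
  · obtain ⟨j, hj⟩ := exists_app_wordPow_lt hw h'
    exact absurd (hj X) (not_lt.2 (le_app_wordPow h.le j))

theorem omegaKey_lt {w : List ℕ} (hw : w ≠ []) {X : InfWord} (h : app w X < X) :
    omegaKey w < X := by
  rcases lt_trichotomy X (omegaKey w) with h' | h' | h'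
  · obtain ⟨j, hj⟩ := exists_lt_app_wordPow hw h'
    exact absurd (hj X) (not_lt.2 (app_wordPow_le h.le j))
  · rw [h', ← omegaKey_eq_app hw] at h; exact absurd h (lt_irrefl _)
  · exact h'

theorem eq_omegaKey {w : List ℕ} (hw : w ≠ []) {X : InfWord} (h : X = app w X) :
    X = omegaKey w := by
  rcases lt_trichotomy X (omegaKey w) with h' | h' | h'
  · obtain ⟨j, hj⟩ := exists_lt_app_wordPow hw h'
    exact absurd (hj X) (by rw [← eq_app_wordPow h j]; exact lt_irrefl _)
  · exact h'
  · obtain ⟨j, hj⟩ := exists_app_wordPow_lt hw h'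
    exact absurd (hj X) (by rw [← eq_app_wordPow h j]; exact lt_irrefl _)

theorem app_lt_of_omegaKey_lt {w : List ℕ} (hw : w ≠ []) {X : InfWord} (h : omegaKey w < X) :
    app w X < X := by
  rcases lt_trichotomy X (app w X) with h' | h' | h'
  · exact absurd (lt_omegaKey hw h') (lt_asymm h)
  · exact absurd (eq_omegaKey hw h') h.ne'
  · exact h'

/-- The right-hand side is unchanged by prepending the rotated word, and `eq_omegaKey` says that
only the infinite power has this property. -/
theorem omegaKey_rotate {w : List ℕ} (hw : w ≠ []) {k : ℕ} (hk : k ≤ w.length) :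
    omegaKey (w.rotate k) = app (w.drop k) (omegaKey w) := by
  symm
  apply eq_omegaKey (by simpa using hw)
  rw [List.rotate_eq_drop_append_take hk, app_append, ← app_append (w.take k), List.take_append_drop,
    ← omegaKey_eq_app hw]

/-- Position `|y||z| - 1` is the end of a copy of `y` and also the end of a copy of `z`. -/
theorem getLastD_eq_of_omegaKey_eq {y z : List ℕ} (hy : y ≠ []) (hz : z ≠ [])
    (h : omegaKey y = omegaKey z) : y.getLastD 0 = z.getLastD 0 := by
  have key : ∀ (y : List ℕ), y ≠ [] → ∀ b, 0 < b →
      (omegaKey y).get (y.length * b - 1) = y.getLastD 0 := by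
    intro y hy b hb
    have hl : 0 < y.length := List.length_pos_iff.2 hy
    have : (y.length * b - 1) % y.length = y.length - 1 := by
      obtain ⟨b, rfl⟩ : ∃ b', b = b' + 1 := ⟨b - 1, by omega⟩
      have : y.length * (b + 1) - 1 = y.length - 1 + y.length * b := by
        rw [Nat.mul_succ]; omega
      rw [this, Nat.add_mul_mod_self_left, Nat.mod_eq_of_lt (by omega)]
    simp only [omegaKey_get]
    rw [this, List.getD_eq_getElem _ _ (by omega), List.getLastD_eq_getLast?, List.getLast?_eq_getElem?,
      List.getElem?_eq_getElem (by omega)]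
    rfl
  have h1 := key y hy z.length (List.length_pos_iff.2 hz)
  have h2 := key z hz y.length (List.length_pos_iff.2 hy)
  rw [← h1, ← h2, h, Nat.mul_comm]

theorem omegaKey_lt_iff {u v : List ℕ} (h : u.length = v.length) (hu : u ≠ []) :
    omegaKey u < omegaKey v ↔ u < v := by
  have hv : v ≠ [] := by intro h'; subst h'; exact hu (List.length_eq_zero_iff.1 h)
  rw [omegaKey_eq_app hu, omegaKey_eq_app hv]
  rcases strongLt_or u v with h1 | h1 | h1 | h1
  · exact iff_of_true (h1.1 _ _) h1.lt
  · exact iff_of_false (lt_asymm (h1.1 _ _)) (lt_asymm h1.lt)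
  · have := h1.eq_of_length h
    subst this; simp only [lt_irrefl]
  · have := h1.eq_of_length h.symm
    subst this; simp only [lt_irrefl]

/-! ## Truncation after the delimiter -/

open Classical in
/-- Replace everything after the first `0` by zeros. -/
noncomputable def trunc (X : InfWord) : InfWord :=
  .mk fun i => if ∃ j < i, X.get j = 0 then 0 else X.get i

/-- If a zero occurs before the first mismatch, both words have it and are truncated to the same
word. Otherwise the mismatch survives the truncation. -/
theorem trunc_mono {X Y : InfWord} (h : X ≤ Y) : trunc X ≤ trunc Y := by
  rcases h.lt_or_eq with h | rfl
  · obtain ⟨i, h1, h2⟩ := infWord_lt_iff.1 h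
    by_cases hz : ∃ j < i, X.get j = 0
    · apply le_of_eq
      apply infWord_ext
      intro l
      simp only [trunc, InfWord.get_mk]
      obtain ⟨j, hj, h0⟩ := hz
      have h0' : Y.get j = 0 := by rw [← h1 j hj, h0]
      by_cases hl : l < i
      · rw [h1 l hl]
        congr 1
        apply propext
        constructor
        · rintro ⟨k, hk, h⟩; exact ⟨k, hk, by rw [← h1 k (hk.trans hl)]; exact h⟩
        · rintro ⟨k, hk, h⟩; exact ⟨k, hk, by rw [h1 k (hk.trans hl)]; exact h⟩
      · rw [if_pos ⟨j, by omega, h0⟩, if_pos ⟨j, by omega, h0'⟩]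
    · apply le_of_lt
      have hz' : ∀ l ≤ i, ¬ ∃ j < l, X.get j = 0 := fun l hl ⟨j, hj, h⟩ => hz ⟨j, by omega, h⟩
      have hz'' : ∀ l ≤ i, ¬ ∃ j < l, Y.get j = 0 := fun l hl ⟨j, hj, h⟩ =>
        hz ⟨j, by omega, by rw [h1 j (by omega)]; exact h⟩
      refine infWord_lt_iff.2 ⟨i, fun l hl => ?_, ?_⟩
      · simp only [trunc, InfWord.get_mk]
        rw [if_neg (hz' l hl.le), if_neg (hz'' l hl.le), h1 l hl]
      · simp only [trunc, InfWord.get_mk]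
        rw [if_neg (hz' i le_rfl), if_neg (hz'' i le_rfl)]
        exact h2
  · exact le_rfl

theorem trunc_eq_self {X : InfWord} (h : ∀ i, X.get i ≠ 0) : trunc X = X := by
  apply infWord_ext
  intro i
  simp only [trunc, InfWord.get_mk]
  rw [if_neg]
  rintro ⟨j, -, hj⟩
  exact h j hj

theorem trunc_scons {c : ℕ} (hc : c ≠ 0) (X : InfWord) : trunc (scons c X) = scons c (trunc X) := by
  apply infWord_ext
  intro i
  cases i with
  | zero => simp [trunc, scons]
  | succ i =>
    have e : ∀ Y : InfWord, (scons c Y).get (i + 1) = Y.get i := fun Y => rfl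
    rw [e]
    simp only [trunc, InfWord.get_mk]
    rw [e]
    congr 1
    apply propext
    constructor
    · rintro ⟨j, hj, h⟩
      cases j with
      | zero => exact absurd h hc
      | succ j => exact ⟨j, by omega, h⟩
    · rintro ⟨j, hj, h⟩
      exact ⟨j + 1, by omega, h⟩

theorem trunc_scons_zero (X : InfWord) : trunc (scons 0 X) = zeroWord := by
  apply infWord_ext
  intro i
  cases i with
  | zero => simp [trunc, scons, zeroWord]
  | succ i =>
    simp only [trunc, InfWord.get_mk, zeroWord]
    rw [if_pos ⟨0, by omega, rfl⟩]

theorem trunc_app_dollar {V : List ℕ} (hV : ∀ c ∈ V, 1 ≤ c) (X : InfWord) :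
    trunc (app V (scons 0 X)) = dollarKey V := by
  induction V with
  | nil => exact trunc_scons_zero X
  | cons c V ih =>
    have := hV c (by simp)
    rw [app_cons, trunc_scons (by omega), ih fun d hd => hV d (by simp [hd])]
    rfl

theorem dollarKey_cons (c : ℕ) (V : List ℕ) : dollarKey (c :: V) = scons c (dollarKey V) := rfl

theorem dollarKey_append (u V : List ℕ) : dollarKey (u ++ V) = app u (dollarKey V) := app_append _ _ _

/-- Letters are positive, so the padding by zeros behaves like an end marker that makes a proper
prefix smaller. -/
theorem dollarKey_lt_iff {V V' : List ℕ} (hV : ∀ c ∈ V, 1 ≤ c) (hV' : ∀ c ∈ V', 1 ≤ c) :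
    dollarKey V < dollarKey V' ↔ V < V' := by
  induction V generalizing V' with
  | nil =>
    cases V' with
    | nil => simp only [lt_irrefl]
    | cons d V' =>
      have := hV' d (by simp)
      refine iff_of_true ?_ (List.nil_lt_cons d V')
      change zeroWord < scons d (dollarKey V')
      rw [← scons_zero_zeroWord, scons_lt_scons]; omega
  | cons c V ih =>
    cases V' with
    | nil =>
      refine iff_of_false (not_lt.2 (zeroWord_le _)) (List.not_lt_nil _)
    | cons d V' =>
      rw [dollarKey_cons, dollarKey_cons, scons_lt_scons, List.cons_lt_cons_iff,
        ih (fun d hd => hV d (by simp [hd])) (fun d hd => hV' d (by simp [hd]))]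

theorem dollarKey_inj {V V' : List ℕ} (hV : ∀ c ∈ V, 1 ≤ c) (hV' : ∀ c ∈ V', 1 ≤ c)
    (h : dollarKey V = dollarKey V') : V = V' :=
  le_antisymm (not_lt.1 fun h' => ((dollarKey_lt_iff hV' hV).2 h').ne h.symm)
    (not_lt.1 fun h' => ((dollarKey_lt_iff hV hV').2 h').ne h)

/-- Positions behind a finite word over positive characters hold `0`. -/
theorem dollarKey_apply_length (V : List ℕ) : (dollarKey V).get V.length = 0 := by
  rw [dollarKey, app_apply]; simp [zeroWord]

theorem omegaKey_apply_ne_zero {w : List ℕ} (hw : w ≠ []) (h : ∀ c ∈ w, 1 ≤ c) (i : ℕ) :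
    (omegaKey w).get i ≠ 0 := by
  have hl : i % w.length < w.length := Nat.mod_lt _ (List.length_pos_iff.2 hw)
  simp only [omegaKey_get]
  rw [List.getD_eq_getElem _ _ hl]
  have := h _ (List.getElem_mem hl)
  omega

/-! ## Lyndon words -/

theorem IsLyndon.strongLt_drop {w : List ℕ} (hw : IsLyndon w) {k : ℕ} (h1 : 1 ≤ k) (h2 : k < w.length) :
    StrongLt w (w.drop k) := by
  apply hw.strongLt (List.drop_suffix k w)
  · intro h; have := congrArg List.length h; simp at this; omega
  · intro h; have := congrArg List.length h; simp at this; omega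

/-- Only the case `w' = wz` is not decided at once. There `w'` is smaller than its suffix `z` by a
mismatch, so `w w'^ω < w z w'^ω = w'^ω`, and `omegaKey_lt` applies. -/
theorem IsLyndon.omegaKey_lt_omegaKey {w w' : List ℕ} (hw : IsLyndon w) (hw' : IsLyndon w')
    (h : w < w') : omegaKey w < omegaKey w' := by
  rcases strongLt_or w w' with h1 | h1 | ⟨z, rfl⟩ | h1
  · rw [omegaKey_eq_app hw.1, omegaKey_eq_app hw'.1]; exact h1.1 _ _
  · exact absurd h1.lt (lt_asymm h)
  · have hz : z ≠ [] := by rintro rfl; simp at h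
    apply omegaKey_lt hw.1
    have hs : StrongLt (w ++ z) z := hw'.strongLt (List.suffix_append w z) hz (by
      intro e; have := congrArg List.length e; simp at this; exact hw.1 this)
    have h2 : omegaKey (w ++ z) < app z (omegaKey (w ++ z)) := by
      conv_lhs => rw [omegaKey_eq_app hw'.1]
      exact hs.1 _ _
    have h3 : app w (omegaKey (w ++ z)) < app w (app z (omegaKey (w ++ z))) := app_lt_app.2 h2
    rwa [← app_append, ← omegaKey_eq_app hw'.1] at h3
  · exact absurd (prefix_le h1) (not_le.2 h)

theorem IsLyndon.omegaKey_le_omegaKey {w w' : List ℕ} (hw : IsLyndon w) (hw' : IsLyndon w')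
    (h : w ≤ w') : omegaKey w ≤ omegaKey w' := by
  rcases h.lt_or_eq with h | rfl
  · exact (hw.omegaKey_lt_omegaKey hw' h).le
  · exact le_rfl

/-! ## Counting in multisets -/

open Classical in
/-- The number of elements with property `P`. -/
noncomputable def pcount {α : Type*} (P : α → Prop) (M : Multiset α) : ℕ := M.countP P

theorem pcount_zero {α : Type*} (P : α → Prop) : pcount P 0 = 0 := by
  classical exact Multiset.countP_zero _

theorem pcount_cons_pos {α : Type*} {P : α → Prop} {a : α} {M : Multiset α} (h : P a) :
    pcount P (a ::ₘ M) = pcount P M + 1 := by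
  classical exact Multiset.countP_cons_of_pos _ h

theorem pcount_cons_neg {α : Type*} {P : α → Prop} {a : α} {M : Multiset α} (h : ¬ P a) :
    pcount P (a ::ₘ M) = pcount P M := by
  classical exact Multiset.countP_cons_of_neg _ h

theorem pcount_add {α : Type*} (P : α → Prop) (M M' : Multiset α) :
    pcount P (M + M') = pcount P M + pcount P M' := by
  classical exact Multiset.countP_add _ _ _

theorem pcount_map {α β : Type*} (P : β → Prop) (f : α → β) (M : Multiset α) :
    pcount P (M.map f) = pcount (fun a => P (f a)) M := by
  classical rw [pcount, pcount, Multiset.countP_map, Multiset.countP_eq_card_filter]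

theorem pcount_congr {α : Type*} {P Q : α → Prop} {M : Multiset α} (h : ∀ a ∈ M, (P a ↔ Q a)) :
    pcount P M = pcount Q M := by
  classical exact Multiset.countP_congr rfl fun a ha => propext (h a ha)

theorem pcount_mono {α : Type*} {P Q : α → Prop} {M : Multiset α} (h : ∀ a ∈ M, P a → Q a) :
    pcount P M ≤ pcount Q M := by
  induction M using Multiset.induction_on with
  | empty => simp [pcount_zero]
  | cons a M ih =>
    have ih := ih fun b hb => h b (Multiset.mem_cons_of_mem hb)
    by_cases hP : P a
    · rw [pcount_cons_pos hP, pcount_cons_pos (h a (Multiset.mem_cons_self a M) hP)]; omega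
    · rw [pcount_cons_neg hP]
      by_cases hQ : Q a
      · rw [pcount_cons_pos hQ]; omega
      · rw [pcount_cons_neg hQ]; omega

theorem pcount_le_card {α : Type*} (P : α → Prop) (M : Multiset α) : pcount P M ≤ M.card := by
  classical exact Multiset.countP_le_card _ _

theorem pcount_lt {α : Type*} {P Q : α → Prop} {M : Multiset α} (h : ∀ a ∈ M, P a → Q a) {a : α}
    (ha : a ∈ M) (hP : ¬ P a) (hQ : Q a) : pcount P M < pcount Q M := by
  obtain ⟨M, rfl⟩ := Multiset.exists_cons_of_mem ha
  rw [pcount_cons_neg hP, pcount_cons_pos hQ]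
  have := pcount_mono (M := M) fun b hb => h b (Multiset.mem_cons_of_mem hb)
  omega

theorem exists_of_pcount_lt {α : Type*} {P Q : α → Prop} {M : Multiset α}
    (h : pcount P M < pcount Q M) : ∃ a ∈ M, Q a ∧ ¬ P a := by
  by_contra hc
  push Not at hc
  exact absurd (pcount_mono hc) (not_le.2 h)

theorem pcount_eq_zero {α : Type*} {P : α → Prop} {M : Multiset α} (h : ∀ a ∈ M, ¬ P a) :
    pcount P M = 0 := by
  classical
  rw [pcount, Multiset.countP_eq_zero]; exact h

theorem pcount_coe {α : Type*} (P : α → Prop) [DecidablePred P] (l : List α) :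
    pcount P (l : Multiset α) = l.countP (fun a => decide (P a)) := by
  rw [pcount, Multiset.coe_countP]
  congr!

/-! ## Sorted lists -/

/-- A property that is closed downwards holds exactly on an initial segment of a sorted list. This
is why numbers of rows can serve as positions. -/
theorem sorted_eq_filter_append {α : Type*} {R : α → α → Prop} {Y : List α} (hY : Y.Pairwise R)
    (D : α → Prop) [DecidablePred D] (hD : ∀ a b, R a b → D b → D a) :
    Y = Y.filter (fun a => decide (D a)) ++ Y.filter (fun a => decide (¬ D a)) := by
  induction Y with
  | nil => rfl
  | cons y Y ih =>
    rw [List.pairwise_cons] at hY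
    by_cases h : D y
    · rw [List.filter_cons_of_pos (by simpa using h), List.filter_cons_of_neg (by simpa using h),
        List.cons_append, ← ih hY.2]
    · have : Y.filter (fun a => decide (D a)) = [] := by
        rw [List.filter_eq_nil_iff]
        intro a ha
        simpa using fun h' => h (hD y a (hY.1 a ha) h')
      have h2 := ih hY.2
      rw [this, List.nil_append] at h2
      rw [List.filter_cons_of_neg (by simpa using h), List.filter_cons_of_pos (by simpa using h), this,
        List.nil_append, ← h2]

theorem sorted_take {α : Type*} {R : α → α → Prop} {Y : List α} (hY : Y.Pairwise R)
    (D : α → Prop) [DecidablePred D] (hD : ∀ a b, R a b → D b → D a) :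
    Y.take (pcount D (Y : Multiset α)) = Y.filter (fun a => decide (D a)) := by
  conv_lhs => rw [sorted_eq_filter_append hY D hD]
  rw [List.take_left']
  rw [pcount_coe, ← sorted_eq_filter_append hY D hD, List.countP_eq_length_filter]

theorem sorted_drop {α : Type*} {R : α → α → Prop} {Y : List α} (hY : Y.Pairwise R)
    (D : α → Prop) [DecidablePred D] (hD : ∀ a b, R a b → D b → D a) :
    Y.drop (pcount D (Y : Multiset α)) = Y.filter (fun a => decide (¬ D a)) := by
  conv_lhs => rw [sorted_eq_filter_append hY D hD]
  rw [List.drop_left']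
  rw [pcount_coe, ← sorted_eq_filter_append hY D hD, List.countP_eq_length_filter]

/-! ## Arrays of labels sorted by keys -/

/-- `A` lists the labels of the pairs (key, label) in `M` in the order of the keys. -/
def SortedArr (M : Multiset (InfWord × ℕ)) (A : List ℕ) : Prop :=
  ∃ Y : List (InfWord × ℕ), (Y : Multiset (InfWord × ℕ)) = M ∧
    Y.Pairwise (fun a b => a.1 ≤ b.1) ∧ A = Y.map Prod.snd

/-- A set of keys closed downwards. -/
def IsLowerKey (D : InfWord → Prop) : Prop := ∀ a b, a ≤ b → D b → D a

theorem isLowerKey_lt (X : InfWord) : IsLowerKey (· < X) := fun _ _ h h' => lt_of_le_of_lt h h'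

theorem isLowerKey_le (X : InfWord) : IsLowerKey (· ≤ X) := fun _ _ h h' => le_trans h h'

/-- The number of pairs whose key has property `D`. -/
noncomputable def keyCount (D : InfWord → Prop) (M : Multiset (InfWord × ℕ)) : ℕ :=
  pcount (fun p => D p.1) M

/-- The number of characters smaller than `c` plus the number of occurrences of `c` before `p`. -/
def lfc (A : List ℕ) (c p : ℕ) : ℕ := A.countP (fun a => decide (a < c)) + rank A c p

/-- The number of labels smaller than `c` plus the number of labels `c` with keys in `D`. -/
noncomputable def labelCount (c : ℕ) (D : InfWord → Prop) (M : Multiset (InfWord × ℕ)) : ℕ :=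
  pcount (fun p => p.2 < c ∨ p.2 = c ∧ D p.1) M

theorem keyCount_map_scons_lt (M : Multiset (InfWord × ℕ)) (c : ℕ) (X : InfWord) :
    pcount (· < scons c X) (M.map fun p => scons p.2 p.1) = labelCount c (· < X) M := by
  rw [pcount_map]
  exact pcount_congr fun a _ => scons_lt_scons

theorem keyCount_map_scons_le (M : Multiset (InfWord × ℕ)) (c : ℕ) (X : InfWord) :
    pcount (· ≤ scons c X) (M.map fun p => scons p.2 p.1) = labelCount c (· ≤ X) M := by
  rw [pcount_map]
  exact pcount_congr fun a _ => scons_le_scons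

theorem keyCount_eq_pcount_map (D : InfWord → Prop) (M : Multiset (InfWord × ℕ)) :
    keyCount D M = pcount D (M.map Prod.fst) := by rw [pcount_map]; rfl

theorem SortedArr.length {M : Multiset (InfWord × ℕ)} {A : List ℕ} (h : SortedArr M A) :
    A.length = M.card := by
  obtain ⟨Y, rfl, -, rfl⟩ := h
  simp

theorem SortedArr.coe {M : Multiset (InfWord × ℕ)} {A : List ℕ} (h : SortedArr M A) :
    (A : Multiset ℕ) = M.map Prod.snd := by
  obtain ⟨Y, rfl, -, rfl⟩ := h
  simp

/-- The keys in a lower set occupy the first places, so the rank of `c` at that position counts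
precisely the labels `c` whose keys lie in the set. -/
theorem SortedArr.lfc_keyCount {M : Multiset (InfWord × ℕ)} {A : List ℕ} (h : SortedArr M A) (c : ℕ)
    {D : InfWord → Prop} (hD : IsLowerKey D) : lfc A c (keyCount D M) = labelCount c D M := by
  classical
  obtain ⟨Y, rfl, hY, rfl⟩ := h
  have h1 := sorted_take hY (fun p => D p.1) fun a b hab => hD a.1 b.1 hab
  rw [lfc, rank, keyCount, ← List.map_take, h1, labelCount, List.countP_map,
    pcount_coe]
  clear h1 hY
  induction Y with
  | nil => rfl
  | cons y Y ih =>
    simp only [List.countP_cons, List.filter_cons, ← ih]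
    by_cases h1 : D y.1 <;> by_cases h2 : y.2 = c
    · simp [h1, h2]; omega
    · simp [h1, h2]
      omega
    · simp [h1, h2]
    · simp [h1, h2]
      omega

/-- Sorting fixes the order of rows only up to equal keys; if equal keys have equal labels, the
choice is invisible in the array. -/
theorem SortedArr.unique {M : Multiset (InfWord × ℕ)} {A A' : List ℕ} (h : SortedArr M A)
    (h' : SortedArr M A') (hM : ∀ a ∈ M, ∀ b ∈ M, a.1 = b.1 → a.2 = b.2) : A = A' := by
  obtain ⟨Y, rfl, hY, rfl⟩ := h
  obtain ⟨Y', hp, hY', rfl⟩ := h'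
  have hp : Y'.Perm Y := Multiset.coe_eq_coe.1 hp
  congr 1
  refine List.Perm.eq_of_pairwise (fun a b ha hb h1 h2 => ?_) hY hY' hp.symm
  have e := le_antisymm h1 h2
  exact Prod.ext e (hM a ha b (hp.mem_iff.1 hb) e)

theorem SortedArr.getD_eq {M : Multiset (InfWord × ℕ)} {A : List ℕ} (h : SortedArr M A) {X : InfWord}
    {l : ℕ} (hl : ∀ b ∈ M, b.1 = X → b.2 = l) {p : ℕ} (h1 : keyCount (· < X) M ≤ p)
    (h2 : p < keyCount (· ≤ X) M) : A.getD p 0 = l := by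
  classical
  obtain ⟨Y, rfl, hY, rfl⟩ := h
  have hp : p < Y.length := h2.trans_le (pcount_le_card _ _)
  have h3 := sorted_take hY (fun p => p.1 ≤ X) fun a b hab => isLowerKey_le X a.1 b.1 hab
  have h4 := sorted_drop hY (fun p => p.1 < X) fun a b hab => isLowerKey_lt X a.1 b.1 hab
  have m1 : Y[p] ∈ Y.take (pcount (fun p => p.1 ≤ X) (Y : Multiset (InfWord × ℕ))) :=
    List.mem_take_iff_getElem.2 ⟨p, by simp only [lt_min_iff]; exact ⟨h2, hp⟩, rfl⟩
  have m2 : Y[p] ∈ Y.drop (pcount (fun p => p.1 < X) (Y : Multiset (InfWord × ℕ))) := by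
    rw [List.mem_drop_iff_getElem]
    have h1 : pcount (fun p => p.1 < X) (Y : Multiset (InfWord × ℕ)) ≤ p := h1
    exact ⟨p - pcount (fun p => p.1 < X) (Y : Multiset (InfWord × ℕ)), by omega, by congr 1; omega⟩
  rw [h3] at m1
  rw [h4] at m2
  have e1 := (List.mem_filter.1 m1).2
  have e2 := (List.mem_filter.1 m2).2
  simp only [decide_eq_true_eq, not_lt] at e1 e2
  rw [List.getD_eq_getElem _ _ (by simpa using hp), List.getElem_map]
  exact hl _ (List.getElem_mem hp) (le_antisymm e1 e2)

theorem SortedArr.insert {M : Multiset (InfWord × ℕ)} {A : List ℕ} (h : SortedArr M A)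
    (a : InfWord × ℕ) {D : InfWord → Prop} (hD : IsLowerKey D) (h1 : ∀ b ∈ M, D b.1 → b.1 ≤ a.1)
    (h2 : ∀ b ∈ M, ¬ D b.1 → a.1 ≤ b.1) :
    SortedArr (a ::ₘ M) (A.take (keyCount D M) ++ a.2 :: A.drop (keyCount D M)) := by
  classical
  obtain ⟨Y, rfl, hY, rfl⟩ := h
  have h3 := sorted_take hY (fun p => D p.1) fun a b hab => hD a.1 b.1 hab
  have h4 := sorted_drop hY (fun p => D p.1) fun a b hab => hD a.1 b.1 hab
  have h5 := sorted_eq_filter_append hY (fun p => D p.1) fun a b hab => hD a.1 b.1 hab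
  refine ⟨Y.filter (fun p => decide (D p.1)) ++ a :: Y.filter (fun p => decide (¬ D p.1)), ?_, ?_, ?_⟩
  · conv_rhs => rw [h5]
    rw [Multiset.cons_coe, Multiset.coe_eq_coe]
    exact List.perm_middle
  · rw [List.pairwise_append, List.pairwise_cons]
    refine ⟨hY.filter _, ⟨fun b hb => ?_, hY.filter _⟩, fun b hb b' hb' => ?_⟩
    · rw [List.mem_filter] at hb
      exact h2 b hb.1 (by simpa using hb.2)
    · rw [List.mem_filter] at hb
      have hb1 : b.1 ≤ a.1 := h1 b hb.1 (by simpa using hb.2)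
      rcases List.mem_cons.1 hb' with rfl | hb'
      · exact hb1
      · rw [List.mem_filter] at hb'
        exact hb1.trans (h2 b' hb'.1 (by simpa using hb'.2))
  · rw [← List.map_take, ← List.map_drop, keyCount, h3, h4]
    simp

theorem SortedArr.insert_lt {M : Multiset (InfWord × ℕ)} {A : List ℕ} (h : SortedArr M A)
    (a : InfWord × ℕ) :
    SortedArr (a ::ₘ M) (A.take (keyCount (· < a.1) M) ++ a.2 :: A.drop (keyCount (· < a.1) M)) :=
  h.insert a (isLowerKey_lt a.1) (fun _ _ h => le_of_lt h) fun _ _ h => not_lt.1 h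

theorem SortedArr.insert_le {M : Multiset (InfWord × ℕ)} {A : List ℕ} (h : SortedArr M A)
    (a : InfWord × ℕ) :
    SortedArr (a ::ₘ M) (A.take (keyCount (· ≤ a.1) M) ++ a.2 :: A.drop (keyCount (· ≤ a.1) M)) :=
  h.insert a (isLowerKey_le a.1) (fun _ _ h => h) fun _ _ h => le_of_lt (not_le.1 h)

/-- A row whose key occurs once has a definite place, and deleting it leaves a sorted array of the
other rows. -/
theorem SortedArr.split {M : Multiset (InfWord × ℕ)} {A : List ℕ} {a : InfWord × ℕ}
    (h : SortedArr (a ::ₘ M) A) (ha : ∀ b ∈ M, b.1 ≠ a.1) :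
    ∃ A1 A2, A = A1 ++ a.2 :: A2 ∧ A1.length = keyCount (· < a.1) M ∧ SortedArr M (A1 ++ A2) := by
  classical
  obtain ⟨Y, hp, hY, rfl⟩ := h
  have hmem : a ∈ Y := by
    rw [← Multiset.mem_coe, hp]; exact Multiset.mem_cons_self a M
  obtain ⟨Y1, Y2, rfl⟩ := List.append_of_mem hmem
  have hM : ((Y1 ++ Y2 : List (InfWord × ℕ)) : Multiset (InfWord × ℕ)) = M := by
    rw [← Multiset.cons_inj_right a, ← hp, Multiset.cons_coe, Multiset.coe_eq_coe]
    exact List.perm_middle.symm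
  subst hM
  rw [List.pairwise_append, List.pairwise_cons] at hY
  refine ⟨Y1.map Prod.snd, Y2.map Prod.snd, by simp, ?_, Y1 ++ Y2, rfl, ?_, by simp⟩
  · rw [keyCount, ← Multiset.coe_add, pcount_add, pcount_coe (fun p => p.1 < a.1) Y1,
      List.countP_eq_length.2, pcount_eq_zero, List.length_map]
    · rfl
    · intro b hb
      exact not_lt.2 (hY.2.1.1 b hb)
    · intro b hb
      have h1 : b.1 ≤ a.1 := hY.2.2 b hb a (by simp)
      exact decide_eq_true (lt_of_le_of_ne h1 (ha b (by simp [hb])))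
  · rw [List.pairwise_append]
    exact ⟨hY.1, hY.2.1.2, fun b hb b' hb' => hY.2.2 b hb b' (by simp [hb'])⟩

theorem SortedArr.relabel {M : Multiset (InfWord × ℕ)} {A : List ℕ} {a : InfWord × ℕ}
    (h : SortedArr (a ::ₘ M) A) (ha : ∀ b ∈ M, b.1 ≠ a.1) (l : ℕ) :
    SortedArr ((a.1, l) ::ₘ M) (A.set (keyCount (· < a.1) M) l) ∧
      A.getD (keyCount (· < a.1) M) 0 = a.2 ∧ keyCount (· < a.1) M < A.length := by
  obtain ⟨A1, A2, rfl, h1, h2⟩ := h.split ha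
  have h3 := h2.insert_lt (a.1, l)
  simp only [← h1] at h3 ⊢
  simp only [List.take_left', List.drop_left'] at h3
  simpa using h3

/-! ## The mappings `lf` and `fl` -/

theorem filter_range_getD (N : ℕ) (P : ℕ → Bool) (j : ℕ) (hj : j < N) (h : P j = true) :
    ((List.range N).filter P).getD ((List.range j).countP P) 0 = j := by
  obtain ⟨r, rfl⟩ : ∃ r, N = j + (r + 1) := ⟨N - j - 1, by omega⟩
  rw [List.range_add, List.filter_append, List.countP_eq_length_filter, List.getD_append_right _ _ _ _ le_rfl,
    Nat.sub_self, List.range_succ_eq_map, List.map_cons]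
  rw [List.filter_cons_of_pos (by simpa using h)]
  simp

theorem countP_range_eq_count_take (A : List ℕ) (c j : ℕ) (hj : j ≤ A.length) :
    (List.range j).countP (fun i => decide (A.getD i 0 = c)) = (A.take j).count c := by
  induction j with
  | zero => simp
  | succ j ih =>
    rw [List.range_succ, List.countP_append, ih (by omega), List.take_add_one,
      List.count_append, List.getElem?_eq_getElem (by omega)]
    simp [List.getElem?_eq_getElem (show j < A.length by omega), List.countP_cons, List.count_cons]

theorem select_rank {A : List ℕ} {c j : ℕ} (hj : j < A.length) (h : A.getD j 0 = c) :
    select A c (rank A c j) = j := by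
  rw [select, rank, ← countP_range_eq_count_take A c j hj.le]
  exact filter_range_getD _ _ j hj (by simpa using h)

theorem firstColumn_perm (A : List ℕ) : (firstColumn A).Perm A := List.mergeSort_perm _ _

theorem firstColumn_sorted (A : List ℕ) : (firstColumn A).Pairwise (· ≤ ·) := by
  have := List.pairwise_mergeSort (le := fun a b : ℕ => decide (a ≤ b))
    (fun a b c => by simpa using le_trans) (fun a b => by simpa using le_total a b) A
  simpa [firstColumn] using this

/-- The sorted column consists of the smaller characters, the block of `c` and the larger
characters. This turns `select` and `rank` on the first column into arithmetic. -/
theorem firstColumn_split (A : List ℕ) (c : ℕ) :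
    ∃ l1 l3 : List ℕ, firstColumn A = l1 ++ List.replicate (A.count c) c ++ l3 ∧
      l1.length = A.countP (fun a => decide (a < c)) ∧ c ∉ l1 := by
  classical
  have hs := firstColumn_sorted A
  have h1 := sorted_eq_filter_append hs (· < c) fun a b hab hb => lt_of_le_of_lt hab hb
  have h2 := sorted_eq_filter_append (hs.filter (fun a => decide (¬ a < c))) (· ≤ c)
    fun a b hab hb => le_trans hab hb
  refine ⟨(firstColumn A).filter (fun a => decide (a < c)),
    ((firstColumn A).filter (fun a => decide (¬ a < c))).filter (fun a => decide (¬ a ≤ c)),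
    ?_, ?_, ?_⟩
  · conv_lhs => rw [h1, h2]
    rw [List.append_assoc]
    congr 2
    rw [List.filter_filter, List.eq_replicate_iff]
    constructor
    · rw [← List.countP_eq_length_filter, ← (firstColumn_perm A).count_eq, List.count_eq_countP]
      congr 1
      funext a
      rw [Bool.eq_iff_iff]
      simp
      omega
    · intro a ha
      have := (List.mem_filter.1 ha).2
      simp at this
      omega
  · rw [← List.countP_eq_length_filter, (firstColumn_perm A).countP_eq]
  · intro h
    have := (List.mem_filter.1 h).2
    simp at this

theorem firstColumn_getD {A : List ℕ} {c k : ℕ} (hk : k < A.count c) :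
    (firstColumn A).getD (A.countP (fun a => decide (a < c)) + k) 0 = c := by
  obtain ⟨l1, l3, h, hl, -⟩ := firstColumn_split A c
  rw [h, ← hl, List.append_assoc, List.getD_append_right _ _ _ _ (by omega), Nat.add_sub_cancel_left,
    List.getD_append _ _ _ _ (by simpa using hk), List.getD_eq_getElem _ _ (by simpa using hk)]
  simp

theorem rank_firstColumn {A : List ℕ} {c k : ℕ} (hk : k ≤ A.count c) :
    rank (firstColumn A) c (A.countP (fun a => decide (a < c)) + k) = k := by
  obtain ⟨l1, l3, h, hl, hc⟩ := firstColumn_split A c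
  rw [rank, h, ← hl, List.append_assoc, List.take_length_add_append, List.count_append,
    List.count_eq_zero_of_not_mem hc, List.take_append_of_le_length (by simpa using hk), List.take_replicate]
  simp [hk]

theorem countP_lt_add_count_le (A : List ℕ) (c : ℕ) :
    A.countP (fun a => decide (a < c)) + A.count c ≤ A.length := by
  obtain ⟨l1, l3, h, hl, hc⟩ := firstColumn_split A c
  have := congrArg List.length h
  rw [(firstColumn_perm A).length_eq] at this
  simp at this
  omega

theorem rank_lt_count {A : List ℕ} {c j : ℕ} (hj : j < A.length) (h : A.getD j 0 = c) :
    rank A c j < A.count c := by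
  rw [rank]
  conv_rhs => rw [← List.take_append_drop j A]
  rw [List.count_append, List.drop_eq_getElem_cons hj, List.count_cons]
  rw [List.getD_eq_getElem _ _ hj] at h
  simp [h]

theorem rank_le_count (A : List ℕ) (c j : ℕ) : rank A c j ≤ A.count c :=
  (List.take_sublist j A).count_le c

theorem lfc_lt {A : List ℕ} {c j : ℕ} (hj : j < A.length) (h : A.getD j 0 = c) :
    lfc A c j < A.length := by
  have := rank_lt_count hj h
  have := countP_lt_add_count_le A c
  unfold lfc
  omega

theorem lfc_le (A : List ℕ) (c j : ℕ) : lfc A c j ≤ A.length := by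
  have := rank_le_count A c j
  have := countP_lt_add_count_le A c
  unfold lfc
  omega

theorem firstColumn_lfc {A : List ℕ} {c j : ℕ} (hj : j < A.length) (h : A.getD j 0 = c) :
    (firstColumn A).getD (lfc A c j) 0 = c := firstColumn_getD (rank_lt_count hj h)

theorem lf_eq {A : List ℕ} {j : ℕ} (hj : j < A.length) : lf A j = lfc A (A.getD j 0) j := by
  have h := rank_lt_count hj rfl
  have hf := firstColumn_lfc hj rfl
  have hl : lfc A (A.getD j 0) j < (firstColumn A).length := by
    rw [(firstColumn_perm A).length_eq]; exact lfc_lt hj rfl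
  have := select_rank hl hf
  rw [lfc, rank_firstColumn h.le] at this
  exact this

theorem fl_lfc {A : List ℕ} {c j : ℕ} (hj : j < A.length) (h : A.getD j 0 = c) :
    fl A (lfc A c j) = j := by
  rw [fl, firstColumn_lfc hj h, lfc, rank_firstColumn (rank_lt_count hj h).le]
  exact select_rank hj h

/-- The counted interval is open on the left and closed on the right, while `rank` counts strictly
before a position; hence both ranks are taken one place further. -/
theorem countIn_add_rank (A : List ℕ) (c a b : ℕ) (hab : a ≤ b) (hb : b < A.length) :
    countIn A c a b + rank A c (a + 1) = rank A c (b + 1) := by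
  induction b, hab using Nat.le_induction with
  | base => simp [countIn]
  | succ b hab ih =>
    have h1 : countIn A c a (b + 1) = countIn A c a b + if A.getD (b + 1) 0 = c then 1 else 0 := by
      unfold countIn
      rw [← Finset.insert_Ioc_right_eq_Ioc_add_one hab, Finset.filter_insert]
      split_ifs with h
      · rw [Finset.card_insert_of_notMem (by simp)]
      · rfl
    have h2 : rank A c (b + 1 + 1) = rank A c (b + 1) + if A.getD (b + 1) 0 = c then 1 else 0 := by
      unfold rank
      rw [List.take_add_one (i := b + 1), List.count_append, List.getElem?_eq_getElem hb, List.getD_eq_getElem _ _ hb]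
      simp [List.count_cons]
    rw [h1, h2, ← ih (by omega)]
    omega

/-! ## Exchanges -/

theorem exchange_adjacent (u v : List ℕ) (a b : ℕ) :
    exchange (u ++ a :: b :: v) u.length (u.length + 1) = u ++ b :: a :: v := by
  unfold exchange
  rw [if_pos (by simp)]
  simp [List.getD_eq_getElem?_getD]

theorem exchanges_append (A : List ℕ) (S S' : List (ℕ × ℕ)) :
    exchanges A (S ++ S') = exchanges (exchanges A S) S' := List.foldl_append

theorem swapRun_succ (p c : ℕ) : swapRun p (c + 1) = (p, p + 1) :: swapRun (p + 1) c := by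
  simp only [swapRun, List.range_succ_eq_map, List.map_cons, List.map_map]
  congr 1
  apply List.map_congr_left
  intro j _
  simp only [Function.comp, Prod.mk.injEq]
  omega

theorem swapRun_succ_last (p c : ℕ) : swapRun p (c + 1) = swapRun p c ++ [(p + c, p + c + 1)] := by
  simp [swapRun, List.range_succ]

theorem exchanges_swapRun (u mid v : List ℕ) (a : ℕ) :
    exchanges (u ++ a :: (mid ++ v)) (swapRun u.length mid.length) = u ++ mid ++ a :: v := by
  induction mid generalizing u with
  | nil => simp [swapRun, exchanges]
  | cons b mid ih =>
    rw [List.length_cons, swapRun_succ]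
    have := ih (u ++ [b])
    simp only [List.length_append, List.length_cons, List.length_nil, List.append_assoc, List.cons_append,
      List.nil_append, exchanges] at this
    simp only [exchanges, List.foldl_cons, List.cons_append, exchange_adjacent, List.append_assoc]
    exact this

/-- Moving one pair to a larger key is a run of swaps. -/
theorem SortedArr.move {M : Multiset (InfWord × ℕ)} {A : List ℕ} {x y : InfWord} {l : ℕ}
    (h : SortedArr ((x, l) ::ₘ M) A) (hx : ∀ b ∈ M, b.1 ≠ x) (hxy : x ≤ y) :
    SortedArr ((y, l) ::ₘ M)
      (exchanges A (swapRun (keyCount (· < x) M) (keyCount (· ≤ y) M - keyCount (· < x) M))) := by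
  obtain ⟨A1, A2, rfl, h1, h2⟩ := h.split hx
  have h3 := h2.insert_le (y, l)
  simp only at h1 h3
  have hle : keyCount (· < x) M ≤ keyCount (· ≤ y) M :=
    pcount_mono fun b _ hb => (lt_of_lt_of_le hb hxy).le
  have hle2 : keyCount (· ≤ y) M ≤ (A1 ++ A2).length := by
    rw [h2.length]; exact pcount_le_card _ _
  set E := keyCount (· ≤ y) M
  rw [← h1] at hle ⊢
  have e : (A2.take (E - A1.length)).length = E - A1.length := by
    rw [List.length_take]; simp at hle2; omega
  have := exchanges_swapRun A1 (A2.take (E - A1.length)) (A2.drop (E - A1.length)) l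
  rw [List.take_append_drop, e] at this
  rw [this]
  convert h3 using 1
  rw [List.take_append, List.take_of_length_le hle, List.drop_append, List.drop_of_length_le hle]
  simp

/-! ## The rows of a stage of the conversion -/

theorem range_succ_map {α : Type*} (g : ℕ → α) (n : ℕ) :
    (Multiset.range (n + 1)).map g = g 0 ::ₘ (Multiset.range n).map (fun k => g (k + 1)) := by
  change (((List.range (n + 1)).map g : List α) : Multiset α) =
    ((g 0 :: (List.range n).map (fun k => g (k + 1)) : List α) : Multiset α)
  rw [List.range_succ_eq_map]
  simp [Function.comp_def]

/-- The conjugate of `w` starting at position `k`: the key and the last character. -/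
noncomputable def wordRow (w : List ℕ) (k : ℕ) : InfWord × ℕ :=
  (app (w.drop k) (omegaKey w), if k = 0 then w.getLastD 0 else w.getD (k - 1) 0)

noncomputable def wordRows (w : List ℕ) : Multiset (InfWord × ℕ) :=
  (Multiset.range w.length).map (wordRow w)

/-- The conjugate of `V$` starting at position `k`: the key and the last character. -/
def textRow (V : List ℕ) (k : ℕ) : InfWord × ℕ :=
  (dollarKey (V.drop k), if k = 0 then 0 else V.getD (k - 1) 0)

/-- The conjugates of `V$` except for `V$`. -/
def textRest (V : List ℕ) : Multiset (InfWord × ℕ) :=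
  (Multiset.range V.length).map fun k => textRow V (k + 1)

noncomputable def wordsRows (ws : List (List ℕ)) : Multiset (InfWord × ℕ) := (ws.map wordRows).sum

/-- The conjugates of the words in `ws` and of `V$` except for `V$`. -/
noncomputable def restRows (ws : List (List ℕ)) (V : List ℕ) : Multiset (InfWord × ℕ) :=
  wordsRows ws + textRest V

/-- The conjugates of the words in `ws` and of `V$`. -/
noncomputable def stageRows (ws : List (List ℕ)) (V : List ℕ) : Multiset (InfWord × ℕ) :=
  (dollarKey V, 0) ::ₘ restRows ws V

theorem scons_getD_app_drop {w : List ℕ} {k : ℕ} (hk : k < w.length) (X : InfWord) :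
    scons (w.getD k 0) (app (w.drop (k + 1)) X) = app (w.drop k) X := by
  rw [List.drop_eq_getElem_cons hk, List.getD_eq_getElem _ _ hk]; rfl

theorem getLastD_eq_getD (w : List ℕ) : w.getLastD 0 = w.getD (w.length - 1) 0 := by
  rw [List.getLastD_eq_getLast?, List.getLast?_eq_getElem?, List.getD_eq_getElem?_getD]

/-- Prepending the last character to a conjugate gives the conjugate starting one place earlier,
cyclically. Passing from start `0` to the last start uses that `w^ω` is its own tail behind `w`. -/
theorem wordRows_scons (w : List ℕ) :
    (wordRows w).map Prod.fst = (wordRows w).map fun p => scons p.2 p.1 := by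
  unfold wordRows
  rw [Multiset.map_map, Multiset.map_map]
  rcases h : w.length with - | n
  · simp
  · have hw : w ≠ [] := by rintro rfl; simp at h
    rw [range_succ_map (fun k => ((fun p : InfWord × ℕ => scons p.2 p.1) ∘ wordRow w) k),
      Multiset.range_succ, Multiset.map_cons]
    congr 1
    · simp only [Function.comp, wordRow, if_true, List.drop_zero]
      rw [← omegaKey_eq_app hw, getLastD_eq_getD, h, Nat.add_sub_cancel]
      conv_rhs => rw [← app_nil (omegaKey w), ← List.drop_of_length_le h.le,
        scons_getD_app_drop (by omega)]
    · apply Multiset.map_congr rfl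
      intro k hk
      rw [Multiset.mem_range] at hk
      simp only [Function.comp, wordRow, Nat.add_sub_cancel, if_neg (Nat.succ_ne_zero k)]
      rw [scons_getD_app_drop (by omega)]

theorem wordsRows_scons (ws : List (List ℕ)) :
    (wordsRows ws).map Prod.fst = (wordsRows ws).map fun p => scons p.2 p.1 := by
  unfold wordsRows
  induction ws with
  | nil => rfl
  | cons w ws ih =>
    rw [List.map_cons, List.sum_cons, Multiset.map_add, Multiset.map_add, ih, wordRows_scons]

/-- The same shift along `V$` is not cyclic: the rows `1, ..., |V|` go to the rows `0, ..., |V| -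
1`, and the row of the delimiter alone is supplied separately. -/
theorem textRest_scons (V : List ℕ) :
    dollarKey V ::ₘ (textRest V).map Prod.fst = zeroWord ::ₘ (textRest V).map fun p => scons p.2 p.1 := by
  unfold textRest
  rw [Multiset.map_map, Multiset.map_map]
  have h1 := range_succ_map (fun k => dollarKey (V.drop k)) V.length
  rw [Multiset.range_succ, Multiset.map_cons, List.drop_length] at h1
  rw [List.drop_zero] at h1
  simp only [Function.comp_def, textRow]
  rw [← h1]
  congr 1
  apply Multiset.map_congr rfl
  intro k hk
  rw [Multiset.mem_range] at hk
  simp only [Nat.add_sub_cancel, if_neg (Nat.succ_ne_zero k)]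
  exact (scons_getD_app_drop hk _).symm

/-- This is the correctness of the LF mapping in the form of an identity of multisets of keys. -/
theorem stageRows_scons (ws : List (List ℕ)) (V : List ℕ) :
    (stageRows ws V).map Prod.fst = zeroWord ::ₘ (restRows ws V).map fun p => scons p.2 p.1 := by
  unfold stageRows restRows
  rw [Multiset.map_cons, Multiset.map_add, Multiset.map_add, wordsRows_scons,
    ← Multiset.add_cons, ← Multiset.add_cons, ← textRest_scons]

theorem zeroWord_lt_scons {c : ℕ} (hc : 1 ≤ c) (X : InfWord) : zeroWord < scons c X := by
  rw [← scons_zero_zeroWord, scons_lt_scons]; omega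

/-- The two sides treat the delimiter differently but both count it once: on the left as the key
consisting of zeros, on the right as the label `0`, which is smaller than `c`. -/
theorem keyCount_stageRows_lt (ws : List (List ℕ)) (V : List ℕ) {c : ℕ} (hc : 1 ≤ c) (X : InfWord) :
    keyCount (· < scons c X) (stageRows ws V) = labelCount c (· < X) (stageRows ws V) := by
  rw [keyCount_eq_pcount_map, stageRows_scons, pcount_cons_pos (P := (· < scons c X)) (zeroWord_lt_scons hc X),
    keyCount_map_scons_lt, labelCount, labelCount, stageRows, pcount_cons_pos]
  exact Or.inl hc

theorem keyCount_stageRows_le (ws : List (List ℕ)) (V : List ℕ) {c : ℕ} (hc : 1 ≤ c) (X : InfWord) :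
    keyCount (· ≤ scons c X) (stageRows ws V) = labelCount c (· ≤ X) (stageRows ws V) := by
  rw [keyCount_eq_pcount_map, stageRows_scons, pcount_cons_pos (P := (· ≤ scons c X)) (zeroWord_lt_scons hc X).le,
    keyCount_map_scons_le, labelCount, labelCount, stageRows, pcount_cons_pos]
  exact Or.inl hc

/-! ## The transforms as sorted arrays -/

theorem getLastD_append_cons (u v : List ℕ) (c : ℕ) : (u ++ c :: v).getLastD 0 = (c :: v).getLastD 0 := by
  simp [List.getLastD_eq_getLast?, List.getLast?_append, List.getLast?_cons]

theorem getLastD_rotate {w : List ℕ} {k : ℕ} (hk : k < w.length) :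
    (w.rotate k).getLastD 0 = if k = 0 then w.getLastD 0 else w.getD (k - 1) 0 := by
  split_ifs with h
  · subst h; simp
  · rw [List.rotate_eq_drop_append_take hk.le]
    obtain ⟨j, rfl⟩ : ∃ j, k = j + 1 := ⟨k - 1, by omega⟩
    rw [List.take_add_one, List.getElem?_eq_getElem (by omega), Option.toList_some,
      ← List.append_assoc, getLastD_append_cons, Nat.add_sub_cancel, List.getD_eq_getElem _ _ (by omega)]
    rfl

theorem coe_map_conjugates (w : List ℕ) :
    (((conjugates w).map fun u => (omegaKey u, u.getLastD 0) : List (InfWord × ℕ)) :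
      Multiset (InfWord × ℕ)) = wordRows w := by
  rw [conjugates, List.map_map]
  change Multiset.map _ (Multiset.range w.length) = _
  apply Multiset.map_congr rfl
  intro k hk
  rw [Multiset.mem_range] at hk
  have hw : w ≠ [] := by rintro rfl; simp at hk
  simp only [Function.comp, wordRow]
  rw [omegaKey_rotate hw hk.le, getLastD_rotate hk]

theorem coe_map_flatMap_conjugates (ws : List (List ℕ)) :
    (((ws.flatMap conjugates).map fun u => (omegaKey u, u.getLastD 0) : List (InfWord × ℕ)) :
      Multiset (InfWord × ℕ)) = wordsRows ws := by
  induction ws with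
  | nil => rfl
  | cons w ws ih =>
    rw [List.flatMap_cons, List.map_append, ← Multiset.coe_add, ih, coe_map_conjugates]
    rfl

theorem coe_map_conjugates_dollar {V : List ℕ} (hV : ∀ c ∈ V, 1 ≤ c) :
    (((conjugates (V ++ [0])).map fun u => (trunc (omegaKey u), u.getLastD 0) : List (InfWord × ℕ)) :
      Multiset (InfWord × ℕ)) = (dollarKey V, 0) ::ₘ textRest V := by
  rw [conjugates, List.map_map]
  have e : (dollarKey V, 0) ::ₘ textRest V = (Multiset.range (V ++ [0]).length).map (textRow V) := by
    rw [List.length_append, List.length_singleton, range_succ_map]; rfl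
  rw [e]
  change Multiset.map _ (Multiset.range _) = _
  apply Multiset.map_congr rfl
  intro k hk
  rw [Multiset.mem_range] at hk
  have hk' : k ≤ V.length := by simp at hk; omega
  simp only [Function.comp, textRow]
  rw [omegaKey_rotate (by simp) hk.le, getLastD_rotate hk, List.drop_append_of_le_length hk', app_append,
    app_cons, app_nil, trunc_app_dollar fun c hc => hV c (List.mem_of_mem_drop hc)]
  congr 1
  split_ifs with h
  · rw [getLastD_append_cons]; rfl
  · rw [List.getD_append _ _ _ _ (by omega)]

/-- A list sorted by infinite powers stays sorted under any monotone image of the keys. The identity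
and `trunc` are the images needed. -/
theorem ebwt_aux (ws : List (List ℕ)) (f : InfWord → InfWord) (hf : ∀ X Y, X ≤ Y → f X ≤ f Y) :
    SortedArr (((ws.flatMap conjugates).map fun u => (f (omegaKey u), u.getLastD 0) :
      List (InfWord × ℕ)) : Multiset (InfWord × ℕ)) (ebwt ws) := by
  classical
  refine ⟨_, Multiset.coe_eq_coe.2 ((List.mergeSort_perm (ws.flatMap conjugates)
    (fun u v => decide (omegaWord u ≤ omegaWord v))).map _), ?_, ?_⟩
  · rw [List.pairwise_map]
    have := List.pairwise_mergeSort (le := fun u v : List ℕ => decide (omegaWord u ≤ omegaWord v))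
      (fun a b c => by simpa using le_trans) (fun a b => by simpa using le_total (omegaWord a) (omegaWord b))
      (ws.flatMap conjugates)
    refine this.imp fun {a b} h => hf _ _ ?_
    have h' := of_decide_eq_true h
    exact h'
  · rw [List.map_map]
    unfold ebwt
    congr!

theorem ebwt_sortedArr (ws : List (List ℕ)) : SortedArr (wordsRows ws) (ebwt ws) := by
  have := ebwt_aux ws id fun X Y h => h
  rwa [← coe_map_flatMap_conjugates]

theorem wordsRows_get_ne_zero {ws : List (List ℕ)} (hws : ∀ w ∈ ws, ∀ c ∈ w, 1 ≤ c)
    {a : InfWord × ℕ} (ha : a ∈ wordsRows ws) :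
    (∀ i, a.1.get i ≠ 0) ∧ ∃ y, y ≠ [] ∧ a = (omegaKey y, y.getLastD 0) := by
  rw [← coe_map_flatMap_conjugates, Multiset.mem_coe, List.mem_map] at ha
  obtain ⟨y, hy, rfl⟩ := ha
  obtain ⟨w, hw, hy⟩ := List.mem_flatMap.1 hy
  obtain ⟨k, hk, rfl⟩ := List.mem_map.1 hy
  have hw0 : w ≠ [] := by rintro rfl; simp at hk
  have hr : w.rotate k ≠ [] := by simpa using hw0
  refine ⟨omegaKey_apply_ne_zero hr fun c hc => hws w hw c (by simpa using hc), _, hr, rfl⟩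

theorem mem_wordsRows {ws : List (List ℕ)} {a : InfWord × ℕ} :
    a ∈ wordsRows ws ↔ ∃ w ∈ ws, ∃ k < w.length, a = wordRow w k := by
  unfold wordsRows
  induction ws with
  | nil => simp
  | cons w ws ih =>
    rw [List.map_cons, List.sum_cons, Multiset.mem_add, ih]
    simp [wordRows, eq_comm]

theorem mem_textRest {V : List ℕ} {a : InfWord × ℕ} :
    a ∈ textRest V ↔ ∃ k < V.length, a = textRow V (k + 1) := by
  simp [textRest, eq_comm]

/-- Truncation does not touch the keys of words over positive letters, and it turns the keys of the
conjugates of `V$` into padded suffixes. -/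
theorem ebwt_dollar_sortedArr {ws : List (List ℕ)} {V : List ℕ} (hws : ∀ w ∈ ws, ∀ c ∈ w, 1 ≤ c)
    (hV : ∀ c ∈ V, 1 ≤ c) : SortedArr (stageRows ws V) (ebwt (ws ++ [V ++ [0]])) := by
  have h := ebwt_aux (ws ++ [V ++ [0]]) trunc fun X Y => trunc_mono
  rw [List.flatMap_append, List.map_append, ← Multiset.coe_add, List.flatMap_singleton,
    coe_map_conjugates_dollar hV] at h
  convert h using 1
  rw [stageRows, restRows, Multiset.add_cons]
  congr 2
  have e : ((ws.flatMap conjugates).map fun u => (trunc (omegaKey u), u.getLastD 0)) =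
      ((ws.flatMap conjugates).map fun u => (omegaKey u, u.getLastD 0)) := by
    apply List.map_congr_left
    intro y hy
    have : (omegaKey y, y.getLastD 0) ∈ wordsRows ws := by
      rw [← coe_map_flatMap_conjugates, Multiset.mem_coe]
      exact List.mem_map.2 ⟨y, hy, rfl⟩
    rw [trunc_eq_self (wordsRows_get_ne_zero hws this).1]
  rw [e, coe_map_flatMap_conjugates]

theorem mem_stageRows {ws : List (List ℕ)} {V : List ℕ} {a : InfWord × ℕ} :
    a ∈ stageRows ws V ↔ (∃ w ∈ ws, ∃ k < w.length, a = wordRow w k) ∨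
      ∃ k ≤ V.length, a = textRow V k := by
  rw [stageRows, restRows, Multiset.mem_cons, Multiset.mem_add, mem_wordsRows, mem_textRest]
  constructor
  · rintro (rfl | h | ⟨k, hk, rfl⟩)
    · exact Or.inr ⟨0, Nat.zero_le _, rfl⟩
    · exact Or.inl h
    · exact Or.inr ⟨k + 1, hk, rfl⟩
  · rintro (h | ⟨k, hk, rfl⟩)
    · exact Or.inr (Or.inl h)
    · cases k with
      | zero => exact Or.inl rfl
      | succ k => exact Or.inr (Or.inr ⟨k, hk, rfl⟩)

theorem textRow_fst_inj {V : List ℕ} (hV : ∀ c ∈ V, 1 ≤ c) {j k : ℕ} (hj : j ≤ V.length)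
    (hk : k ≤ V.length) (h : (textRow V j).1 = (textRow V k).1) : j = k := by
  have := dollarKey_inj (fun c hc => hV c (List.mem_of_mem_drop hc))
    (fun c hc => hV c (List.mem_of_mem_drop hc)) h
  have := congrArg List.length this
  simp at this
  omega

theorem wordRow_ne_dollarKey {ws : List (List ℕ)} (hws : ∀ w ∈ ws, ∀ c ∈ w, 1 ≤ c) {a : InfWord × ℕ}
    (ha : a ∈ wordsRows ws) (V : List ℕ) : a.1 ≠ dollarKey V := fun h =>
  (wordsRows_get_ne_zero hws ha).1 V.length (by rw [h, dollarKey_apply_length])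

/-- Equal infinite powers have the same last character. Rows of the text contain a zero in their
keys, rows of the other words do not, and different suffixes of the text differ in length. -/
theorem stageRows_label {ws : List (List ℕ)} {V : List ℕ} (hws : ∀ w ∈ ws, ∀ c ∈ w, 1 ≤ c)
    (hV : ∀ c ∈ V, 1 ≤ c) : ∀ a ∈ stageRows ws V, ∀ b ∈ stageRows ws V, a.1 = b.1 → a.2 = b.2 := by
  intro a ha b hb h
  rw [mem_stageRows, ← mem_wordsRows] at ha hb
  rcases ha with ha | ⟨j, hj, rfl⟩ <;> rcases hb with hb | ⟨k, hk, rfl⟩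
  · obtain ⟨-, y, hy, rfl⟩ := wordsRows_get_ne_zero hws ha
    obtain ⟨-, z, hz, rfl⟩ := wordsRows_get_ne_zero hws hb
    exact getLastD_eq_of_omegaKey_eq hy hz h
  · exact absurd h (wordRow_ne_dollarKey hws ha _)
  · exact absurd h.symm (wordRow_ne_dollarKey hws hb _)
  · rw [textRow_fst_inj hV hj hk h]

/-- All conjugates of one word have the same length, and for words of equal length the lexicographic
order and the order of the infinite powers agree. -/
theorem bwt_eq_ebwt {w : List ℕ} (hw : w ≠ []) : bwt w = ebwt [w] := by
  classical
  unfold bwt ebwt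
  rw [List.flatMap_singleton]
  congr 1
  refine List.Perm.eq_of_pairwise (le := fun u v => u ≤ v) (fun a b _ _ h1 h2 => le_antisymm h1 h2) ?_ ?_
    ((List.mergeSort_perm _ _).trans (List.mergeSort_perm _ _).symm)
  · have := List.pairwise_mergeSort (le := fun u v : List ℕ => decide (u ≤ v))
      (fun a b c => by simpa using le_trans) (fun a b => by simpa using le_total a b) (conjugates w)
    exact this.imp fun {a b} h => of_decide_eq_true h
  · have := List.pairwise_mergeSort (le := fun u v : List ℕ => decide (omegaWord u ≤ omegaWord v))
      (fun a b c => by simpa using le_trans) (fun a b => by simpa using le_total (omegaWord a) (omegaWord b))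
      (conjugates w)
    refine this.imp_of_mem fun {a b} ha hb h => ?_
    obtain ⟨j, hj, rfl⟩ := List.mem_map.1 ((List.mergeSort_perm _ _).mem_iff.1 ha)
    obtain ⟨k, hk, rfl⟩ := List.mem_map.1 ((List.mergeSort_perm _ _).mem_iff.1 hb)
    have h' : omegaKey (w.rotate j) ≤ omegaKey (w.rotate k) := of_decide_eq_true h
    rw [← not_lt] at h' ⊢
    rwa [omegaKey_lt_iff (by simp) (by simpa using hw)] at h'

theorem ebwt_append_dollar {ws : List (List ℕ)} (hws : ∀ w ∈ ws, ∀ c ∈ w, 1 ≤ c) :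
    ebwt (ws ++ [[0]]) = 0 :: ebwt ws := by
  have h1 := ebwt_dollar_sortedArr (V := []) hws (by simp)
  have h2 := (ebwt_sortedArr ws).insert_lt (zeroWord, 0)
  have e : keyCount (· < zeroWord) (wordsRows ws) = 0 :=
    pcount_eq_zero fun a _ => not_lt.2 (zeroWord_le _)
  rw [e] at h2
  have e2 : (zeroWord, 0) ::ₘ wordsRows ws = stageRows ws [] := by
    simp [stageRows, restRows, textRest, dollarKey]
  rw [e2] at h2
  simpa using h1.unique h2 (stageRows_label hws (by simp))

/-! ## The factorization by next smaller suffixes -/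

/-- Every factor extends to the next smaller suffix. -/
def NextSmallerFactors : List (List ℕ) → Prop
  | [] => True
  | w :: fs => w ≠ [] ∧ fs.flatten < w ++ fs.flatten ∧
      (∀ k, 1 ≤ k → k < w.length → w ++ fs.flatten < w.drop k ++ fs.flatten) ∧ NextSmallerFactors fs

/-- Cut the text in front of its longest proper suffix that is smaller than the text, and repeat.
The empty suffix guarantees that there is a place to cut. -/
theorem exists_nextSmallerFactors (T : List ℕ) : ∃ fs, fs.flatten = T ∧ NextSmallerFactors fs := by
  classical
  induction h : T.length using Nat.strong_induction_on generalizing T with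
  | _ n ih =>
    by_cases hT : T = []
    · exact ⟨[], hT.symm, trivial⟩
    · have hl : 0 < T.length := List.length_pos_iff.2 hT
      have hex : ∃ k, 1 ≤ k ∧ T.drop k < T := ⟨T.length, hl, by
        rw [List.drop_length]
        cases T with
        | nil => exact absurd rfl hT
        | cons c T => exact List.nil_lt_cons c T⟩
      obtain ⟨h1, h2⟩ := Nat.find_spec hex
      have hmin : ∀ k < Nat.find hex, 1 ≤ k → ¬ T.drop k < T := fun k hk hk1 h' =>
        Nat.find_min hex hk ⟨hk1, h'⟩
      have hle : Nat.find hex ≤ T.length := Nat.find_min' hex ⟨hl, by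
        rw [List.drop_length]
        cases T with
        | nil => exact absurd rfl hT
        | cons c T => exact List.nil_lt_cons c T⟩
      generalize Nat.find hex = m at h1 h2 hmin hle
      obtain ⟨fs, hf, hfs⟩ := ih (T.drop m).length (by rw [List.length_drop]; omega) (T.drop m) rfl
      have hdrop : ∀ k ≤ m, (T.take m).drop k ++ T.drop m = T.drop k := by
        intro k hk
        conv_rhs => rw [← List.take_append_drop m T]
        rw [List.drop_append_of_le_length (by rw [List.length_take]; omega)]
      refine ⟨T.take m :: fs, ?_, ?_, ?_, ?_, hfs⟩
      · simp [hf]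
      · intro h'
        have := congrArg List.length h'
        rw [List.length_take, List.length_nil] at this
        omega
      · rw [hf, List.take_append_drop]; exact h2
      · intro k hk1 hk2
        rw [List.length_take] at hk2
        rw [hf, List.take_append_drop, hdrop k (by omega)]
        refine lt_of_le_of_ne (not_lt.1 (hmin k (by omega) hk1)) fun h' => ?_
        have := congrArg List.length h'
        rw [List.length_drop] at this
        omega

theorem NextSmallerFactors.drop {fs : List (List ℕ)} (h : NextSmallerFactors fs) (x : ℕ) :
    NextSmallerFactors (fs.drop x) := by
  induction x generalizing fs with
  | zero => simpa using h
  | succ x ih =>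
    cases fs with
    | nil => simpa using h
    | cons w fs => exact ih h.2.2.2

/-- A mismatch between `w` and a proper suffix is seen in the whole text as well and must favour
`w`. It remains to exclude that the suffix is a border of `w`. -/
theorem NextSmallerFactors.isLyndon_head {w : List ℕ} {fs : List (List ℕ)}
    (h : NextSmallerFactors (w :: fs)) : IsLyndon w := by
  obtain ⟨h0, h1, h2, -⟩ := h
  refine ⟨h0, fun s hs hs0 hs1 => ?_⟩
  obtain ⟨k, rfl⟩ : ∃ k, s = w.drop k := ⟨_, List.suffix_iff_eq_drop.1 hs⟩
  have hk1 : 1 ≤ k := by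
    rcases Nat.eq_zero_or_pos k with rfl | hk
    · simp at hs1
    · exact hk
  have hk2 : k < w.length := by
    by_contra hk
    exact hs0 (List.drop_of_length_le (not_lt.1 hk))
  have h3 := h2 k hk1 hk2
  rcases strongLt_or w (w.drop k) with h | h | h | ⟨z, hz⟩
  · exact h.lt
  · exact absurd (h.2 _ _) (lt_asymm h3)
  · have := h.length_le
    rw [List.length_drop] at this
    omega
  -- Border case `w = w[k..] z`. Cancelling `w[k..]` gives `zF < F` for the rest `F` of the text,
  -- and `F < wF`; but `z` is itself a proper suffix of `w`, so `wF < zF`.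
  · have hz' : z = w.drop (w.length - k) := by
      conv_rhs => rw [← hz]
      rw [List.length_append, List.length_drop, List.drop_append,
        List.drop_of_length_le (by rw [List.length_drop]; have := congrArg List.length hz; simp at this; omega)]
      have := congrArg List.length hz
      simp at this
      simp [show w.length - k + z.length - k - (w.length - k) = 0 by omega]
    have h4 := h2 (w.length - k) (by omega) (by omega)
    rw [← hz'] at h4
    have h5 : w.drop k ++ (z ++ fs.flatten) < w.drop k ++ fs.flatten := by
      rw [← List.append_assoc, hz]; exact h3
    rw [append_lt_append_iff] at h5
    exact absurd (h5.trans h1) (lt_asymm h4)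

/-- The critical case is `w2 = wy`: cancelling `w` in `w2 F < w w2 F` gives `yF < w2 F`, whereas no
suffix starting inside `w2` is smaller than the one starting at `w2`. -/
theorem NextSmallerFactors.second_le {w w2 : List ℕ} {fs : List (List ℕ)}
    (h : NextSmallerFactors (w :: w2 :: fs)) : w2 ≤ w := by
  obtain ⟨h0, h1, h2, h3⟩ := h
  obtain ⟨h0', h1', h2', -⟩ := h3
  rw [List.flatten_cons] at h1 h2
  rcases strongLt_or w w2 with h | h | ⟨y, rfl⟩ | h
  · exact absurd (h.2 _ _) (lt_asymm h1)
  · exact h.lt.le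
  · by_cases hy : y = []
    · simp [hy]
    · have hl := List.length_pos_iff.2 h0
      have hl' := List.length_pos_iff.2 hy
      have h4 := h2' w.length hl (by simp; omega)
      rw [List.drop_left] at h4
      rw [List.append_assoc, append_lt_append_iff, ← List.append_assoc] at h1
      exact absurd h4 (lt_asymm h1)
  · exact prefix_le h

theorem NextSmallerFactors.isLyndonFactorization {fs : List (List ℕ)} (h : NextSmallerFactors fs) :
    IsLyndonFactorization fs.flatten fs := by
  refine ⟨rfl, ?_⟩
  induction fs with
  | nil => simp
  | cons w fs ih =>
    obtain ⟨h1, h2⟩ := ih h.2.2.2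
    refine ⟨fun u hu => ?_, ?_⟩
    · rcases List.mem_cons.1 hu with rfl | hu
      · exact h.isLyndon_head
      · exact h1 u hu
    · refine List.pairwise_cons.2 ⟨fun u hu => ?_, h2⟩
      cases fs with
      | nil => simp at hu
      | cons w2 fs =>
        have h3 := h.second_le
        rcases List.mem_cons.1 hu with rfl | hu
        · exact h3
        · exact ((List.pairwise_cons.1 h2).1 u hu).trans h3

theorem NextSmallerFactors.flatten_append_le {fs gs : List (List ℕ)} (h : NextSmallerFactors (fs ++ gs)) :
    gs.flatten ≤ (fs ++ gs).flatten := by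
  induction fs with
  | nil => exact le_rfl
  | cons w fs ih => exact (ih h.2.2.2).trans h.2.1.le

/-! ## Cutting out one factor -/

/-- `w` is the first factor of the text `w V`, and the factors in `ws` are cut out already. -/
structure CutContext (ws : List (List ℕ)) (w V : List ℕ) : Prop where
  lyndon : IsLyndon w
  pos_ws : ∀ u ∈ ws, ∀ c ∈ u, 1 ≤ c
  pos_w : ∀ c ∈ w, 1 ≤ c
  pos_V : ∀ c ∈ V, 1 ≤ c
  lt : V < w ++ V

/-- Key of the row of `wV$` starting inside `w`, before the cut. The value `k = |w|` is allowed and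
is the key of `V$`. -/
def oldKey (w V : List ℕ) (k : ℕ) : InfWord := dollarKey (w.drop k ++ V)

/-- Key of the same row after the cut. At `k = |w|` it equals the key at `0`, which closes the
cycle. -/
def newKey (w : List ℕ) (k : ℕ) : InfWord := app (w.drop k) (omegaKey w)

/-- The last character of the conjugate of `w` starting at position `k`. -/
def rowLabel (w : List ℕ) (k : ℕ) : ℕ := if k = 0 then w.getLastD 0 else w.getD (k - 1) 0

/-- The position of the row of `w V$` starting at position `k`. -/
noncomputable def rowPos (ws : List (List ℕ)) (w V : List ℕ) (k : ℕ) : ℕ :=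
  keyCount (· < oldKey w V k) (stageRows ws (w ++ V))

/-- The number of rows up to the new place of the row of `w` starting at position `k`. -/
noncomputable def rowEnd (ws : List (List ℕ)) (w V : List ℕ) (k : ℕ) : ℕ :=
  keyCount (· ≤ newKey w k) (stageRows ws (w ++ V))

/-- The keys of the rows of `w` when those from `k` on have been moved. -/
def mixedKey (w V : List ℕ) (k j : ℕ) : InfWord := if j < k then oldKey w V j else newKey w j

/-- The rows when the delimiter has been exchanged and the rows of `w` from `k` on have been moved. -/
noncomputable def cutRows (ws : List (List ℕ)) (w V : List ℕ) (k : ℕ) : Multiset (InfWord × ℕ) :=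
  (dollarKey V, 0) ::ₘ (restRows ws V +
    (Multiset.range w.length).map fun j => (mixedKey w V k j, rowLabel w j))

theorem oldKey_eq (w V : List ℕ) (k : ℕ) : oldKey w V k = app (w.drop k) (dollarKey V) :=
  dollarKey_append _ _

theorem oldKey_length (w V : List ℕ) : oldKey w V w.length = dollarKey V := by simp [oldKey]

theorem newKey_length (w : List ℕ) : newKey w w.length = omegaKey w := by simp [newKey]

theorem newKey_zero {w : List ℕ} (hw : w ≠ []) : newKey w 0 = omegaKey w := by
  rw [newKey, List.drop_zero, ← omegaKey_eq_app hw]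

theorem wordRow_eq (w : List ℕ) (k : ℕ) : wordRow w k = (newKey w k, rowLabel w k) := rfl

theorem cutRows_zero (ws : List (List ℕ)) (w V : List ℕ) :
    cutRows ws w V 0 = stageRows (ws ++ [w]) V := by
  unfold cutRows stageRows restRows wordsRows
  congr 1
  rw [List.map_append, List.sum_append, List.map_singleton, List.sum_singleton, add_right_comm]
  congr 1

/-- The states during the moves differ from the state right after the exchange only in the keys of
the rows of `w`, so it suffices to compare these rows one by one. -/
theorem pcount_cutRows {ws : List (List ℕ)} {w V : List ℕ} {P Q : InfWord × ℕ → Prop} {k : ℕ}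
    (h1 : ∀ b, (P b ↔ Q b)) (h2 : ∀ j < w.length, (P (mixedKey w V k j, rowLabel w j) ↔
      Q (oldKey w V j, rowLabel w j))) :
    pcount P (cutRows ws w V k) = pcount Q (cutRows ws w V w.length) := by
  have e : P = Q := funext fun b => propext (h1 b)
  subst e
  unfold cutRows
  rw [← Multiset.cons_add, ← Multiset.cons_add, pcount_add, pcount_add, pcount_map, pcount_map]
  congr 1
  apply pcount_congr
  intro j hj
  rw [Multiset.mem_range] at hj
  rw [h2 j hj, mixedKey, if_pos hj]

theorem keyCount_cons_pos {D : InfWord → Prop} {a : InfWord × ℕ} {M : Multiset (InfWord × ℕ)}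
    (h : D a.1) : keyCount D (a ::ₘ M) = keyCount D M + 1 := pcount_cons_pos h

theorem keyCount_cons_neg {D : InfWord → Prop} {a : InfWord × ℕ} {M : Multiset (InfWord × ℕ)}
    (h : ¬ D a.1) : keyCount D (a ::ₘ M) = keyCount D M := pcount_cons_neg h

namespace CutContext

variable {ws : List (List ℕ)} {w V : List ℕ} (h : CutContext ws w V)
include h

theorem length_pos : 0 < w.length := List.length_pos_iff.2 h.lyndon.1

theorem pos_wV : ∀ c ∈ w ++ V, 1 ≤ c := fun c hc => by
  rcases List.mem_append.1 hc with hc | hc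
  · exact h.pos_w c hc
  · exact h.pos_V c hc

theorem dollarKey_lt : dollarKey V < app w (dollarKey V) := by
  rw [← dollarKey_append, dollarKey_lt_iff h.pos_V h.pos_wV]
  exact h.lt

theorem dollarKey_lt_omegaKey : dollarKey V < omegaKey w := lt_omegaKey h.lyndon.1 h.dollarKey_lt

theorem oldKey_lt_newKey (k : ℕ) : oldKey w V k < newKey w k := by
  rw [oldKey_eq, newKey, app_lt_app]; exact h.dollarKey_lt_omegaKey

theorem oldKey_zero_lt {k : ℕ} (h1 : 1 ≤ k) (h2 : k < w.length) : oldKey w V 0 < oldKey w V k := by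
  rw [oldKey_eq, oldKey_eq, List.drop_zero]
  exact (h.lyndon.strongLt_drop h1 h2).1 _ _

theorem oldKey_length_lt_zero : oldKey w V w.length < oldKey w V 0 := by
  rw [oldKey_eq, oldKey_eq, List.drop_zero, List.drop_length]
  exact h.dollarKey_lt

theorem newKey_zero_lt {k : ℕ} (h1 : 1 ≤ k) (h2 : k < w.length) : newKey w 0 < newKey w k :=
  (h.lyndon.strongLt_drop h1 h2).1 _ _

/-- A moved row stays below every larger old key of another row of `w`. If `w[k..]` is a proper
prefix of `w[j..]`, the remaining part of `w[j..]` is a proper suffix of the Lyndon word `w`, hence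
above `w^ω` by a mismatch. If `w[j..]` is a proper prefix of `w[k..]`, the hypothesis would put a
suffix of `w` followed by `V$` below `V$`, although `V$ < wV$` and `wV$` is below that word. -/
theorem newKey_lt_oldKey {j k : ℕ} (hj : j < w.length) (hk : k < w.length) (hjk : k ≠ j)
    (hlt : oldKey w V k < oldKey w V j) : newKey w k < oldKey w V j := by
  have pre : ∀ {a b : ℕ}, w.drop a <+: w.drop b → a < w.length →
      w.drop b = w.drop a ++ w.drop (b + (w.length - a)) := by
    rintro a b ⟨z, hz⟩ -
    have : z = (w.drop b).drop (w.drop a).length := by rw [← hz, List.drop_left]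
    rw [List.length_drop, List.drop_drop] at this
    rw [← this, hz]
  rw [oldKey_eq] at hlt ⊢
  rw [oldKey_eq] at hlt
  rcases strongLt_or (w.drop k) (w.drop j) with h' | h' | h' | h'
  · exact h'.1 _ _
  · exact absurd (h'.1 _ _) (lt_asymm hlt)
  · have hl := h'.length_le
    rw [List.length_drop, List.length_drop] at hl
    rw [pre h' hk, app_append, newKey, app_lt_app, omegaKey_eq_app h.lyndon.1]
    exact (h.lyndon.strongLt_drop (by omega) (by omega)).1 _ _
  · have hl := h'.length_le
    rw [List.length_drop, List.length_drop] at hl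
    rw [pre h' hj, app_append, app_lt_app] at hlt
    have := (h.lyndon.strongLt_drop (k := k + (w.length - j)) (by omega) (by omega)).1
      (dollarKey V) (dollarKey V)
    exact absurd (h.dollarKey_lt.trans this) (lt_asymm hlt)

theorem newKey_lt_oldKey_iff {j k : ℕ} (hj : j < w.length) (hk : k < w.length) (hjk : k ≠ j) :
    newKey w j < oldKey w V k ↔ oldKey w V j < oldKey w V k :=
  ⟨fun h' => (h.oldKey_lt_newKey j).trans h', fun h' => h.newKey_lt_oldKey hk hj hjk.symm h'⟩

theorem oldKey_ne {j k : ℕ} (hj : j ≤ w.length) (hk : k ≤ w.length) (hjk : k ≠ j) :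
    oldKey w V j ≠ oldKey w V k := by
  intro h'
  have hp : ∀ i, ∀ c ∈ w.drop i ++ V, 1 ≤ c := fun i c hc => h.pos_wV c (by
    rcases List.mem_append.1 hc with hc | hc
    · exact List.mem_append_left _ (List.mem_of_mem_drop hc)
    · exact List.mem_append_right _ hc)
  have := congrArg List.length (dollarKey_inj (hp j) (hp k) h')
  simp at this
  omega

/-- Whether a row of `w` has already been moved makes no difference when the rows up to a new key
are counted. -/
theorem newKey_le_newKey_iff {j k : ℕ} (hj : j < w.length) (hk : k < w.length) :
    newKey w j ≤ newKey w k ↔ oldKey w V j ≤ newKey w k := by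
  refine ⟨fun h' => (h.oldKey_lt_newKey j).le.trans h', fun h' => ?_⟩
  rcases eq_or_ne k j with rfl | hjk
  · exact le_rfl
  rcases lt_trichotomy (oldKey w V j) (oldKey w V k) with h1 | h1 | h1
  · exact ((h.newKey_lt_oldKey hk hj hjk.symm h1).trans (h.oldKey_lt_newKey k)).le
  · exact absurd h1 (h.oldKey_ne hj.le hk.le hjk)
  · exact absurd h' (not_le.2 (h.newKey_lt_oldKey hj hk hjk h1))

theorem newKey_get (k i : ℕ) (hk : k < w.length) : (newKey w k).get i ≠ 0 := by
  rw [newKey, ← omegaKey_rotate h.lyndon.1 hk.le]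
  exact omegaKey_apply_ne_zero (by simpa using h.lyndon.1) (fun c hc => h.pos_w c (by simpa using hc)) i

theorem newKey_ne_dollarKey {k : ℕ} (hk : k < w.length) (U : List ℕ) : newKey w k ≠ dollarKey U := fun e =>
  h.newKey_get k U.length hk (by rw [e, dollarKey_apply_length])

theorem restRows_ne {k : ℕ} (hk : k < w.length) {b : InfWord × ℕ} (hb : b ∈ (dollarKey V, 0) ::ₘ restRows ws V) :
    b.1 ≠ oldKey w V k := by
  have key : ∀ i, i ≤ V.length → dollarKey (V.drop i) ≠ oldKey w V k := fun i hi e => by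
    have := congrArg List.length (dollarKey_inj (fun c hc => h.pos_V c (List.mem_of_mem_drop hc))
      (fun c hc => h.pos_wV c (by
        rcases List.mem_append.1 hc with hc | hc
        · exact List.mem_append_left _ (List.mem_of_mem_drop hc)
        · exact List.mem_append_right _ hc)) e)
    simp at this
    omega
  rcases Multiset.mem_cons.1 hb with rfl | hb
  · exact key 0 (Nat.zero_le _)
  · rcases Multiset.mem_add.1 hb with hb | hb
    · exact wordRow_ne_dollarKey h.pos_ws hb _
    · obtain ⟨i, hi, rfl⟩ := mem_textRest.1 hb
      exact key (i + 1) hi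

/-- The rows before the exchange. -/
theorem stageRows_eq : stageRows ws (w ++ V) = (oldKey w V 0, 0) ::ₘ (dollarKey V, rowLabel w 0) ::ₘ
    (restRows ws V + (Multiset.range (w.length - 1)).map fun j => (oldKey w V (j + 1), rowLabel w (j + 1))) := by
  obtain ⟨m, hm⟩ : ∃ m, w.length = m + 1 := ⟨w.length - 1, by have := h.length_pos; omega⟩
  have e0 : (oldKey w V 0, 0) = (dollarKey (w ++ V), 0) := rfl
  rw [e0, stageRows]
  congr 1
  rw [restRows, restRows]
  have e1 : textRest (w ++ V) = (dollarKey V, rowLabel w 0) ::ₘ (textRest V +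
      (Multiset.range (w.length - 1)).map fun j => (oldKey w V (j + 1), rowLabel w (j + 1))) := by
    unfold textRest
    rw [List.length_append, Multiset.range_add, Multiset.map_add, Multiset.map_map, hm, Nat.add_sub_cancel,
      Multiset.range_succ, Multiset.map_cons, Multiset.cons_add]
    congr 1
    · rw [textRow, ← hm, List.drop_left, hm, if_neg (Nat.succ_ne_zero m), Nat.add_sub_cancel, rowLabel, if_pos rfl,
        getLastD_eq_getD, hm, Nat.add_sub_cancel, List.getD_append _ _ _ _ (by omega)]
    · rw [add_comm]
      congr 1
      · apply Multiset.map_congr rfl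
        intro k hk
        rw [Multiset.mem_range] at hk
        simp only [Function.comp, textRow, if_neg (Nat.succ_ne_zero _), Nat.add_sub_cancel]
        rw [← hm, add_assoc, List.drop_append, List.drop_of_length_le (by omega), List.nil_append,
          List.getD_append_right _ _ _ _ (by omega)]
        simp
      · apply Multiset.map_congr rfl
        intro k hk
        rw [Multiset.mem_range] at hk
        simp only [textRow, rowLabel, if_neg (Nat.succ_ne_zero _), Nat.add_sub_cancel, oldKey]
        rw [List.drop_append_of_le_length (by omega), List.getD_append _ _ _ _ (by omega)]
  rw [e1, Multiset.add_cons, add_assoc]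

theorem cutRows_length : cutRows ws w V w.length = (dollarKey V, 0) ::ₘ (oldKey w V 0, rowLabel w 0) ::ₘ
    (restRows ws V + (Multiset.range (w.length - 1)).map fun j => (oldKey w V (j + 1), rowLabel w (j + 1))) := by
  obtain ⟨m, hm⟩ : ∃ m, w.length = m + 1 := ⟨w.length - 1, by have := h.length_pos; omega⟩
  unfold cutRows
  congr 1
  rw [← Multiset.add_cons]
  congr 1
  rw [hm, range_succ_map, Nat.add_sub_cancel]
  congr 1
  apply Multiset.map_congr rfl
  intro k hk
  rw [Multiset.mem_range] at hk
  rw [mixedKey, if_pos (by omega)]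

/-- The exchange permutes labels and leaves the multiset of keys alone. -/
theorem keyCount_cutRows_length (D : InfWord → Prop) :
    keyCount D (cutRows ws w V w.length) = keyCount D (stageRows ws (w ++ V)) := by
  rw [keyCount_eq_pcount_map, keyCount_eq_pcount_map, h.stageRows_eq, h.cutRows_length]
  simp only [Multiset.map_cons]
  rw [Multiset.cons_swap]

/-- Labels are counted alike before and after the exchange, behind the two exchanged rows. -/
theorem labelCount_cutRows_length (c : ℕ) {D : InfWord → Prop} (h1 : D (dollarKey V)) (h2 : D (oldKey w V 0)) :
    labelCount c D (cutRows ws w V w.length) = labelCount c D (stageRows ws (w ++ V)) := by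
  have e : ∀ (M : Multiset (InfWord × ℕ)) {X Y : InfWord} (l : ℕ), D X → D Y →
      labelCount c D ((X, l) ::ₘ M) = labelCount c D ((Y, l) ::ₘ M) := by
    intro M X Y l hX hY
    by_cases hl : l < c ∨ l = c
    · unfold labelCount
      rw [pcount_cons_pos, pcount_cons_pos] <;> simp only <;> tauto
    · unfold labelCount
      rw [pcount_cons_neg, pcount_cons_neg] <;> simp only <;> tauto
  rw [h.stageRows_eq, h.cutRows_length, e _ _ h1 h2, Multiset.cons_swap, e _ _ h2 h1, Multiset.cons_swap]

theorem mixedKey_lt_iff {j k : ℕ} (hj : j < w.length) (hk : k < w.length) :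
    mixedKey w V (k + 1) j < oldKey w V k ↔ oldKey w V j < oldKey w V k := by
  unfold mixedKey
  split_ifs with hjk
  · rfl
  · exact h.newKey_lt_oldKey_iff hj hk (by omega)

theorem mixedKey_le_iff (i : ℕ) {j k : ℕ} (hj : j < w.length) (hk : k < w.length) :
    mixedKey w V i j ≤ newKey w k ↔ oldKey w V j ≤ newKey w k := by
  unfold mixedKey
  split_ifs with hjk
  · rfl
  · exact h.newKey_le_newKey_iff hj hk

theorem keyCount_cutRows_lt {k : ℕ} (hk : k < w.length) :
    keyCount (· < oldKey w V k) (cutRows ws w V (k + 1)) = rowPos ws w V k := by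
  rw [rowPos, ← h.keyCount_cutRows_length]
  exact pcount_cutRows (fun _ => Iff.rfl) fun j hj => h.mixedKey_lt_iff hj hk

theorem keyCount_cutRows_le (i : ℕ) {k : ℕ} (hk : k < w.length) :
    keyCount (· ≤ newKey w k) (cutRows ws w V i) = rowEnd ws w V k := by
  rw [rowEnd, ← h.keyCount_cutRows_length]
  exact pcount_cutRows (fun _ => Iff.rfl) fun j hj => h.mixedKey_le_iff i hj hk

theorem labelCount_cutRows_lt (c : ℕ) {k : ℕ} (h1 : 1 ≤ k) (hk : k < w.length) :
    labelCount c (· < oldKey w V k) (cutRows ws w V (k + 1)) =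
      labelCount c (· < oldKey w V k) (stageRows ws (w ++ V)) := by
  rw [← h.labelCount_cutRows_length]
  · refine pcount_cutRows (fun _ => Iff.rfl) fun j hj => ?_
    simp only [h.mixedKey_lt_iff hj hk]
  · rw [← oldKey_length w V]
    exact h.oldKey_length_lt_zero.trans (h.oldKey_zero_lt h1 hk)
  · exact h.oldKey_zero_lt h1 hk

/-- For `k ≥ 1` both exchanged rows, `V$` and `wV$`, precede row `k`, so the exchange is invisible
to the count; earlier moves are invisible because they do not cross row `k`. -/
theorem labelCount_cutRows_le (c : ℕ) {k : ℕ} (h1 : 1 ≤ k) (hk : k < w.length) :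
    labelCount c (· ≤ newKey w k) (cutRows ws w V (k + 1)) =
      labelCount c (· ≤ newKey w k) (stageRows ws (w ++ V)) := by
  rw [← h.labelCount_cutRows_length]
  · refine pcount_cutRows (fun _ => Iff.rfl) fun j hj => ?_
    simp only [h.mixedKey_le_iff _ hj hk]
  · rw [← oldKey_length w V]
    exact ((h.oldKey_length_lt_zero.trans (h.oldKey_zero_lt h1 hk)).trans (h.oldKey_lt_newKey k)).le
  · exact ((h.oldKey_zero_lt h1 hk).trans (h.oldKey_lt_newKey k)).le

/-- Moving the row `k` of `w`. -/
theorem sortedArr_move {k : ℕ} (hk : k < w.length) {A : List ℕ} (hA : SortedArr (cutRows ws w V (k + 1)) A) :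
    SortedArr (cutRows ws w V k)
      (exchanges A (swapRun (rowPos ws w V k) (rowEnd ws w V k - 1 - rowPos ws w V k))) := by
  classical
  set R := (dollarKey V, 0) ::ₘ (restRows ws V +
    ((Multiset.range w.length).erase k).map fun j => (mixedKey w V k j, rowLabel w j)) with hR
  have e : ∀ (f : ℕ → InfWord × ℕ), (Multiset.range w.length).map f =
      f k ::ₘ ((Multiset.range w.length).erase k).map f := by
    intro f
    rw [← Multiset.map_cons, Multiset.cons_erase (Multiset.mem_range.2 hk)]
  have hmem : ∀ j ∈ (Multiset.range w.length).erase k, j < w.length ∧ j ≠ k := by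
    intro j hj
    rw [(Multiset.nodup_range _).mem_erase_iff, Multiset.mem_range] at hj
    exact ⟨hj.2, hj.1⟩
  have e1 : cutRows ws w V (k + 1) = (oldKey w V k, rowLabel w k) ::ₘ R := by
    rw [hR, cutRows, e, Multiset.add_cons, Multiset.cons_swap]
    congr 2
    · rw [mixedKey, if_pos (by omega)]
    · refine congrArg _ (Multiset.map_congr rfl fun j hj => ?_)
      have := hmem j hj
      rw [mixedKey, mixedKey]
      congr 1
      exact if_congr (by omega) rfl rfl
  have e2 : cutRows ws w V k = (newKey w k, rowLabel w k) ::ₘ R := by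
    rw [hR, cutRows, e, Multiset.add_cons, Multiset.cons_swap]
    congr 2
    rw [mixedKey, if_neg (by omega)]
  have hne : ∀ b ∈ R, b.1 ≠ oldKey w V k := by
    intro b hb
    rw [hR, ← Multiset.cons_add] at hb
    rcases Multiset.mem_add.1 hb with hb | hb
    · exact h.restRows_ne hk hb
    · obtain ⟨j, hj, rfl⟩ := Multiset.mem_map.1 hb
      have hj := hmem j hj
      simp only [mixedKey]
      split_ifs with hjk
      · exact h.oldKey_ne hj.1.le hk.le hj.2.symm
      · exact h.newKey_ne_dollarKey hj.1 _
  have h1 := h.keyCount_cutRows_lt hk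
  have h2 := h.keyCount_cutRows_le (k + 1) hk
  rw [e1] at hA h1 h2
  -- Row `k` itself is not counted below its old key, but it is counted up to its new key. This
  -- accounts for the `- 1` in the number of swaps.
  rw [keyCount_cons_neg (D := (· < oldKey w V k)) (lt_irrefl _)] at h1
  rw [keyCount_cons_pos (D := (· ≤ newKey w k)) (h.oldKey_lt_newKey k).le] at h2
  have h3 := hA.move hne (h.oldKey_lt_newKey k).le
  rw [e2, ← h1, ← h2, Nat.add_sub_cancel]
  exact h3

end CutContext

/-! ### Positions of the rows of a factor and the exchanges that move them -/

namespace CutContext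

variable {ws : List (List ℕ)} {w V : List ℕ} (h : CutContext ws w V)
include h

theorem getD_mem_pos {k : ℕ} (hk : k < w.length) : 1 ≤ w.getD k 0 := by
  rw [List.getD_eq_getElem _ _ hk]; exact h.pos_w _ (List.getElem_mem hk)

theorem oldKey_mem {k : ℕ} (hk : k ≤ w.length) :
    (oldKey w V k, if k = 0 then 0 else w.getD (k - 1) 0) ∈ stageRows ws (w ++ V) := by
  rw [mem_stageRows]
  refine Or.inr ⟨k, by simp; omega, ?_⟩
  rw [textRow, oldKey, List.drop_append_of_le_length hk]
  congr 1
  split_ifs with h0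
  · rfl
  · rw [List.getD_append _ _ _ _ (by omega)]

theorem newKey_mem {k : ℕ} (hk : k < w.length) : (newKey w k, rowLabel w k) ∈ stageRows (ws ++ [w]) V := by
  rw [mem_stageRows]
  exact Or.inl ⟨w, by simp, k, hk, rfl⟩

theorem rowPos_lt_rowPos {j k : ℕ} (hj : j ≤ w.length) (hlt : oldKey w V j < oldKey w V k) :
    rowPos ws w V j < rowPos ws w V k :=
  pcount_lt (fun _ _ hb => hb.trans hlt) (h.oldKey_mem hj) (lt_irrefl _) hlt

theorem rowPos_length_lt : rowPos ws w V w.length < rowPos ws w V 0 :=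
  h.rowPos_lt_rowPos le_rfl h.oldKey_length_lt_zero

theorem rowPos_zero_lt {k : ℕ} (h1 : 1 ≤ k) (h2 : k < w.length) : rowPos ws w V 0 < rowPos ws w V k :=
  h.rowPos_lt_rowPos (Nat.zero_le _) (h.oldKey_zero_lt h1 h2)

theorem rowPos_lt_rowEnd {k : ℕ} (hk : k ≤ w.length) : rowPos ws w V k < rowEnd ws w V k :=
  pcount_lt (fun _ _ hb => (lt_trans hb (h.oldKey_lt_newKey k)).le) (h.oldKey_mem hk) (lt_irrefl _)
    (h.oldKey_lt_newKey k).le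

/-- Both numbers refer to `w^ω`; this is what makes the recursion for the counts of swaps cyclic. -/
theorem rowEnd_length : rowEnd ws w V w.length = rowEnd ws w V 0 := by
  rw [rowEnd, rowEnd, newKey_length, newKey_zero h.lyndon.1]

theorem oldKey_eq_scons {k : ℕ} (hk : k < w.length) :
    oldKey w V k = scons (w.getD k 0) (oldKey w V (k + 1)) := by
  rw [oldKey_eq, oldKey_eq, scons_getD_app_drop hk]

omit h in
theorem newKey_eq_scons {k : ℕ} (hk : k < w.length) :
    newKey w k = scons (w.getD k 0) (newKey w (k + 1)) := by
  rw [newKey, newKey, scons_getD_app_drop hk]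

variable {A : List ℕ} (hA : SortedArr (stageRows ws (w ++ V)) A)
include hA

theorem rowEnd_le_length (k : ℕ) : rowEnd ws w V k ≤ A.length := by
  rw [hA.length]; exact pcount_le_card _ _

theorem rowPos_lt_length {k : ℕ} (hk : k ≤ w.length) : rowPos ws w V k < A.length :=
  (h.rowPos_lt_rowEnd hk).trans_le (h.rowEnd_le_length hA k)

theorem getD_rowPos {k : ℕ} (hk : k ≤ w.length) :
    A.getD (rowPos ws w V k) 0 = if k = 0 then 0 else w.getD (k - 1) 0 := by
  apply hA.getD_eq (X := oldKey w V k)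
  · intro b hb e
    exact stageRows_label h.pos_ws h.pos_wV b hb _ (h.oldKey_mem hk) e
  · exact le_rfl
  · exact pcount_lt (fun _ _ hb => le_of_lt hb) (h.oldKey_mem hk) (lt_irrefl _) le_rfl

theorem lfc_rowPos {k : ℕ} (hk : k < w.length) :
    lfc A (w.getD k 0) (rowPos ws w V (k + 1)) = rowPos ws w V k := by
  rw [rowPos, rowPos, hA.lfc_keyCount _ (isLowerKey_lt _), h.oldKey_eq_scons hk,
    keyCount_stageRows_lt _ _ (h.getD_mem_pos hk)]

theorem lfc_rowEnd {k : ℕ} (hk : k < w.length) :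
    lfc A (w.getD k 0) (rowEnd ws w V (k + 1)) = rowEnd ws w V k := by
  rw [rowEnd, rowEnd, hA.lfc_keyCount _ (isLowerKey_le _), newKey_eq_scons hk,
    keyCount_stageRows_le _ _ (h.getD_mem_pos hk)]

theorem fl_rowPos {k : ℕ} (hk : k < w.length) : fl A (rowPos ws w V k) = rowPos ws w V (k + 1) := by
  rw [← h.lfc_rowPos hA hk]
  refine fl_lfc (h.rowPos_lt_length hA hk) ?_
  rw [h.getD_rowPos hA hk, if_neg (Nat.succ_ne_zero k)]; rfl

theorem firstColumn_rowPos {k : ℕ} (hk : k < w.length) :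
    (firstColumn A).getD (rowPos ws w V k) 0 = w.getD k 0 := by
  rw [← h.lfc_rowPos hA hk]
  refine firstColumn_lfc (h.rowPos_lt_length hA hk) ?_
  rw [h.getD_rowPos hA hk, if_neg (Nat.succ_ne_zero k)]; rfl

theorem count_zero : A.count 0 = 1 := by
  have e : A.count 0 = (A : Multiset ℕ).count 0 := (Multiset.coe_count 0 A).symm
  rw [e, hA.coe, stageRows, Multiset.map_cons, Multiset.count_cons_self, Multiset.count_eq_zero_of_notMem]
  intro hm
  obtain ⟨b, hb, e⟩ := Multiset.mem_map.1 hm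
  rcases Multiset.mem_add.1 hb with hb | hb
  · obtain ⟨-, y, hy, rfl⟩ := wordsRows_get_ne_zero h.pos_ws hb
    obtain ⟨u, hu, k, hk, e'⟩ := mem_wordsRows.1 hb
    rw [e'] at e
    simp only [wordRow] at e
    have hp : ∀ i < u.length, u.getD i 0 ≠ 0 := fun i hi h0 => by
      rw [List.getD_eq_getElem _ _ hi] at h0
      have := h.pos_ws u hu _ (List.getElem_mem hi)
      omega
    split_ifs at e
    · rw [getLastD_eq_getD] at e; exact hp _ (by omega) e
    · exact hp _ (by omega) e
  · obtain ⟨k, hk, rfl⟩ := mem_textRest.1 hb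
    simp only [textRow, if_neg (Nat.succ_ne_zero _), Nat.add_sub_cancel] at e
    rw [List.getD_eq_getElem _ _ hk] at e
    have := h.pos_wV _ (List.getElem_mem hk)
    omega

theorem eq_rowPos_zero {i : ℕ} (hi : i < A.length) (h0 : A.getD i 0 = 0) : i = rowPos ws w V 0 := by
  have h1 := rank_lt_count hi h0
  have h2 := h.getD_rowPos hA (Nat.zero_le _)
  rw [if_pos rfl] at h2
  have h3 := rank_lt_count (h.rowPos_lt_length hA (Nat.zero_le _)) h2
  rw [h.count_zero hA] at h1 h3
  rw [← select_rank hi h0, ← select_rank (h.rowPos_lt_length hA (Nat.zero_le _)) h2]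
  congr 1
  omega

theorem idxOf_zero : A.idxOf 0 = rowPos ws w V 0 := by
  have hm : 0 ∈ A := by
    rw [← List.count_pos_iff, h.count_zero hA]; exact Nat.one_pos
  have hl := List.idxOf_lt_length_of_mem hm
  apply h.eq_rowPos_zero hA hl
  rw [List.getD_eq_getElem _ _ hl, List.getElem_idxOf]

theorem fl_iterate {k : ℕ} (hk : k ≤ w.length) : (fl A)^[k] (A.idxOf 0) = rowPos ws w V k := by
  induction k with
  | zero => exact h.idxOf_zero hA
  | succ k ih => rw [Function.iterate_succ_apply', ih (by omega), h.fl_rowPos hA (by omega)]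

/-! ### The exchanges -/

/-- No other row shares a key with `V$` or `wV$`, so exchanging the two entries relabels exactly
these two rows. -/
theorem sortedArr_exchange :
    SortedArr (cutRows ws w V w.length) (exchange A (rowPos ws w V w.length) (rowPos ws w V 0)) := by
  have hG : ∀ b ∈ restRows ws V + (Multiset.range (w.length - 1)).map
      (fun j => (oldKey w V (j + 1), rowLabel w (j + 1))), b.1 ≠ oldKey w V 0 ∧ b.1 ≠ dollarKey V := by
    intro b hb
    have hd : ∀ i, 1 ≤ i → i ≤ V.length → dollarKey (V.drop i) ≠ dollarKey V := fun i h1 hi e => by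
      have := congrArg List.length (dollarKey_inj (fun c hc => h.pos_V c (List.mem_of_mem_drop hc))
        h.pos_V e)
      simp at this
      omega
    rcases Multiset.mem_add.1 hb with hb | hb
    · refine ⟨h.restRows_ne h.length_pos (Multiset.mem_cons_of_mem hb), ?_⟩
      rcases Multiset.mem_add.1 hb with hb | hb
      · exact wordRow_ne_dollarKey h.pos_ws hb _
      · obtain ⟨i, hi, rfl⟩ := mem_textRest.1 hb
        exact hd (i + 1) (by omega) hi
    · obtain ⟨j, hj, rfl⟩ := Multiset.mem_map.1 hb
      rw [Multiset.mem_range] at hj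
      refine ⟨h.oldKey_ne (by omega) (Nat.zero_le _) (by omega), ?_⟩
      rw [← oldKey_length w V]
      exact h.oldKey_ne (by omega) le_rfl (by omega)
  have hlt := h.oldKey_length_lt_zero
  rw [oldKey_length] at hlt
  have e1 := hA
  rw [h.stageRows_eq] at e1
  obtain ⟨r1, r2, r3⟩ := e1.relabel (by
    intro b hb
    rcases Multiset.mem_cons.1 hb with rfl | hb
    · exact hlt.ne
    · exact (hG b hb).1) (rowLabel w 0)
  rw [Multiset.cons_swap] at r1
  obtain ⟨s1, s2, s3⟩ := r1.relabel (by
    intro b hb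
    rcases Multiset.mem_cons.1 hb with rfl | hb
    · exact hlt.ne'
    · exact (hG b hb).2) 0
  have p1 := h.rowPos_length_lt (ws := ws)
  have p2 := h.rowPos_lt_length hA le_rfl
  have p3 := h.rowPos_lt_length hA (Nat.zero_le _)
  have p4 := h.getD_rowPos hA le_rfl
  have p5 := h.getD_rowPos hA (Nat.zero_le _)
  have hm := h.length_pos
  rw [if_neg (by omega), ← getLastD_eq_getD] at p4
  rw [if_pos rfl] at p5
  have q1 : keyCount (· < oldKey w V 0) ((dollarKey V, rowLabel w 0) ::ₘ (restRows ws V +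
      (Multiset.range (w.length - 1)).map fun j => (oldKey w V (j + 1), rowLabel w (j + 1)))) =
      rowPos ws w V 0 := by
    rw [rowPos, h.stageRows_eq]
    exact (keyCount_cons_neg (D := (· < oldKey w V 0)) (lt_irrefl _)).symm
  have q2 : keyCount (· < dollarKey V) ((oldKey w V 0, rowLabel w 0) ::ₘ (restRows ws V +
      (Multiset.range (w.length - 1)).map fun j => (oldKey w V (j + 1), rowLabel w (j + 1)))) =
      rowPos ws w V w.length := by
    rw [rowPos, ← h.keyCount_cutRows_length, oldKey_length, h.cutRows_length]
    exact (keyCount_cons_neg (D := (· < dollarKey V)) (lt_irrefl _)).symm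
  rw [h.cutRows_length]
  simp only [q1, q2] at s1
  have e : exchange A (rowPos ws w V w.length) (rowPos ws w V 0) =
      (A.set (rowPos ws w V 0) (rowLabel w 0)).set (rowPos ws w V w.length) 0 := by
    rw [exchange, if_pos ⟨p2, p3⟩, p4, p5, List.set_comm _ _ p1.ne]
    rfl
  rw [e]
  exact s1

/-- The run of swaps moving the row `k`. -/
noncomputable def _root_.cutRun (ws : List (List ℕ)) (w V : List ℕ) (k : ℕ) : List (ℕ × ℕ) :=
  swapRun (rowPos ws w V k) (rowEnd ws w V k - 1 - rowPos ws w V k)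

/-- The exchanges executed up to the runs of the last `i` rows. -/
noncomputable def _root_.cutSwaps (ws : List (List ℕ)) (w V : List ℕ) (i : ℕ) : List (ℕ × ℕ) :=
  (rowPos ws w V w.length, rowPos ws w V 0) ::
    (List.range i).flatMap fun j => cutRun ws w V (w.length - 1 - j)

omit h hA in
theorem _root_.cutSwaps_succ (ws : List (List ℕ)) (w V : List ℕ) (i : ℕ) :
    cutSwaps ws w V (i + 1) = cutSwaps ws w V i ++ cutRun ws w V (w.length - 1 - i) := by
  simp [cutSwaps, List.range_succ]

omit h hA in
theorem _root_.cutSwaps_length (ws : List (List ℕ)) (w V : List ℕ) :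
    cutSwaps ws w V w.length = (rowPos ws w V w.length, rowPos ws w V 0) ::
      (List.range w.length).reverse.flatMap (cutRun ws w V) := by
  rw [cutSwaps]
  congr 1
  have : (List.range w.length).reverse = (List.range w.length).map fun j => w.length - 1 - j := by
    apply List.ext_getElem
    · simp
    · intro i h1 h2; simp
  rw [this, List.flatMap_map]

theorem sortedArr_cutSwaps {i : ℕ} (hi : i ≤ w.length) :
    SortedArr (cutRows ws w V (w.length - i)) (exchanges A (cutSwaps ws w V i)) := by
  induction i with
  | zero => exact h.sortedArr_exchange hA
  | succ i ih =>
    have h1 := ih (by omega)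
    rw [show w.length - i = w.length - 1 - i + 1 by omega] at h1
    have h2 := h.sortedArr_move (by omega) h1
    rw [cutSwaps_succ, exchanges_append, show w.length - (i + 1) = w.length - 1 - i by omega]
    exact h2

omit hA in
theorem pos_append : ∀ u ∈ ws ++ [w], ∀ c ∈ u, 1 ≤ c := by
  intro u hu
  rcases List.mem_append.1 hu with hu | hu
  · exact h.pos_ws u hu
  · rw [List.mem_singleton.1 hu]; exact h.pos_w

/-- The result of the exchanges and the next transform are sorted arrays of the same rows, hence
equal. -/
theorem eq_exchanges {B : List ℕ} (hB : SortedArr (stageRows (ws ++ [w]) V) B) :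
    B = exchanges A (cutSwaps ws w V w.length) := by
  have h1 := h.sortedArr_cutSwaps hA le_rfl
  rw [Nat.sub_self, cutRows_zero] at h1
  exact hB.unique h1 (stageRows_label h.pos_append h.pos_V)

end CutContext

theorem rank_succ {A : List ℕ} {c j : ℕ} (hj : j < A.length) (h : A.getD j 0 = c) :
    rank A c (j + 1) = rank A c j + 1 := by
  rw [List.getD_eq_getElem _ _ hj] at h
  rw [rank, rank, List.take_add_one, List.getElem?_eq_getElem hj, h]
  simp

/-! ### The cycle of the factor after the cut -/

namespace CutContext

variable {ws : List (List ℕ)} {w V : List ℕ} (h : CutContext ws w V)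
include h

/-- The number of rows up to the place of the row of `w` starting at position `k`, after the cut. -/
noncomputable def _root_.finalEnd (ws : List (List ℕ)) (w V : List ℕ) (k : ℕ) : ℕ :=
  keyCount (· ≤ newKey w k) (stageRows (ws ++ [w]) V)

theorem finalEnd_length : finalEnd ws w V w.length = finalEnd ws w V 0 := by
  rw [finalEnd, finalEnd, newKey_length, newKey_zero h.lyndon.1]

/-- Moving the rows of `w` does not change the number of rows up to a new key, so the ends computed
before the cut remain valid after it. -/
theorem finalEnd_eq_rowEnd {k : ℕ} (hk : k < w.length) : finalEnd ws w V k = rowEnd ws w V k := by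
  rw [finalEnd, ← cutRows_zero, h.keyCount_cutRows_le 0 hk]

theorem finalEnd_zero_lt {k : ℕ} (h1 : 1 ≤ k) (hk : k < w.length) :
    finalEnd ws w V 0 < finalEnd ws w V k :=
  pcount_lt (fun _ _ hb => le_trans hb (h.newKey_zero_lt h1 hk).le) (h.newKey_mem hk)
    (not_le.2 (h.newKey_zero_lt h1 hk)) le_rfl

variable {B : List ℕ} (hB : SortedArr (stageRows (ws ++ [w]) V) B)
include hB

theorem finalEnd_spec {k : ℕ} (hk : k < w.length) :
    1 ≤ finalEnd ws w V k ∧ finalEnd ws w V k ≤ B.length ∧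
      B.getD (finalEnd ws w V k - 1) 0 = rowLabel w k := by
  have h1 : keyCount (· < newKey w k) (stageRows (ws ++ [w]) V) < finalEnd ws w V k :=
    pcount_lt (fun _ _ hb => le_of_lt hb) (h.newKey_mem hk) (lt_irrefl _) le_rfl
  refine ⟨by omega, ?_, ?_⟩
  · rw [hB.length]; exact pcount_le_card _ _
  · apply hB.getD_eq (X := newKey w k)
    · intro b hb e
      exact stageRows_label h.pos_append h.pos_V b hb _ (h.newKey_mem hk) e
    · omega
    · change _ < finalEnd ws w V k; omega

/-- Equal factors cut out earlier have rows with the same keys. Position `finalEnd - 1` singles out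
the last of them, and the backward step respects this choice because it preserves the order of rows
with equal labels. -/
theorem lf_finalEnd {k : ℕ} (hk : k < w.length) :
    lf B (finalEnd ws w V (k + 1) - 1) = finalEnd ws w V k - 1 := by
  have h0 : 1 ≤ finalEnd ws w V (k + 1) ∧ finalEnd ws w V (k + 1) ≤ B.length ∧
      B.getD (finalEnd ws w V (k + 1) - 1) 0 = w.getD k 0 := by
    rcases Nat.lt_or_ge (k + 1) w.length with hk' | hk'
    · have := h.finalEnd_spec hB hk'
      rwa [rowLabel, if_neg (Nat.succ_ne_zero k), Nat.add_sub_cancel] at this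
    · have e : k + 1 = w.length := by omega
      rw [e, h.finalEnd_length]
      have := h.finalEnd_spec hB h.length_pos
      rwa [rowLabel, if_pos rfl, getLastD_eq_getD, show w.length - 1 = k by omega] at this
  obtain ⟨h1, h2, h3⟩ := h0
  have e1 : lfc B (w.getD k 0) (finalEnd ws w V (k + 1)) = finalEnd ws w V k := by
    rw [finalEnd, finalEnd, hB.lfc_keyCount _ (isLowerKey_le _), newKey_eq_scons hk,
      keyCount_stageRows_le _ _ (h.getD_mem_pos hk)]
  have hl : finalEnd ws w V (k + 1) - 1 < B.length := by omega
  rw [lf_eq hl, h3, ← e1]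
  have := rank_succ hl h3
  rw [Nat.sub_add_cancel h1] at this
  rw [lfc, lfc, this]
  omega

theorem lf_iterate {k : ℕ} (hk : k ≤ w.length) :
    (lf B)^[k] (finalEnd ws w V 0 - 1) = finalEnd ws w V (w.length - k) - 1 := by
  induction k with
  | zero => rw [Nat.sub_zero, h.finalEnd_length]; rfl
  | succ k ih =>
    rw [Function.iterate_succ_apply', ih (by omega), show w.length - k = w.length - (k + 1) + 1 by omega,
      h.lf_finalEnd hB (by omega)]

theorem isCut {A : List ℕ} (hA : SortedArr (stageRows ws (w ++ V)) A) :
    IsCut A w (cutSwaps ws w V w.length) B := by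
  have hm := h.length_pos
  have hfl : ∀ k ≤ w.length, (fl A)^[k] (A.idxOf 0) = rowPos ws w V k := fun k hk => h.fl_iterate hA hk
  have hlt : ∀ k ≤ w.length, rowPos ws w V k < rowEnd ws w V k := fun k hk => h.rowPos_lt_rowEnd hk
  have hle : ∀ k, rowEnd ws w V k ≤ A.length := h.rowEnd_le_length hA
  have hq : rowPos ws w V 0 + (rowEnd ws w V 0 - 1 - rowPos ws w V 0) = rowEnd ws w V 0 - 1 := by
    have := hlt 0 (Nat.zero_le _); omega
  -- Subtract the two backward steps that lead from row `k + 1` to row `k`. The entry at `rowPos (k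
  -- + 1)` is itself `w[k]` and lies outside the half-open interval, which absorbs the `- 1`.
  have hcount : ∀ k < w.length, rowEnd ws w V k - 1 - rowPos ws w V k =
      countIn A (w.getD k 0) (rowPos ws w V (k + 1)) (rowEnd ws w V (k + 1) - 1) := by
    intro k hk
    have h1 := hlt (k + 1) hk
    have h2 := countIn_add_rank A (w.getD k 0) (rowPos ws w V (k + 1)) (rowEnd ws w V (k + 1) - 1) (by omega)
      (by have := hle (k + 1); omega)
    have h3 := h.getD_rowPos hA (k := k + 1) hk
    rw [if_neg (Nat.succ_ne_zero k), Nat.add_sub_cancel] at h3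
    rw [rank_succ (h.rowPos_lt_length hA (show k + 1 ≤ w.length from hk)) h3,
      show rowEnd ws w V (k + 1) - 1 + 1 = rowEnd ws w V (k + 1) by omega] at h2
    have h4 := h.lfc_rowPos hA hk
    have h5 := h.lfc_rowEnd hA hk
    unfold lfc at h4 h5
    omega
  have hlast : w.getLastD 0 = w.getD (w.length - 1) 0 := getLastD_eq_getD w
  have hfe := h.finalEnd_eq_rowEnd (ws := ws) hm
  refine ⟨fun k hk => ?_, ?_, ?_, fun k h1 hk => ?_, fun k => rowEnd ws w V k - 1 - rowPos ws w V k,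
    ?_, fun k hk => ?_, fun k hk => ?_, ?_, ?_, ?_, fun k h1 hk => ?_, fun k hk => ?_⟩
  · beta_reduce
    rw [hfl k hk.le]; exact h.firstColumn_rowPos hA hk
  · beta_reduce
    rw [hfl _ le_rfl, h.idxOf_zero hA]; exact h.rowPos_length_lt
  · beta_reduce
    rw [hfl _ le_rfl, h.getD_rowPos hA le_rfl, if_neg (by omega), hlast]
  · beta_reduce
    rw [hfl k hk.le, h.idxOf_zero hA]; exact h.rowPos_zero_lt h1 hk
  -- For the last row the upper end is `rowEnd` at `|w|`, that is `rowEnd` at `0`, so the interval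
  -- ends at `d + c 0`.
  · have := hcount (w.length - 1) (by omega)
    rw [Nat.sub_add_cancel hm, h.rowEnd_length] at this
    simp only
    rw [hfl _ le_rfl, h.idxOf_zero hA, hq, hlast]
    exact this
  · simp only
    rw [hfl _ hk.le, hcount k (by omega)]
    congr 1
    have := hlt (k + 1) hk.le
    omega
  · simp only
    have h1 := hlt k hk.le
    have h2 := hlt (k + 1) hk
    have h3 := hle k
    have h4 := hle (k + 1)
    rw [hfl k hk.le, show rowPos ws w V k + (rowEnd ws w V k - 1 - rowPos ws w V k) = rowEnd ws w V k - 1 by omega]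
    refine ⟨by omega, ?_⟩
    have h5 := h.lfc_rowEnd hA hk
    have h6 := h.lfc_rowPos hA hk
    have h7 := rank_le_count A (w.getD k 0) (rowEnd ws w V (k + 1))
    unfold lfc at h5 h6
    rw [show rowEnd ws w V k - 1 = A.countP (fun a => decide (a < w.getD k 0)) +
      (rank A (w.getD k 0) (rowEnd ws w V (k + 1)) - 1) by omega]
    exact firstColumn_getD (by omega)
  · beta_reduce
    rw [cutSwaps_length, hfl _ le_rfl, h.idxOf_zero hA]
    congr 1
    rw [List.flatMap_def, List.flatMap_def]
    congr 1
    apply List.map_congr_left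
    intro k hk
    have hk : k < w.length := by simpa using hk
    rw [← h.idxOf_zero hA, hfl k hk.le]; rfl
  · exact h.eq_exchanges hA hB
  · simp only
    rw [h.idxOf_zero hA, hq, ← hfe, h.lf_iterate hB le_rfl, Nat.sub_self]
  · simp only
    -- The cycle does not close early: `w` is strictly smaller than its other conjugates, so row `0`
    -- lies strictly before the other rows of the cycle.
    rw [h.idxOf_zero hA, hq, ← hfe, h.lf_iterate hB hk.le]
    have h2 := h.finalEnd_zero_lt (ws := ws) (k := w.length - k) (by omega) (by omega)
    have h3 := (h.finalEnd_spec hB hm).1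
    omega
  · simp only
    rw [h.idxOf_zero hA, hq, ← hfe, h.lf_iterate hB hk.le]
    rcases Nat.eq_zero_or_pos k with rfl | hk0
    · rw [Nat.sub_zero, h.finalEnd_length, (h.finalEnd_spec hB hm).2.2, rowLabel, if_pos rfl, hlast]; rfl
    · rw [(h.finalEnd_spec hB (show w.length - k < w.length by omega)).2.2, rowLabel, if_neg (by omega)]
      congr 1
      omega

end CutContext

/-! ## Structured programs -/

/-- A configuration without the program counter. -/
structure MemState where
  reg : ℕ → ℕ
  arr : List ℕ
  swaps : List (ℕ × ℕ)
  lookups : ℕ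

def Config.mem (s : Config) : MemState := ⟨s.reg, s.arr, s.swaps, s.lookups⟩

def MemState.set (σ : MemState) (r v : ℕ) : MemState := { σ with reg := Function.update σ.reg r v }

def Instr.IsOp : Instr → Prop
  | .jump _ => False
  | .jumpLt _ _ _ => False
  | .jumpEq _ _ _ => False
  | _ => True

/-- The effect of an instruction other than a jump. -/
def Instr.apply (σ : MemState) : Instr → MemState
  | .const r c => σ.set r c
  | .move r a => σ.set r (σ.reg a)
  | .add r a b => σ.set r (σ.reg a + σ.reg b)
  | .sub r a b => σ.set r (σ.reg a - σ.reg b)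
  | .mul r a b => σ.set r (σ.reg a * σ.reg b)
  | .div r a b => σ.set r (σ.reg a / σ.reg b)
  | .load r i => σ.set r (σ.arr.getD (σ.reg i) 0)
  | .swap i j => { σ with
      arr := exchange σ.arr (σ.reg i) (σ.reg j)
      swaps := σ.swaps ++ [(σ.reg i, σ.reg j)] }
  | .first r i =>
    { σ.set r ((firstColumn σ.arr).getD (σ.reg i) 0) with lookups := σ.lookups + 1 }
  | _ => σ

theorem Instr.exec_of_isOp {i : Instr} (h : i.IsOp) (s : Config) :
    (i.exec s).mem = i.apply s.mem ∧ (i.exec s).pc = s.pc + 1 := by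
  cases i <;> first | exact ⟨rfl, rfl⟩ | exact h.elim

/-- Structured programs, so that running times can be derived by induction on the program instead of
by tracking instruction numbers. -/
inductive Com
  | skip
  | op (i : Instr)
  | seq (a b : Com)
  | ifLt (r s : ℕ) (a b : Com)
  | ifEq (r s : ℕ) (a b : Com)
  | whileLt (r s : ℕ) (a : Com)

infixr:60 " ;; " => Com.seq

def Com.size : Com → ℕ
  | .skip => 0
  | .op _ => 1
  | .seq a b => a.size + b.size
  | .ifLt _ _ a b => a.size + b.size + 2
  | .ifEq _ _ a b => a.size + b.size + 2
  | .whileLt _ _ a => a.size + 3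

/-- The instructions of a structured program placed at address `l`. -/
def Com.compile : ℕ → Com → List Instr
  | _, .skip => []
  | _, .op i => [i]
  | l, .seq a b => a.compile l ++ b.compile (l + a.size)
  | l, .ifLt r s a b => .jumpLt r s (l + 2 + b.size) :: (b.compile (l + 1) ++
      (.jump (l + 2 + b.size + a.size) :: a.compile (l + 2 + b.size)))
  | l, .ifEq r s a b => .jumpEq r s (l + 2 + b.size) :: (b.compile (l + 1) ++
      (.jump (l + 2 + b.size + a.size) :: a.compile (l + 2 + b.size)))
  | l, .whileLt r s a => .jumpLt r s (l + 2) :: .jump (l + 3 + a.size) :: (a.compile (l + 2) ++ [.jump l])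

theorem Com.length_compile (c : Com) (l : ℕ) : (c.compile l).length = c.size := by
  induction c generalizing l with
  | skip => rfl
  | op i => rfl
  | seq a b iha ihb => simp [compile, size, iha, ihb]
  | ifLt r s a b iha ihb => simp [compile, size, iha, ihb]; omega
  | ifEq r s a b iha ihb => simp [compile, size, iha, ihb]; omega
  | whileLt r s a iha => simp [compile, size, iha]

/-- All registers and array entries are at most `W`. -/
def MemState.Bounded (W : ℕ) (σ : MemState) : Prop := (∀ r, σ.reg r ≤ W) ∧ ∀ x ∈ σ.arr, x ≤ W

/-- Execution of a structured program in `t` steps. -/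
inductive Exec (W : ℕ) : Com → MemState → ℕ → MemState → Prop
  | skip (σ) : Exec W .skip σ 0 σ
  | op {i σ} : i.IsOp → (i.apply σ).Bounded W → Exec W (.op i) σ 1 (i.apply σ)
  | seq {a b σ σ' σ'' t t'} : Exec W a σ t σ' → Exec W b σ' t' σ'' → Exec W (.seq a b) σ (t + t') σ''
  | ltTrue {r s a b σ σ' t} : σ.reg r < σ.reg s → Exec W a σ t σ' → Exec W (.ifLt r s a b) σ (1 + t) σ'
  | ltFalse {r s a b σ σ' t} : ¬ σ.reg r < σ.reg s → Exec W b σ t σ' →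
      Exec W (.ifLt r s a b) σ (1 + (t + 1)) σ'
  | eqTrue {r s a b σ σ' t} : σ.reg r = σ.reg s → Exec W a σ t σ' → Exec W (.ifEq r s a b) σ (1 + t) σ'
  | eqFalse {r s a b σ σ' t} : ¬ σ.reg r = σ.reg s → Exec W b σ t σ' →
      Exec W (.ifEq r s a b) σ (1 + (t + 1)) σ'
  | whileTrue {r s a σ σ' σ'' t t'} : σ.reg r < σ.reg s → Exec W a σ t σ' →
      Exec W (.whileLt r s a) σ' t' σ'' → Exec W (.whileLt r s a) σ (1 + (t + (1 + t'))) σ''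
  | whileFalse {r s a σ} : ¬ σ.reg r < σ.reg s → Exec W (.whileLt r s a) σ (1 + 1) σ

/-- `t` steps lead from `s` to `s'`, with registers bounded by `W`. -/
def Reach (P : Program) (W : ℕ) (s : Config) (t : ℕ) (s' : Config) : Prop :=
  P.step^[t] s = s' ∧ ∀ j ≤ t, ∀ r, (P.step^[j] s).reg r ≤ W

theorem Reach.refl {P : Program} {W : ℕ} {s : Config} (h : ∀ r, s.reg r ≤ W) : Reach P W s 0 s :=
  ⟨rfl, fun j hj => by rw [Nat.le_zero.1 hj]; exact h⟩

theorem Reach.trans {P : Program} {W : ℕ} {s s' s'' : Config} {t t' : ℕ} (h : Reach P W s t s')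
    (h' : Reach P W s' t' s'') : Reach P W s (t + t') s'' := by
  constructor
  · rw [Nat.add_comm, Function.iterate_add_apply, h.1, h'.1]
  · intro j hj
    rcases Nat.lt_or_ge j t with hjt | hjt
    · exact h.2 j hjt.le
    · obtain ⟨i, rfl⟩ := Nat.exists_eq_add_of_le hjt
      rw [Nat.add_comm, Function.iterate_add_apply, h.1]
      exact h'.2 i (by omega)

theorem Reach.step {P : Program} {W : ℕ} {s : Config} {i : Instr} (hi : P[s.pc]? = some i)
    (h : ∀ r, s.reg r ≤ W) (h' : ∀ r, (i.exec s).reg r ≤ W) : Reach P W s 1 (i.exec s) := by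
  have e : P.step s = i.exec s := by simp [Program.step, hi]
  refine ⟨e, fun j hj => ?_⟩
  rcases Nat.le_one_iff_eq_zero_or_eq_one.1 hj with rfl | rfl
  · exact h
  · rw [Function.iterate_one, e]; exact h'

def CodeAt (P : Program) (l : ℕ) (L : List Instr) : Prop := ∀ j < L.length, P[l + j]? = L[j]?

theorem codeAt_append {P : Program} {l : ℕ} {L L' : List Instr} (h : CodeAt P l (L ++ L')) :
    CodeAt P l L ∧ CodeAt P (l + L.length) L' := by
  constructor
  · intro j hj
    rw [h j (by simp; omega), List.getElem?_append_left hj]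
  · intro j hj
    rw [Nat.add_assoc, h (L.length + j) (by simp; omega), List.getElem?_append_right (by omega),
      Nat.add_sub_cancel_left]

theorem codeAt_cons {P : Program} {l : ℕ} {i : Instr} {L : List Instr} (h : CodeAt P l (i :: L)) :
    P[l]? = some i ∧ CodeAt P (l + 1) L := by
  constructor
  · simpa using h 0 (by simp)
  · have := (codeAt_append (L := [i]) (L' := L) h).2
    simpa using this

theorem Config.ext_mem {s s' : Config} (h : s.pc = s'.pc) (h' : s.mem = s'.mem) : s = s' := by
  cases s; cases s'
  simp only [Config.mem, MemState.mk.injEq] at h'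
  simp only at h
  obtain ⟨h1, h2, h3, h4⟩ := h'
  subst h h1 h2 h3 h4
  rfl

def MemState.at (σ : MemState) (l : ℕ) : Config := ⟨l, σ.reg, σ.arr, σ.swaps, σ.lookups⟩

theorem Exec.bounded {W : ℕ} {c : Com} {σ σ' : MemState} {t : ℕ} (h : Exec W c σ t σ')
    (hb : σ.Bounded W) : σ'.Bounded W := by
  induction h with
  | skip => exact hb
  | op _ h => exact h
  | seq _ _ ih ih' => exact ih' (ih hb)
  | ltTrue _ _ ih => exact ih hb
  | ltFalse _ _ ih => exact ih hb
  | eqTrue _ _ ih => exact ih hb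
  | eqFalse _ _ ih => exact ih hb
  | whileTrue _ _ _ ih ih' => exact ih' (ih hb)
  | whileFalse => exact hb

theorem Reach.jump {P : Program} {W : ℕ} {σ : MemState} {l l' : ℕ} {i : Instr} (hi : P[l]? = some i)
    (hb : σ.Bounded W) (h : i.exec (σ.at l) = σ.at l') : Reach P W (σ.at l) 1 (σ.at l') := by
  rw [← h]
  exact Reach.step hi hb.1 (by rw [h]; exact hb.1)

/-- Jump targets are absolute, so the induction over the execution has to allow the code to sit at
any address of a larger program. -/
theorem Exec.reach {W : ℕ} {c : Com} {σ σ' : MemState} {t : ℕ} (h : Exec W c σ t σ') (P : Program) :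
    ∀ l, CodeAt P l (c.compile l) → σ.Bounded W → Reach P W (σ.at l) t (σ'.at (l + c.size)) := by
  induction h with
  | skip σ => exact fun l _ hb => Reach.refl hb.1
  | @op i σ hi hb' =>
    intro l hc hb
    have h1 := (codeAt_cons hc).1
    have h2 := Instr.exec_of_isOp hi (σ.at l)
    have e : i.exec (σ.at l) = (i.apply σ).at (l + 1) := Config.ext_mem h2.2 h2.1
    have := Reach.step (W := W) (s := σ.at l) h1 hb.1 (by rw [e]; exact hb'.1)
    rw [e] at this
    exact this
  | @seq a b σ σ' σ'' t t' h1 h2 ih1 ih2 =>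
    intro l hc hb
    obtain ⟨c1, c2⟩ := codeAt_append hc
    rw [Com.length_compile] at c2
    have := (ih1 l c1 hb).trans (ih2 _ c2 (h1.bounded hb))
    rwa [Nat.add_assoc] at this
  | @ltTrue r s a b σ σ' t hlt h1 ih =>
    intro l hc hb
    obtain ⟨c1, c2⟩ := codeAt_cons hc
    obtain ⟨-, c3⟩ := codeAt_append c2
    obtain ⟨-, c4⟩ := codeAt_cons c3
    rw [Com.length_compile, show l + 1 + b.size + 1 = l + 2 + b.size by omega] at c4
    have j1 : Reach P W (σ.at l) 1 (σ.at (l + 2 + b.size)) := Reach.jump c1 hb (congrArg σ.at (if_pos hlt))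
    have := j1.trans (ih _ c4 hb)
    rwa [show l + 2 + b.size + a.size = l + (a.size + b.size + 2) by omega] at this
  | @ltFalse r s a b σ σ' t hlt h1 ih =>
    intro l hc hb
    obtain ⟨c1, c2⟩ := codeAt_cons hc
    obtain ⟨c5, c3⟩ := codeAt_append c2
    obtain ⟨c6, -⟩ := codeAt_cons c3
    rw [Com.length_compile] at c6
    have j1 : Reach P W (σ.at l) 1 (σ.at (l + 1)) := Reach.jump c1 hb (congrArg σ.at (if_neg hlt))
    have j2 : Reach P W (σ'.at (l + 1 + b.size)) 1 (σ'.at (l + 2 + b.size + a.size)) :=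
      Reach.jump c6 (h1.bounded hb) rfl
    have := j1.trans ((ih _ c5 hb).trans j2)
    rwa [show l + 2 + b.size + a.size = l + (a.size + b.size + 2) by omega] at this
  | @eqTrue r s a b σ σ' t hlt h1 ih =>
    intro l hc hb
    obtain ⟨c1, c2⟩ := codeAt_cons hc
    obtain ⟨-, c3⟩ := codeAt_append c2
    obtain ⟨-, c4⟩ := codeAt_cons c3
    rw [Com.length_compile, show l + 1 + b.size + 1 = l + 2 + b.size by omega] at c4
    have j1 : Reach P W (σ.at l) 1 (σ.at (l + 2 + b.size)) := Reach.jump c1 hb (congrArg σ.at (if_pos hlt))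
    have := j1.trans (ih _ c4 hb)
    rwa [show l + 2 + b.size + a.size = l + (a.size + b.size + 2) by omega] at this
  | @eqFalse r s a b σ σ' t hlt h1 ih =>
    intro l hc hb
    obtain ⟨c1, c2⟩ := codeAt_cons hc
    obtain ⟨c5, c3⟩ := codeAt_append c2
    obtain ⟨c6, -⟩ := codeAt_cons c3
    rw [Com.length_compile] at c6
    have j1 : Reach P W (σ.at l) 1 (σ.at (l + 1)) := Reach.jump c1 hb (congrArg σ.at (if_neg hlt))
    have j2 : Reach P W (σ'.at (l + 1 + b.size)) 1 (σ'.at (l + 2 + b.size + a.size)) :=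
      Reach.jump c6 (h1.bounded hb) rfl
    have := j1.trans ((ih _ c5 hb).trans j2)
    rwa [show l + 2 + b.size + a.size = l + (a.size + b.size + 2) by omega] at this
  | @whileTrue r s a σ σ' σ'' t t' hlt h1 h2 ih1 ih2 =>
    intro l hc hb
    obtain ⟨c1, c2⟩ := codeAt_cons hc
    obtain ⟨-, c3⟩ := codeAt_cons c2
    obtain ⟨c4, c5⟩ := codeAt_append c3
    obtain ⟨c6, -⟩ := codeAt_cons c5
    rw [Com.length_compile] at c6
    have j1 : Reach P W (σ.at l) 1 (σ.at (l + 2)) := Reach.jump c1 hb (congrArg σ.at (if_pos hlt))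
    have j2 : Reach P W (σ'.at (l + 2 + a.size)) 1 (σ'.at l) :=
      Reach.jump c6 (h1.bounded hb) rfl
    exact j1.trans ((ih1 _ c4 hb).trans (j2.trans (ih2 l hc (h1.bounded hb))))
  | @whileFalse r s a σ hlt =>
    intro l hc hb
    obtain ⟨c1, c2⟩ := codeAt_cons hc
    obtain ⟨c3, -⟩ := codeAt_cons c2
    have j1 : Reach P W (σ.at l) 1 (σ.at (l + 1)) := Reach.jump c1 hb (congrArg σ.at (if_neg hlt))
    have j2 : Reach P W (σ.at (l + 1)) 1 (σ.at (l + 3 + a.size)) := Reach.jump c3 hb rfl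
    have := j1.trans j2
    rwa [show l + 3 + a.size = l + (a.size + 3) by omega] at this

/-! ## Specifications -/

/-- Started in `σ`, the program `c` stops after at most `T` steps in a state with property `Q`. -/
def Spec (W : ℕ) (c : Com) (σ : MemState) (T : ℕ) (Q : MemState → Prop) : Prop :=
  σ.Bounded W → ∃ t ≤ T, ∃ σ', Exec W c σ t σ' ∧ Q σ'

namespace Spec

variable {W : ℕ}

theorem mono {c : Com} {σ : MemState} {T T' : ℕ} {Q Q' : MemState → Prop} (h : Spec W c σ T Q)
    (hT : T ≤ T') (hQ : ∀ σ', σ'.Bounded W → Q σ' → Q' σ') : Spec W c σ T' Q' := fun hb =>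
  let ⟨t, ht, σ', h1, h2⟩ := h hb
  ⟨t, ht.trans hT, σ', h1, hQ σ' (h1.bounded hb) h2⟩

theorem seq {a b : Com} {σ : MemState} {T T' : ℕ} {Q : MemState → Prop}
    (h : Spec W a σ T fun σ' => Spec W b σ' T' Q) : Spec W (a ;; b) σ (T + T') Q := fun hb =>
  let ⟨_, ht, _, h1, h2⟩ := h hb
  let ⟨_, ht', _, h1', h2'⟩ := h2 (h1.bounded hb)
  ⟨_, Nat.add_le_add ht ht', _, .seq h1 h1', h2'⟩

theorem ifLt {r s : ℕ} {a b : Com} {σ : MemState} {T : ℕ} {Q : MemState → Prop}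
    (h1 : σ.reg r < σ.reg s → Spec W a σ T Q) (h2 : ¬ σ.reg r < σ.reg s → Spec W b σ T Q) :
    Spec W (.ifLt r s a b) σ (T + 2) Q := fun hb => by
  by_cases h : σ.reg r < σ.reg s
  · obtain ⟨t, ht, σ', e, q⟩ := h1 h hb
    exact ⟨_, by omega, σ', .ltTrue h e, q⟩
  · obtain ⟨t, ht, σ', e, q⟩ := h2 h hb
    exact ⟨_, by omega, σ', .ltFalse h e, q⟩

theorem ifEq {r s : ℕ} {a b : Com} {σ : MemState} {T : ℕ} {Q : MemState → Prop}
    (h1 : σ.reg r = σ.reg s → Spec W a σ T Q) (h2 : ¬ σ.reg r = σ.reg s → Spec W b σ T Q) :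
    Spec W (.ifEq r s a b) σ (T + 2) Q := fun hb => by
  by_cases h : σ.reg r = σ.reg s
  · obtain ⟨t, ht, σ', e, q⟩ := h1 h hb
    exact ⟨_, by omega, σ', .eqTrue h e, q⟩
  · obtain ⟨t, ht, σ', e, q⟩ := h2 h hb
    exact ⟨_, by omega, σ', .eqFalse h e, q⟩

/-- The invariant is indexed by the number of completed rounds and each round has its own time
bound. The `+ 2` per round pays for the test and the jump back, the final `+ 2` for the exit. -/
theorem whileLt_sum {r s : ℕ} {a : Com} {Q : MemState → Prop} (I : ℕ → MemState → Prop) (N : ℕ) (T : ℕ → ℕ)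
    (hstep : ∀ i < N, ∀ σ, σ.Bounded W → I i σ → σ.reg r < σ.reg s ∧ Spec W a σ (T i) (I (i + 1)))
    (hfin : ∀ σ, σ.Bounded W → I N σ → ¬ σ.reg r < σ.reg s ∧ Q σ) {σ : MemState} (h0 : I 0 σ) :
    Spec W (.whileLt r s a) σ ((∑ i ∈ Finset.range N, (T i + 2)) + 2) Q := by
  have key : ∀ k ≤ N, ∀ σ, I (N - k) σ → Spec W (.whileLt r s a) σ
      ((∑ i ∈ Finset.Ico (N - k) N, (T i + 2)) + 2) Q := by
    intro k
    induction k with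
    | zero =>
      intro _ σ h hb
      obtain ⟨h1, h2⟩ := hfin σ hb h
      exact ⟨_, by omega, σ, .whileFalse h1, h2⟩
    | succ k ih =>
      intro hk σ h hb
      obtain ⟨h1, h2⟩ := hstep _ (by omega) σ hb h
      obtain ⟨t, ht, σ', e, q⟩ := h2 hb
      rw [show N - (k + 1) + 1 = N - k by omega] at q
      obtain ⟨t', ht', σ'', e', q'⟩ := ih (by omega) σ' q (e.bounded hb)
      refine ⟨_, ?_, σ'', .whileTrue h1 e e', q'⟩
      rw [Finset.sum_eq_sum_Ico_succ_bot (by omega), show N - (k + 1) + 1 = N - k by omega]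
      omega
  have := key N le_rfl σ (by rw [Nat.sub_self]; exact h0)
  rwa [Nat.sub_self, ← Finset.range_eq_Ico] at this

theorem whileLt {r s : ℕ} {a : Com} {Q : MemState → Prop} (I : ℕ → MemState → Prop) (N T : ℕ)
    (hstep : ∀ i < N, ∀ σ, σ.Bounded W → I i σ → σ.reg r < σ.reg s ∧ Spec W a σ T (I (i + 1)))
    (hfin : ∀ σ, σ.Bounded W → I N σ → ¬ σ.reg r < σ.reg s ∧ Q σ) {σ : MemState} (h0 : I 0 σ) :
    Spec W (.whileLt r s a) σ (N * (T + 2) + 2) Q := by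
  have := whileLt_sum I N (fun _ => T) hstep hfin h0
  simpa using this

end Spec

/-- The value written by an instruction is within the bound. -/
def Instr.Fits (W : ℕ) (σ : MemState) : Instr → Prop
  | .const _ c => c ≤ W
  | .add _ a b => σ.reg a + σ.reg b ≤ W
  | .mul _ a b => σ.reg a * σ.reg b ≤ W
  | _ => True

theorem MemState.Bounded.set {W : ℕ} {σ : MemState} (h : σ.Bounded W) (r : ℕ) {v : ℕ} (hv : v ≤ W) :
    (σ.set r v).Bounded W := by
  refine ⟨fun r' => ?_, h.2⟩
  simp only [MemState.set, Function.update_apply]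
  split_ifs
  · exact hv
  · exact h.1 r'

theorem getD_le {A : List ℕ} {W : ℕ} (h : ∀ x ∈ A, x ≤ W) (i : ℕ) : A.getD i 0 ≤ W := by
  rcases Nat.lt_or_ge i A.length with hi | hi
  · rw [List.getD_eq_getElem _ _ hi]; exact h _ (List.getElem_mem hi)
  · rw [List.getD_eq_default _ _ hi]; exact Nat.zero_le _

theorem exchange_le {A : List ℕ} {W : ℕ} (h : ∀ x ∈ A, x ≤ W) (i j : ℕ) : ∀ x ∈ exchange A i j, x ≤ W := by
  intro x hx
  unfold exchange at hx
  split_ifs at hx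
  · rcases List.mem_or_eq_of_mem_set hx with hx | rfl
    · rcases List.mem_or_eq_of_mem_set hx with hx | rfl
      · exact h x hx
      · exact getD_le h j
    · exact getD_le h i
  · exact h x hx

theorem Instr.apply_bounded {W : ℕ} {σ : MemState} (h : σ.Bounded W) {i : Instr} (hf : i.Fits W σ) :
    (i.apply σ).Bounded W := by
  cases i with
  | const r c => exact h.set r hf
  | move r a => exact h.set r (h.1 a)
  | add r a b => exact h.set r hf
  | sub r a b => exact h.set r ((Nat.sub_le _ _).trans (h.1 a))
  | mul r a b => exact h.set r hf
  | div r a b => exact h.set r ((Nat.div_le_self _ _).trans (h.1 a))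
  | jump l => exact h
  | jumpLt r a l => exact h
  | jumpEq r a l => exact h
  | load r i => exact h.set r (getD_le h.2 _)
  | swap i j => exact ⟨h.1, exchange_le h.2 _ _⟩
  | first r i =>
    have h' := h.set r (getD_le (A := firstColumn σ.arr)
      (fun x hx => h.2 x ((List.mergeSort_perm _ _).mem_iff.1 hx)) (σ.reg i))
    exact ⟨h'.1, h'.2⟩

/-- Weakest precondition of a program without loops. -/
def Com.Pre (W : ℕ) : Com → (MemState → Prop) → MemState → Prop
  | .skip, Q, σ => Q σ
  | .op i, Q, σ => i.IsOp ∧ i.Fits W σ ∧ Q (i.apply σ)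
  | .seq a b, Q, σ => a.Pre W (b.Pre W Q) σ
  | .ifLt r s a b, Q, σ => (σ.reg r < σ.reg s → a.Pre W Q σ) ∧ (¬ σ.reg r < σ.reg s → b.Pre W Q σ)
  | .ifEq r s a b, Q, σ => (σ.reg r = σ.reg s → a.Pre W Q σ) ∧ (¬ σ.reg r = σ.reg s → b.Pre W Q σ)
  | .whileLt _ _ _, _, _ => False

/-- Without loops every instruction is executed at most once, so the size of the code bounds the
time. -/
theorem Spec.block {W : ℕ} {c : Com} {σ : MemState} {Q : MemState → Prop} (h : c.Pre W Q σ) :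
    Spec W c σ c.size Q := by
  induction c generalizing σ Q with
  | skip => exact fun _ => ⟨0, le_rfl, σ, .skip σ, h⟩
  | op i => exact fun hb => ⟨1, le_rfl, _, .op h.1 (Instr.apply_bounded hb h.2.1), h.2.2⟩
  | seq a b iha ihb => exact Spec.seq ((iha h).mono le_rfl fun _ _ h => ihb h)
  | ifLt r s a b iha ihb =>
    exact Spec.ifLt (fun hlt => (iha (h.1 hlt)).mono (Nat.le_add_right _ _) fun _ _ h => h)
      (fun hlt => (ihb (h.2 hlt)).mono (Nat.le_add_left _ _) fun _ _ h => h)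
  | ifEq r s a b iha ihb =>
    exact Spec.ifEq (fun hlt => (iha (h.1 hlt)).mono (Nat.le_add_right _ _) fun _ _ h => h)
      (fun hlt => (ihb (h.2 hlt)).mono (Nat.le_add_left _ _) fun _ _ h => h)
  | whileLt r s a => exact h.elim

/-- The state at the start. -/
def startState (A : List ℕ) : MemState := ⟨Function.update (fun _ => 0) 0 A.length, A, [], 0⟩

theorem Spec.computes {W T : ℕ} {c : Com} {A : List ℕ} {Q : MemState → Prop}
    (h : Spec W c (startState A) T Q) (hl : A.length ≤ W) (hA : ∀ x ∈ A, x ≤ W) {R : Config → Prop}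
    (hR : ∀ s : Config, Q s.mem → R s) : Program.Computes (c.compile 0) A T W R := by
  have hb : (startState A).Bounded W := by
    refine ⟨fun r => ?_, hA⟩
    simp only [startState, Function.update_apply]
    split_ifs
    · exact hl
    · exact Nat.zero_le _
  obtain ⟨t, ht, σ', he, hq⟩ := h hb
  obtain ⟨h1, h2⟩ := he.reach (c.compile 0) 0 (fun j _ => by rw [Nat.zero_add]) hb
  have e : (startState A).at 0 = startConfig A := rfl
  rw [e] at h1 h2
  refine ⟨t, ht, ?_, h2, ?_⟩
  · rw [Program.run, h1, Com.length_compile]; simp [MemState.at]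
  · rw [Program.run, h1]; exact hR _ hq

/-! ## The total length of the runs of Lyndon words inside Lyndon words -/

/-- The suffix at `x + m` is the first one behind `x` that is smaller than the suffix at `x`. -/
structure IsNextSmaller (v : List ℕ) (x m : ℕ) : Prop where
  lt : v.drop (x + m) < v.drop x
  lt_of_lt : ∀ i, 0 < i → i < m → v.drop x < v.drop (x + i)

/-- Being the first later smaller suffix determines the distance. -/
theorem IsNextSmaller.eq {v : List ℕ} {x m m' : ℕ} (h : IsNextSmaller v x m) (h' : IsNextSmaller v x m')
    (hm : 0 < m) (hm' : 0 < m') : m = m' := by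
  rcases lt_trichotomy m m' with hlt | heq | hlt
  · exact absurd (h'.lt_of_lt m hm hlt) (lt_asymm h.lt)
  · exact heq
  · exact absurd (h.lt_of_lt m' hm' hlt) (lt_asymm h'.lt)

/-- If the inner interval extended beyond the outer one, the suffix at `y` would be below the suffix
at `x + m`, which is below the one at `x`, which is below the one at `y`. -/
theorem IsNextSmaller.laminar {v : List ℕ} {x y m m' : ℕ} (h : IsNextSmaller v x m)
    (h' : IsNextSmaller v y m') (h1 : x < y) (h2 : y < x + m) : y + m' ≤ x + m := by
  by_contra hc
  have h3 := h'.lt_of_lt (x + m - y) (by omega) (by omega)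
  rw [show y + (x + m - y) = x + m by omega] at h3
  have h4 := h.lt_of_lt (y - x) (by omega) (by omega)
  rw [show x + (y - x) = y by omega] at h4
  exact lt_irrefl _ (h4.trans (h3.trans h.lt))

/-- `v` contains the power `w ^ h` behind the nonempty word `α`, maximal to the right. -/
structure RunIn (v w α u : List ℕ) (h : ℕ) : Prop where
  ne_nil : α ≠ []
  eq : v = α ++ (wordPow w h ++ u)
  lt : u < w

theorem RunIn.drop {v w α u : List ℕ} {h i : ℕ} (hr : RunIn v w α u h) (hi : i ≤ h) :
    v.drop (α.length + i * w.length) = wordPow w (h - i) ++ u := by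
  obtain ⟨j, rfl⟩ := Nat.exists_eq_add_of_le hi
  rw [hr.eq, wordPow_add, Nat.add_sub_cancel_left, List.append_assoc, ← List.append_assoc,
    List.drop_left' (by simp [wordPow_length])]

/-- Behind a copy of `w` the same run continues with one copy fewer; since the remainder is smaller
than `w`, the suffix there is smaller. Suffixes starting inside the copy are larger because `w` is
Lyndon. -/
theorem RunIn.isNextSmaller {v w α u : List ℕ} {h i : ℕ} (hr : RunIn v w α u h) (hw : IsLyndon w)
    (hi : i < h) : IsNextSmaller v (α.length + i * w.length) w.length := by
  have e1 : v.drop (α.length + i * w.length) = w ++ (wordPow w (h - i - 1) ++ u) := by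
    rw [hr.drop hi.le, show h - i = h - i - 1 + 1 by omega, wordPow, List.append_assoc]; rfl
  constructor
  · rw [show α.length + i * w.length + w.length = α.length + (i + 1) * w.length by ring,
      hr.drop hi, e1, ← List.append_assoc]
    change _ < wordPow w (h - i - 1 + 1) ++ u
    rw [wordPow_succ', List.append_assoc, Nat.sub_sub, append_lt_append_iff]
    exact hr.lt.trans_le (prefix_le ⟨u, rfl⟩)
  · intro k h1 h2
    have e2 : v.drop (α.length + i * w.length + k) = (v.drop (α.length + i * w.length)).drop k := by
      rw [List.drop_drop]
    rw [e2, e1, List.drop_append_of_le_length h2.le]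
    exact (hw.strongLt_drop h1 h2).2 _ _

theorem RunIn.take {v w α u : List ℕ} {h i : ℕ} (hr : RunIn v w α u h) (hi : i < h) :
    (v.drop (α.length + i * w.length)).take w.length = w := by
  rw [hr.drop hi.le, show h - i = h - i - 1 + 1 by omega, wordPow, List.append_assoc, List.take_left]

theorem RunIn.length {v w α u : List ℕ} {h : ℕ} (hr : RunIn v w α u h) :
    v.length = α.length + h * w.length + u.length := by
  rw [hr.eq]; simp [wordPow_length]; omega

/-- One copy of `w'` that starts strictly inside a copy of `w` drags the whole run of `w'` into that
copy, by laminarity in both directions. The shorter Lyndon word `w` then contains the run itself. -/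
theorem RunIn.nested {v w α u w' α' u' : List ℕ} {h h' i i' : ℕ} (hr : RunIn v w α u h)
    (hr' : RunIn v w' α' u' h') (hw : IsLyndon w) (hw' : IsLyndon w') (hi : i < h) (hi' : i' < h')
    (h1 : α.length + i * w.length < α'.length + i' * w'.length)
    (h2 : α'.length + i' * w'.length < α.length + i * w.length + w.length) :
    ∃ α₂ u₂, RunIn w w' α₂ u₂ h' := by
  have hm := List.length_pos_iff.2 hw.1
  have hm' := List.length_pos_iff.2 hw'.1
  have hx := hr.isNextSmaller hw hi
  have ew := hr.take hi
  generalize hxe : α.length + i * w.length = x at *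
  have hlam : ∀ j < h', x < α'.length + j * w'.length → α'.length + j * w'.length < x + w.length →
      α'.length + j * w'.length + w'.length ≤ x + w.length := fun j hj h1 h2 =>
    hx.laminar (hr'.isNextSmaller hw' hj) h1 h2
  -- Copies further to the right: a copy could only leave the block by ending exactly at its end.
  -- Then `w'` is a proper suffix of `w`, and the next copy of `w'` would make the suffix behind the
  -- block larger than the one at `x`.
  have hup : ∀ k, i' + k < h' → x < α'.length + (i' + k) * w'.length ∧
      α'.length + (i' + k) * w'.length < x + w.length := by
    intro k
    induction k with
    | zero => exact fun _ => ⟨h1, h2⟩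
    | succ k ih =>
      intro hk
      obtain ⟨h3, h4⟩ := ih (by omega)
      have h5 := hlam _ (by omega) h3 h4
      rw [show α'.length + (i' + (k + 1)) * w'.length = α'.length + (i' + k) * w'.length + w'.length by ring]
      refine ⟨by omega, lt_of_le_of_ne h5 fun he => ?_⟩
      have e2 : v.drop (x + w.length) = wordPow w' (h' - (i' + k + 1)) ++ u' := by
        rw [← he, show α'.length + (i' + k) * w'.length + w'.length =
          α'.length + (i' + k + 1) * w'.length by ring, hr'.drop (by omega)]
      have e3 : v.drop x = w ++ v.drop (x + w.length) := by
        conv_lhs => rw [← List.take_append_drop w.length (v.drop x), ew, List.drop_drop]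
      have e4 : w.drop (α'.length + (i' + k) * w'.length - x) = w' := by
        conv_rhs => rw [← hr'.take (show i' + k < h' by omega)]
        conv_lhs => rw [← ew]
        rw [List.drop_take, List.drop_drop]
        congr 1
        · omega
        · congr 1; omega
      have h6 := hw.strongLt_drop (k := α'.length + (i' + k) * w'.length - x) (by omega) (by omega)
      rw [e4] at h6
      have h7 := hx.lt
      rw [e3, e2, show h' - (i' + k + 1) = h' - (i' + k + 1) - 1 + 1 by omega, wordPow,
        List.append_assoc] at h7
      exact lt_asymm h7 (h6.2 _ _)
  -- Copies further to the left: one starting at `x` would have the same next smaller suffix as `w`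
  -- and fill the block; one starting before `x` would have to contain the block.
  have hdown : ∀ k ≤ i', x < α'.length + (i' - k) * w'.length ∧
      α'.length + (i' - k) * w'.length < x + w.length := by
    intro k
    induction k with
    | zero => exact fun _ => ⟨h1, h2⟩
    | succ k ih =>
      intro hk
      obtain ⟨h3, h4⟩ := ih (by omega)
      have h5 := hr'.isNextSmaller hw' (show i' - (k + 1) < h' by omega)
      rw [show i' - k = i' - (k + 1) + 1 by omega, Nat.add_mul, one_mul, ← Nat.add_assoc] at h3 h4
      generalize α'.length + (i' - (k + 1)) * w'.length = y at *
      rcases lt_trichotomy x y with h6 | h6 | h6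
      · exact ⟨h6, by omega⟩
      · subst h6
        have := hx.eq h5 hm hm'
        omega
      · have := h5.laminar hx h6 h3
        omega
  have hf := (hdown i' le_rfl).1
  rw [Nat.sub_self, zero_mul, Nat.add_zero] at hf
  have hl : α'.length + h' * w'.length ≤ x + w.length := by
    obtain ⟨h3, h4⟩ := hup (h' - 1 - i') (by omega)
    rw [show i' + (h' - 1 - i') = h' - 1 by omega] at h3 h4
    have h5 := hlam _ (by omega) h3 h4
    have e : h' * w'.length = (h' - 1) * w'.length + w'.length := by
      conv_lhs => rw [show h' = h' - 1 + 1 by omega, Nat.add_mul, one_mul]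
    omega
  have hd := hr'.drop (Nat.zero_le h')
  rw [zero_mul, Nat.add_zero, Nat.sub_zero] at hd
  -- The run keeps its exponent. Its remainder is cut off at the end of the block, and a prefix of
  -- `u'` is still smaller than `w'`.
  refine ⟨w.take (α'.length - x), u'.take (x + w.length - (α'.length + h' * w'.length)), ?_, ?_, ?_⟩
  · intro h
    rcases List.take_eq_nil_iff.1 h with h | h
    · omega
    · exact hw.1 h
  · conv_lhs => rw [← List.take_append_drop (α'.length - x) w]
    congr 1
    conv_lhs => rw [← ew]
    rw [List.drop_take, List.drop_drop, show x + (α'.length - x) = α'.length by omega, hd,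
      List.take_append, List.take_of_length_le (by rw [wordPow_length]; omega), wordPow_length]
    congr 2
    omega
  · exact (prefix_le (List.take_prefix _ _)).trans_lt hr'.lt

/-- Surplus copies on the left are absorbed into `α`, so the run remains maximal to the right. -/
theorem RunIn.exact {v w α u : List ℕ} {h k : ℕ} (hr : RunIn v w α u h) (hk : k ≤ h) :
    ∃ α', RunIn v w α' u k := by
  obtain ⟨j, rfl⟩ := Nat.exists_eq_add_of_le' hk
  refine ⟨α ++ wordPow w j, by simp [hr.ne_nil], ?_, hr.lt⟩
  rw [hr.eq, wordPow_add]; simp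

/-- Charge each word `w` to the places of a run `w^(K w)` in a shortest member of `F` that contains
one. Two words never charge the same place, so the total is at most the total length. -/
theorem sum_run_length_le (F : Finset (List ℕ)) (hF : ∀ v ∈ F, IsLyndon v) (K : List ℕ → ℕ)
    (hK : ∀ w ∈ F, 1 ≤ K w → ∃ v ∈ F, ∃ α u h, RunIn v w α u h ∧ K w ≤ h) :
    ∑ w ∈ F, K w * w.length ≤ ∑ v ∈ F, v.length := by
  have hmin : ∀ w, ∃ v α u, w ∈ F → 1 ≤ K w → v ∈ F ∧ RunIn v w α u (K w) ∧
      ∀ v' ∈ F, ∀ α' u', RunIn v' w α' u' (K w) → v.length ≤ v'.length := by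
    classical
    intro w
    by_cases hw : w ∈ F ∧ 1 ≤ K w
    · obtain ⟨v, hv, α, u, h, hr, hle⟩ := hK w hw.1 hw.2
      obtain ⟨α', hr'⟩ := hr.exact hle
      obtain ⟨v₀, h0, h0'⟩ := Finset.exists_min_image (F.filter fun v => ∃ α u, RunIn v w α u (K w))
        List.length ⟨v, Finset.mem_filter.2 ⟨hv, α', u, hr'⟩⟩
      obtain ⟨h1, α₀, u₀, h2⟩ := Finset.mem_filter.1 h0
      exact ⟨v₀, α₀, u₀, fun _ _ => ⟨h1, h2, fun v' hv' α' u' hr' =>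
        h0' v' (Finset.mem_filter.2 ⟨hv', α', u', hr'⟩)⟩⟩
    · exact ⟨[], [], [], fun h1 h2 => absurd ⟨h1, h2⟩ hw⟩
  choose v α u hv using hmin
  -- The charging map sends offset `t` in the run of `w` to the corresponding place in the chosen `v
  -- w`.
  have hle : (F.sigma fun w => Finset.range (K w * w.length)).card ≤
      (F.sigma fun v => Finset.range v.length).card := by
    apply Finset.card_le_card_of_injOn (fun p => ⟨v p.1, (α p.1).length + p.2⟩)
    · rintro ⟨w, t⟩ hp
      simp only [Finset.coe_sigma, Set.mem_sigma_iff, Finset.mem_coe, Finset.mem_range] at hp ⊢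
      have hK1 : 1 ≤ K w := by
        rcases Nat.eq_zero_or_pos (K w) with h | h
        · rw [h] at hp; omega
        · exact h
      obtain ⟨h1, h2, -⟩ := hv w hp.1 hK1
      refine ⟨h1, ?_⟩
      rw [h2.length]
      omega
    -- Compare the two copies covering a common place. With equal starts they have the same next
    -- smaller suffix, hence are the same word. Otherwise the run of `w'` lies inside `w`, and `w`
    -- is shorter than `v`, because `α` is nonempty; this contradicts the minimality of `v w'`.
    · have key : ∀ w ∈ F, ∀ w' ∈ F, ∀ t t', t < K w * w.length → t' < K w' * w'.length →
          v w = v w' → (α w).length + t = (α w').length + t' →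
          (α w).length + t / w.length * w.length ≤ (α w').length + t' / w'.length * w'.length →
          w = w' := by
        intro w hw w' hw' t t' ht ht' hvv htt hle
        have hm := List.length_pos_iff.2 (hF w hw).1
        have hm' := List.length_pos_iff.2 (hF w' hw').1
        have hi := (Nat.div_lt_iff_lt_mul hm).2 ht
        have hi' := (Nat.div_lt_iff_lt_mul hm').2 ht'
        obtain ⟨h1, h2, -⟩ := hv w hw ((Nat.zero_le _).trans_lt hi)
        obtain ⟨h1', h2', h3'⟩ := hv w' hw' ((Nat.zero_le _).trans_lt hi')
        rw [← hvv] at h2' h3'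
        have q := Nat.div_add_mod' t w.length
        have q' := Nat.div_add_mod' t' w'.length
        have r := Nat.mod_lt t hm
        have r' := Nat.mod_lt t' hm'
        rcases hle.lt_or_eq with hlt | heq
        · obtain ⟨α₂, u₂, hr⟩ := h2.nested h2' (hF w hw) (hF w' hw') hi hi' hlt (by omega)
          have h4 := h3' w hw _ _ hr
          have h5 := h2.length
          have h6 : 0 < (α w).length := List.length_pos_iff.2 h2.ne_nil
          have h7 : w.length ≤ K w * w.length := Nat.le_mul_of_pos_left _ ((Nat.zero_le _).trans_lt hi)
          omega
        · have e1 := h2.take hi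
          have e2 := h2'.take hi'
          have h5 := h2.isNextSmaller (hF w hw) hi
          have h6 := h2'.isNextSmaller (hF w' hw') hi'
          rw [← heq] at h6 e2
          rw [← h5.eq h6 hm hm', e1] at e2
          exact e2
      rintro ⟨w, t⟩ hp ⟨w', t'⟩ hp' he
      simp only [Finset.coe_sigma, Set.mem_sigma_iff, Finset.mem_coe, Finset.mem_range] at hp hp'
      simp only [Sigma.mk.injEq, heq_eq_eq] at he
      obtain ⟨he1, he2⟩ := he
      have e : w = w' := by
        rcases Nat.le_total ((α w).length + t / w.length * w.length)
          ((α w').length + t' / w'.length * w'.length) with h | h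
        · exact key w hp.1 w' hp'.1 t t' hp.2 hp'.2 he1 he2 h
        · exact (key w' hp'.1 w hp.1 t' t hp'.2 hp.2 he1.symm he2.symm h).symm
      subst e
      simp only [Sigma.mk.injEq, heq_eq_eq, true_and]
      omega
  simpa [Finset.card_sigma] using hle

/-! ## The number of passes -/

theorem exists_eq_wordPow_append {w : List ℕ} (hw : w ≠ []) (z : List ℕ) :
    ∃ h u, z = wordPow w h ++ u ∧ ¬ w <+: u := by
  induction hn : z.length using Nat.strong_induction_on generalizing z with
  | _ n ih =>
    by_cases hz : w <+: z
    · obtain ⟨z', rfl⟩ := hz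
      have := List.length_pos_iff.2 hw
      obtain ⟨h, u, rfl, hu⟩ := ih z'.length (by simp at hn; omega) z' rfl
      exact ⟨h + 1, u, by rw [wordPow, List.append_assoc], hu⟩
    · exact ⟨0, z, rfl, hz⟩

namespace CutContext

variable {ws : List (List ℕ)} {w V : List ℕ} (h : CutContext ws w V)

include h in
-- A suffix of a power begins with a suffix of `w` or with `w` itself; a proper suffix wins by a
-- mismatch, and `w` by `V$ < wV$`.
theorem lt_app_suffix_wordPow {j : ℕ} {t : List ℕ} (ht : t <:+ wordPow w j) (h0 : t ≠ []) :
    dollarKey V < app t (dollarKey V) := by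
  induction j with
  | zero => exact absurd (List.suffix_nil.1 ht) h0
  | succ j ih =>
    have hle := le_app_wordPow h.dollarKey_lt.le j
    have e := List.suffix_iff_eq_drop.1 ht
    generalize (wordPow w (j + 1)).length - t.length = k at e
    rw [wordPow] at e
    rcases Nat.lt_or_ge k w.length with hk | hk
    · rw [List.drop_append_of_le_length hk.le] at e
      rw [e, app_append]
      rcases Nat.eq_zero_or_pos k with rfl | hk0
      · rw [List.drop_zero]
        exact h.dollarKey_lt.trans_le (app_le_app.2 hle)
      · exact h.dollarKey_lt.trans ((h.lyndon.strongLt_drop hk0 hk).1 _ _)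
    · rw [List.drop_append, List.drop_of_length_le hk, List.nil_append] at e
      exact ih (e ▸ List.drop_suffix _ _)

omit h

/-- The number of rows smaller than `w ^ j V$`. -/
noncomputable def _root_.powPos (ws : List (List ℕ)) (w V : List ℕ) (j : ℕ) : ℕ :=
  keyCount (· < app (wordPow w j) (dollarKey V)) (stageRows ws (w ++ V))

theorem powPos_one : powPos ws w V 1 = rowPos ws w V 0 := by
  rw [powPos, wordPow_one, rowPos, oldKey_eq, List.drop_zero]

include h

theorem powKey_le {i j : ℕ} (hij : i ≤ j) :
    app (wordPow w i) (dollarKey V) ≤ app (wordPow w j) (dollarKey V) := by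
  obtain ⟨k, rfl⟩ := Nat.exists_eq_add_of_le hij
  rw [wordPow_add, app_append, app_le_app]
  exact le_app_wordPow h.dollarKey_lt.le k

theorem powKey_lt (j : ℕ) : app (wordPow w j) (dollarKey V) < omegaKey w := by
  rw [omegaKey_eq_app_wordPow h.lyndon.1 j, app_lt_app]
  exact h.dollarKey_lt_omegaKey

theorem powPos_mono {i j : ℕ} (hij : i ≤ j) : powPos ws w V i ≤ powPos ws w V j :=
  pcount_mono fun _ _ hb => lt_of_lt_of_le hb (h.powKey_le hij)

/-- The numbers are bounded by the number of rows and cannot increase forever. -/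
theorem exists_powPos_eq : ∃ j, powPos ws w V (j + 1) = powPos ws w V (j + 2) := by
  by_contra hc
  push Not at hc
  have hj : ∀ j, j ≤ powPos ws w V (j + 1) := by
    intro j
    induction j with
    | zero => exact Nat.zero_le _
    | succ j ih =>
      have := h.powPos_mono (show j + 1 ≤ j + 2 by omega)
      have := hc j
      change j + 1 ≤ powPos ws w V (j + 2)
      omega
  have h1 := hj ((stageRows ws (w ++ V)).card + 1)
  have h2 : powPos ws w V ((stageRows ws (w ++ V)).card + 1 + 1) ≤ _ := pcount_le_card _ _
  omega

/-- The number of passes until the number of smaller rows is stable. -/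
noncomputable def _root_.passCount (ws : List (List ℕ)) (w V : List ℕ) : ℕ :=
  sInf {j | powPos ws w V (j + 1) = powPos ws w V (j + 2)}

theorem powPos_passCount :
    powPos ws w V (passCount ws w V + 1) = powPos ws w V (passCount ws w V + 2) :=
  Nat.sInf_mem (s := {j | powPos ws w V (j + 1) = powPos ws w V (j + 2)}) h.exists_powPos_eq

theorem powPos_lt {j : ℕ} (hj : j < passCount ws w V) :
    powPos ws w V (j + 1) < powPos ws w V (j + 2) :=
  lt_of_le_of_ne (h.powPos_mono (by omega)) 
    (Nat.notMem_of_lt_sInf (s := {j | powPos ws w V (j + 1) = powPos ws w V (j + 2)}) hj)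

/-- A row between two consecutive powers comes from a power inside a later factor. -/
theorem exists_runIn (hws : ∀ u ∈ ws, IsLyndon u ∧ w ≤ u) {gs : List (List ℕ)} (hgs : NextSmallerFactors gs)
    (hV : V = gs.flatten) {j : ℕ} (hj : 2 ≤ j) (hlt : powPos ws w V j < powPos ws w V (j + 1)) :
    ∃ v ∈ gs, ∃ α u k, RunIn v w α u k ∧ j ≤ k := by
  obtain ⟨y, hy, h1, h2⟩ := exists_of_pcount_lt hlt
  rw [not_lt] at h2
  have hpos : ∀ {l1 l2 : List (List ℕ)}, gs = l1 ++ l2 → dollarKey l2.flatten ≤ dollarKey V := by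
    intro l1 l2 e
    rw [← not_lt, dollarKey_lt_iff h.pos_V, not_lt, hV, e]
    · exact NextSmallerFactors.flatten_append_le (e ▸ hgs)
    · intro c hc
      exact h.pos_V c (by rw [hV, e]; simp only [List.flatten_append, List.mem_append]; exact Or.inr hc)
  rcases mem_stageRows.1 hy with ⟨u, hu, k, hk, rfl⟩ | ⟨k, hk, rfl⟩
  -- Rows of earlier factors `u` have keys at least `u^ω ≥ w^ω`, above all powers followed by `V$`.
  · exfalso
    obtain ⟨hu1, hu2⟩ := hws u hu
    have h3 : omegaKey u ≤ app (u.drop k) (omegaKey u) := by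
      rcases Nat.eq_zero_or_pos k with rfl | hk0
      · rw [List.drop_zero, ← omegaKey_eq_app hu1.1]
      · conv_lhs => rw [omegaKey_eq_app hu1.1]
        exact ((hu1.strongLt_drop hk0 hk).1 _ _).le
    exact absurd (h1.trans (h.powKey_lt _))
      (not_lt.2 ((h.lyndon.omegaKey_le_omegaKey hu1 hu2).trans h3))
  · change dollarKey ((w ++ V).drop k) < _ at h1
    change _ ≤ dollarKey ((w ++ V).drop k) at h2
    rcases Nat.lt_or_ge k w.length with hkw | hkw
    -- Rows starting inside `w`: the row `wV$` is below `w^2 V$`, which is where `j ≥ 2` enters, and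
    -- a proper suffix of `w` exceeds everything starting with `w` by a mismatch.
    · exfalso
      rw [List.drop_append_of_le_length hkw.le, dollarKey_append] at h1 h2
      rcases Nat.eq_zero_or_pos k with rfl | hk0
      · have h3 := h.powKey_le hj
        have h4 : app (wordPow w 1) (dollarKey V) < app (wordPow w 2) (dollarKey V) := by
          rw [wordPow_one, wordPow, wordPow_one, app_append, app_lt_app]; exact h.dollarKey_lt
        rw [wordPow_one] at h4
        exact absurd (h4.trans_le (h3.trans h2)) (lt_irrefl _)
      · rw [wordPow, app_append] at h1
        exact lt_asymm h1 ((h.lyndon.strongLt_drop hk0 hkw).1 _ _)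
    · rw [List.drop_append, List.drop_of_length_le hkw, List.nil_append] at h1 h2
      generalize k - w.length = l at h1 h2
      -- Split the suffix of `V` at the next factor boundary. The part `z` is empty if the suffix
      -- starts at a boundary or behind the text; otherwise it is a proper suffix of a factor `v`.
      obtain ⟨l1, l2, e1, z, e2, hz⟩ : ∃ l1 l2, gs = l1 ++ l2 ∧ ∃ z, V.drop l = z ++ l2.flatten ∧
          (z = [] ∨ ∃ l0 v α, l1 = l0 ++ [v] ∧ v = α ++ z ∧ α ≠ [] ∧ z ≠ []) := by
        have : ∀ (gs : List (List ℕ)) (l : ℕ), ∃ l1 l2, gs = l1 ++ l2 ∧ ∃ z, gs.flatten.drop l = z ++ l2.flatten ∧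
          (z = [] ∨ ∃ l0 v α, l1 = l0 ++ [v] ∧ v = α ++ z ∧ α ≠ [] ∧ z ≠ []) := by
          intro gs
          induction gs with
          | nil => intro l; exact ⟨[], [], rfl, [], by simp, Or.inl rfl⟩
          | cons v gs ih =>
            intro l
            rcases Nat.lt_or_ge l v.length with hl | hl
            · rcases Nat.eq_zero_or_pos l with rfl | hl0
              · exact ⟨[], v :: gs, rfl, [], rfl, Or.inl rfl⟩
              · refine ⟨[v], gs, rfl, v.drop l, ?_, Or.inr ⟨[], v, v.take l, rfl, ?_, ?_, ?_⟩⟩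
                · rw [List.flatten_cons, List.drop_append_of_le_length hl.le]
                · rw [List.take_append_drop]
                · rw [Ne, List.take_eq_nil_iff]; rintro (h | rfl)
                  · omega
                  · simp at hl
                · rw [Ne, List.drop_eq_nil_iff]; omega
            · obtain ⟨l1, l2, rfl, z, hz, hc⟩ := ih (l - v.length)
              refine ⟨v :: l1, l2, rfl, z, ?_, ?_⟩
              · rw [List.flatten_cons, List.drop_append, List.drop_of_length_le hl, List.nil_append, hz]
              · rcases hc with hc | ⟨l0, v', α, rfl, hc⟩
                · exact Or.inl hc
                · exact Or.inr ⟨v :: l0, v', α, rfl, hc⟩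
        rw [hV]
        exact this gs l
      have hr := hpos e1
      rw [e2, dollarKey_append] at h1 h2
      have hvlt : dollarKey V < app (wordPow w j) (dollarKey V) :=
        h.lt_app_suffix_wordPow List.suffix_rfl fun h0 => by
          have := congrArg List.length h0
          rw [wordPow_length, List.length_nil] at this
          have := h.length_pos
          rcases Nat.mul_eq_zero.1 ‹j * w.length = 0› with h | h <;> omega
      rcases hz with rfl | ⟨l0, v, α, rfl, rfl, hα, hz0⟩
      -- A suffix starting at a factor boundary is at most `V$`, hence below `w^j V$`.
      · exact absurd (hvlt.trans_le (h2.trans hr)) (lt_irrefl _)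
      · generalize dollarKey l2.flatten = r at *
        obtain ⟨q, u, rfl, hu⟩ := exists_eq_wordPow_append h.lyndon.1 z
        -- After stripping all leading copies of `w`, fewer than `j` copies cannot remain: a
        -- mismatch contradicts one of the two bounds, and running out of `z` inside `w^j` would put
        -- the row below `w^j V$`.
        have hjq : j ≤ q := by
          rcases strongLt_or (wordPow w q ++ u) (wordPow w j) with h' | h' | ⟨t, ht⟩ | h'
          · exact absurd (h'.1 r (dollarKey V)) (not_lt.2 h2)
          · rw [wordPow_succ', app_append (wordPow w j)] at h1
            exact absurd (h'.1 (app w (dollarKey V)) r) (lt_asymm h1)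
          · by_contra hc
            by_cases ht0 : t = []
            · subst ht0
              rw [List.append_nil, show j = q + (j - q - 1 + 1) by omega, wordPow_add,
                List.append_cancel_left_eq, wordPow] at ht
              exact hu ⟨_, ht.symm⟩
            · have h3 := h.lt_app_suffix_wordPow ⟨_, ht⟩ ht0
              rw [← ht, app_append, app_le_app] at h2
              exact absurd (h3.trans_le (h2.trans hr)) (lt_irrefl _)
          · by_contra hc
            obtain ⟨t, ht⟩ := h'
            rw [show j = q + (j - q - 1 + 1) by omega, wordPow_add, List.append_assoc,
              List.append_cancel_left_eq, wordPow, List.append_assoc] at ht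
            exact hu ⟨_, ht⟩
        refine ⟨_, by rw [e1]; simp, α, u, q, ⟨hα, rfl, ?_⟩, hjq⟩
        rcases strongLt_or u w with h' | h' | h' | h'
        · exact h'.lt
        -- If the remainder were larger than `w` by a mismatch, the row would lie above `w^(q+1)
        -- V$`, which is at least `w^(j+1) V$`.
        · exfalso
          rw [app_append] at h1
          have h3 := h.powKey_le (show j + 1 ≤ q + 1 by omega)
          rw [wordPow_succ' w q, app_append] at h3
          exact lt_asymm (h1.trans_le h3) (app_lt_app.2 (h'.1 _ _))
        · refine lt_of_le_of_ne (prefix_le h') ?_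
          rintro rfl
          exact hu List.prefix_rfl
        · exact absurd h' hu

theorem le_passCount_runIn (hws : ∀ u ∈ ws, IsLyndon u ∧ w ≤ u) {gs : List (List ℕ)}
    (hgs : NextSmallerFactors gs) (hV : V = gs.flatten) (hp : 2 ≤ passCount ws w V) :
    ∃ v ∈ gs, ∃ α u k, RunIn v w α u k ∧ passCount ws w V ≤ k := by
  have := h.powPos_lt (j := passCount ws w V - 1) (by omega)
  rw [show passCount ws w V - 1 + 2 = passCount ws w V - 1 + 1 + 1 by omega] at this
  obtain ⟨v, hv, α, u, k, hr, hk⟩ := h.exists_runIn hws hgs hV (by omega) this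
  exact ⟨v, hv, α, u, k, hr, by omega⟩

variable {A : List ℕ} (hA : SortedArr (stageRows ws (w ++ V)) A)

/-- The composition of backward steps with the characters of `w`. -/
def _root_.backward (A w : List ℕ) (e : ℕ) : ℕ := w.foldr (lfc A) e

omit h in
include hA in
theorem backward_lt {u : List ℕ} (hu : ∀ c ∈ u, 1 ≤ c) (X : InfWord) :
    backward A u (keyCount (· < X) (stageRows ws (w ++ V))) =
      keyCount (· < app u X) (stageRows ws (w ++ V)) := by
  induction u with
  | nil => rfl
  | cons c u ih =>
    rw [List.forall_mem_cons] at hu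
    change lfc A c (backward A u _) = _
    rw [ih hu.2, hA.lfc_keyCount _ (isLowerKey_lt _), ← keyCount_stageRows_lt _ _ hu.1]
    rfl

omit h in
include hA in
theorem backward_le {u : List ℕ} (hu : ∀ c ∈ u, 1 ≤ c) (X : InfWord) :
    backward A u (keyCount (· ≤ X) (stageRows ws (w ++ V))) =
      keyCount (· ≤ app u X) (stageRows ws (w ++ V)) := by
  induction u with
  | nil => rfl
  | cons c u ih =>
    rw [List.forall_mem_cons] at hu
    change lfc A c (backward A u _) = _
    rw [ih hu.2, hA.lfc_keyCount _ (isLowerKey_le _), ← keyCount_stageRows_le _ _ hu.1]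
    rfl

include hA in
theorem backward_powPos (j : ℕ) : backward A w (powPos ws w V j) = powPos ws w V (j + 1) := by
  rw [powPos, backward_lt hA h.pos_w, ← app_append]; rfl

include hA in
-- Once two consecutive numbers agree, all later ones do. Every row below `w^ω` is below some power,
-- so the stable value counts the rows below `w^ω`; without a row equal to `w^ω` these are the rows
-- up to `w^ω`.
theorem powPos_passCount_eq (hne : ∀ b ∈ stageRows ws (w ++ V), b.1 ≠ omegaKey w) :
    powPos ws w V (passCount ws w V + 1) = rowEnd ws w V 0 := by
  have hst : ∀ i, powPos ws w V (passCount ws w V + 1 + i) = powPos ws w V (passCount ws w V + 1) := by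
    intro i
    induction i with
    | zero => rfl
    | succ i ih => rw [← Nat.add_assoc, ← h.backward_powPos hA, ih, h.backward_powPos hA, ← h.powPos_passCount]
  rw [rowEnd, newKey_zero h.lyndon.1]
  apply le_antisymm (pcount_mono fun _ _ hb => (lt_trans hb (h.powKey_lt _)).le)
  by_contra hc
  obtain ⟨y, hy, h1, h2⟩ := exists_of_pcount_lt (not_le.1 hc)
  obtain ⟨i, hi⟩ := exists_lt_app_wordPow h.lyndon.1 (lt_of_le_of_ne h1 (hne y hy))
  have h3 : powPos ws w V (passCount ws w V + 1) < powPos ws w V (passCount ws w V + 1 + i) :=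
    pcount_lt (fun _ _ hb => lt_of_lt_of_le hb (h.powKey_le (by omega))) hy h2
      ((hi (dollarKey V)).trans_le (h.powKey_le (by omega)))
  rw [hst] at h3
  exact lt_irrefl _ h3

theorem ne_omegaKey (hws : ∀ u ∈ ws, IsLyndon u ∧ w ≤ u) (hw : w ∉ ws) :
    ∀ b ∈ stageRows ws (w ++ V), b.1 ≠ omegaKey w := by
  intro b hb e
  rcases mem_stageRows.1 hb with ⟨u, hu, k, hk, rfl⟩ | ⟨k, hk, rfl⟩
  · obtain ⟨hu1, hu2⟩ := hws u hu
    have h3 : omegaKey u ≤ app (u.drop k) (omegaKey u) := by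
      rcases Nat.eq_zero_or_pos k with rfl | hk0
      · rw [List.drop_zero, ← omegaKey_eq_app hu1.1]
      · conv_lhs => rw [omegaKey_eq_app hu1.1]
        exact ((hu1.strongLt_drop hk0 hk).1 _ _).le
    change app (u.drop k) (omegaKey u) = _ at e
    rw [e] at h3
    rcases hu2.lt_or_eq with hlt | rfl
    · exact absurd (h.lyndon.omegaKey_lt_omegaKey hu1 hlt) (not_lt.2 h3)
    · exact hw hu
  · apply omegaKey_apply_ne_zero h.lyndon.1 h.pos_w ((w ++ V).drop k).length
    rw [← e]
    exact dollarKey_apply_length _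

include hA in
-- For `u > w` the word `w u^ω` is strictly below `u^ω`, and the row of `u` itself separates the two
-- counts. Thus one pass detects a repeated factor.
theorem backward_prev_eq_iff {u : List ℕ} (hu : u ∈ ws) (hu1 : IsLyndon u) (hu2 : w ≤ u) :
    backward A w (keyCount (· ≤ omegaKey u) (stageRows ws (w ++ V))) =
      keyCount (· ≤ omegaKey u) (stageRows ws (w ++ V)) ↔ u = w := by
  rw [backward_le hA h.pos_w]
  constructor
  · intro e
    by_contra hc
    have h1 := app_lt_of_omegaKey_lt h.lyndon.1
      (h.lyndon.omegaKey_lt_omegaKey hu1 (lt_of_le_of_ne hu2 (Ne.symm hc)))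
    have h2 : (wordRow u 0) ∈ stageRows ws (w ++ V) :=
      mem_stageRows.2 (Or.inl ⟨u, hu, 0, List.length_pos_iff.2 hu1.1, rfl⟩)
    have e3 : (wordRow u 0).1 = omegaKey u := by
      rw [wordRow, List.drop_zero, ← omegaKey_eq_app hu1.1]
    have h3 : keyCount (· ≤ app w (omegaKey u)) (stageRows ws (w ++ V)) <
        keyCount (· ≤ omegaKey u) (stageRows ws (w ++ V)) :=
      pcount_lt (fun _ _ hb => le_trans hb h1.le) h2 (by rw [e3]; exact not_le.2 h1) (by rw [e3])
    omega
  · rintro rfl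
    rw [← omegaKey_eq_app hu1.1]

theorem keyCount_omegaKey : keyCount (· ≤ omegaKey w) (stageRows ws (w ++ V)) = rowEnd ws w V 0 := by
  rw [rowEnd, newKey_zero h.lyndon.1]

include hA in
-- For the first factor the initial candidate `0` must be rejected: every backward step with a
-- positive character counts the delimiter.
theorem backward_zero_ne : backward A w 0 ≠ 0 := by
  have h0 := h.length_pos
  obtain ⟨c, u, rfl⟩ := List.exists_cons_of_length_pos h0
  have hc := h.pos_w c (by simp)
  change lfc A c _ ≠ 0
  have h1 : 0 < A.countP (fun a => decide (a < c)) := by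
    rw [List.countP_pos_iff]
    have h2 : 0 < A.count 0 := by rw [h.count_zero hA]; exact Nat.one_pos
    exact ⟨0, List.count_pos_iff.1 h2, decide_eq_true hc⟩
  unfold lfc
  omega

end CutContext

/-! ## The stages of a factorization -/

/-- The factorization `fs` by next smaller suffixes of a text over positive characters. -/
structure TextFactors (fs : List (List ℕ)) : Prop where
  nextSmaller : NextSmallerFactors fs
  pos : ∀ u ∈ fs, ∀ c ∈ u, 1 ≤ c

/-- The text behind the `x`-th factor. -/
def laterText (fs : List (List ℕ)) (x : ℕ) : List ℕ := (fs.drop (x + 1)).flatten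

namespace TextFactors

variable {fs : List (List ℕ)} (h : TextFactors fs) {x : ℕ} (hx : x < fs.length)

theorem _root_.getD_cons_drop (hx : x < fs.length) : fs.drop x = fs.getD x [] :: fs.drop (x + 1) := by
  rw [List.drop_eq_getElem_cons hx, List.getD_eq_getElem _ _ hx]

theorem _root_.getD_mem (hx : x < fs.length) : fs.getD x [] ∈ fs := by
  rw [List.getD_eq_getElem _ _ hx]; exact List.getElem_mem hx

theorem _root_.flatten_drop_eq (hx : x < fs.length) : (fs.drop x).flatten = fs.getD x [] ++ laterText fs x := by
  rw [getD_cons_drop hx]; rfl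

theorem _root_.take_succ_getD (hx : x < fs.length) : fs.take (x + 1) = fs.take x ++ [fs.getD x []] := by
  rw [List.take_succ_eq_append_getElem hx, List.getD_eq_getElem _ _ hx]

include h

theorem pos_take : ∀ u ∈ fs.take x, ∀ c ∈ u, 1 ≤ c := fun u hu => h.pos u (List.mem_of_mem_take hu)

theorem pos_flatten : ∀ c ∈ (fs.drop x).flatten, 1 ≤ c := by
  intro c hc
  obtain ⟨u, hu, hc⟩ := List.mem_flatten.1 hc
  exact h.pos u (List.mem_of_mem_drop hu) c hc

theorem isLyndon : ∀ u ∈ fs, IsLyndon u := h.nextSmaller.isLyndonFactorization.2.1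

include hx in
theorem cutContext : CutContext (fs.take x) (fs.getD x []) (laterText fs x) where
  lyndon := h.isLyndon _ (getD_mem hx)
  pos_ws := h.pos_take
  pos_w := h.pos _ (getD_mem hx)
  pos_V := h.pos_flatten
  lt := by
    have := h.nextSmaller.drop x
    rw [getD_cons_drop hx] at this
    exact this.2.1

theorem getD_le {y : ℕ} (hxy : x ≤ y) (hy : y < fs.length) : fs.getD y [] ≤ fs.getD x [] := by
  rcases hxy.lt_or_eq with hlt | rfl
  · rw [List.getD_eq_getElem _ _ hy, List.getD_eq_getElem _ _ (hlt.trans hy)]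
    exact List.pairwise_iff_getElem.1 h.nextSmaller.isLyndonFactorization.2.2 _ _ _ _ hlt
  · exact le_rfl

include hx in
theorem le_take : ∀ u ∈ fs.take x, IsLyndon u ∧ fs.getD x [] ≤ u := by
  intro u hu
  refine ⟨h.isLyndon u (List.mem_of_mem_take hu), ?_⟩
  obtain ⟨y, hy, rfl⟩ := List.mem_iff_getElem.1 hu
  rw [List.length_take] at hy
  rw [List.getElem_take, ← List.getD_eq_getElem _ []]
  exact h.getD_le (by omega) hx

include hx in
-- Factors do not increase, so equal factors are consecutive, and looking at the preceding one
-- suffices.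
theorem mem_take_iff : fs.getD x [] ∈ fs.take x ↔ 0 < x ∧ fs.getD (x - 1) [] = fs.getD x [] := by
  constructor
  · intro hu
    obtain ⟨y, hy, e⟩ := List.mem_iff_getElem.1 hu
    rw [List.length_take] at hy
    rw [List.getElem_take, ← List.getD_eq_getElem _ []] at e
    refine ⟨by omega, le_antisymm ?_ (h.getD_le (by omega) hx)⟩
    rw [← e]
    exact h.getD_le (by omega) (by omega)
  · rintro ⟨h0, e⟩
    rw [← e, List.getD_eq_getElem _ _ (by omega), List.mem_take_iff_getElem]
    exact ⟨x - 1, by omega, rfl⟩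

/-- The number of passes needed for the `x`-th factor; none if it equals the factor before. -/
noncomputable def _root_.passes (fs : List (List ℕ)) (x : ℕ) : ℕ :=
  open Classical in
  if fs.getD x [] ∈ fs.take x then 0 else passCount (fs.take x) (fs.getD x []) (laterText fs x)

omit h hx in
theorem _root_.sum_length_getD (fs : List (List ℕ)) :
    ∑ x ∈ Finset.range fs.length, (fs.getD x []).length = fs.flatten.length := by
  induction fs with
  | nil => rfl
  | cons w fs ih =>
    rw [List.length_cons, Finset.sum_range_succ', List.flatten_cons, List.length_append, ← ih, Nat.add_comm]
    rfl

omit h in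
theorem _root_.sum_length_toFinset_le [DecidableEq (List ℕ)] (fs : List (List ℕ)) :
    ∑ v ∈ fs.toFinset, v.length ≤ fs.flatten.length := by
  induction fs with
  | nil => simp
  | cons w fs ih =>
    rw [List.toFinset_cons, List.flatten_cons, List.length_append]
    by_cases hw : w ∈ fs.toFinset
    · rw [Finset.insert_eq_of_mem hw]; omega
    · rw [Finset.sum_insert hw]; omega

/-- Factors with at most one pass contribute at most their own length. All others are distinct first
occurrences with a run inside a later factor, so `sum_run_length_le` bounds their share by the
length of the text as well. -/
theorem sum_passes_le :
    ∑ x ∈ Finset.range fs.length, passes fs x * (fs.getD x []).length ≤ 2 * fs.flatten.length := by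
  classical
  have hidx : ∀ x < fs.length, fs.getD x [] ∉ fs.take x → fs.idxOf (fs.getD x []) = x := by
    intro x hx hn
    have hlt := List.idxOf_lt_length_of_mem (getD_mem hx)
    have he : fs[fs.idxOf (fs.getD x [])] = fs.getD x [] := List.getElem_idxOf hlt
    rcases lt_trichotomy (fs.idxOf (fs.getD x [])) x with h1 | h1 | h1
    · exact absurd (List.mem_take_iff_getElem.2 ⟨_, by omega, he⟩) hn
    · exact h1
    · have := List.not_of_lt_findIdx (p := (· == fs.getD x [])) (xs := fs) (i := x) h1
      simp [List.getElem?_eq_getElem hx] at this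
  let P : List ℕ → ℕ := fun w => passes fs (fs.idxOf w)
  -- Pass numbers below two carry no information about runs and are set to zero here; they are paid
  -- for in `hsplit`.
  let K : List ℕ → ℕ := fun w => if 2 ≤ P w then P w else 0
  have hlen := sum_length_toFinset_le fs
  have hK : ∑ w ∈ fs.toFinset, K w * w.length ≤ ∑ v ∈ fs.toFinset, v.length := by
    apply sum_run_length_le
    · intro v hv
      exact h.isLyndon v (List.mem_toFinset.1 hv)
    · intro w hw h1
      rw [List.mem_toFinset] at hw
      have h2 : 2 ≤ P w := by
        by_contra hc
        simp [K, hc] at h1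
      have h3 : K w = P w := if_pos h2
      have hlt := List.idxOf_lt_length_of_mem hw
      have he : fs.getD (fs.idxOf w) [] = w := by
        rw [List.getD_eq_getElem _ _ hlt]; exact List.getElem_idxOf hlt
      have h4 : P w = passCount (fs.take (fs.idxOf w)) w (laterText fs (fs.idxOf w)) := by
        change passes fs _ = _
        unfold passes
        split_ifs with h5
        · have : P w = 0 := if_pos h5
          omega
        · rw [he]
      have hc := h.cutContext hlt
      have hl := h.le_take hlt
      rw [he] at hc hl
      obtain ⟨v, hv, α, u, k, hr, hk⟩ := hc.le_passCount_runIn hl (h.nextSmaller.drop (fs.idxOf w + 1)) rfl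
        (by omega)
      exact ⟨v, List.mem_toFinset.2 (List.mem_of_mem_drop hv), α, u, k, hr, by omega⟩
  have hsplit : ∀ x ∈ Finset.range fs.length, passes fs x * (fs.getD x []).length ≤
      (fs.getD x []).length + if fs.getD x [] ∉ fs.take x then
        K (fs.getD x []) * (fs.getD x []).length else 0 := by
    intro x hx
    rw [Finset.mem_range] at hx
    by_cases hc : fs.getD x [] ∈ fs.take x
    · rw [passes, if_pos hc, zero_mul]
      exact Nat.zero_le _
    · rw [if_pos hc]
      have e : P (fs.getD x []) = passes fs x := by
        change passes fs (fs.idxOf _) = _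
        rw [hidx x hx hc]
      rw [← e]
      by_cases h2 : 2 ≤ P (fs.getD x [])
      · rw [show K (fs.getD x []) = P (fs.getD x []) from if_pos h2]
        omega
      · have : P (fs.getD x []) * (fs.getD x []).length ≤ 1 * (fs.getD x []).length :=
          Nat.mul_le_mul_right _ (by omega)
        omega
  refine (Finset.sum_le_sum hsplit).trans ?_
  rw [Finset.sum_add_distrib, sum_length_getD, ← Finset.sum_filter]
  -- Sums over positions of first occurrences are sums over distinct words, since `idxOf` recovers
  -- the position.
  have h5 : ∑ x ∈ (Finset.range fs.length).filter (fun x => fs.getD x [] ∉ fs.take x),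
      K (fs.getD x []) * (fs.getD x []).length ≤ ∑ w ∈ fs.toFinset, K w * w.length := by
    rw [← Finset.sum_image (f := fun w => K w * w.length) (g := fun x => fs.getD x [])]
    · apply Finset.sum_le_sum_of_subset
      intro w hw
      obtain ⟨x, hx, rfl⟩ := Finset.mem_image.1 hw
      exact List.mem_toFinset.2 (getD_mem (Finset.mem_range.1 (Finset.mem_filter.1 hx).1))
    · intro x hx y hy e
      simp only [Finset.coe_filter, Finset.mem_range, Set.mem_ofPred_eq] at hx hy
      have e' : fs.getD x [] = fs.getD y [] := e
      rw [← hidx x hx.1 hx.2, ← hidx y hy.1 hy.2, e']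
  omega

end TextFactors

/-! ## Subroutines -/

/-- Only registers from `20` on have changed. -/
structure Frame (σ σ' : MemState) : Prop where
  reg : ∀ r < 20, σ'.reg r = σ.reg r
  arr : σ'.arr = σ.arr
  swaps : σ'.swaps = σ.swaps
  lookups : σ'.lookups = σ.lookups

theorem Frame.refl (σ : MemState) : Frame σ σ := ⟨fun _ _ => rfl, rfl, rfl, rfl⟩

theorem Frame.trans {σ σ' σ'' : MemState} (h : Frame σ σ') (h' : Frame σ' σ'') : Frame σ σ'' :=
  ⟨fun r hr => (h'.reg r hr).trans (h.reg r hr), h'.arr.trans h.arr, h'.swaps.trans h.swaps,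
    h'.lookups.trans h.lookups⟩

theorem Frame.set {σ σ' : MemState} (h : Frame σ σ') {r : ℕ} (hr : 20 ≤ r) (v : ℕ) : Frame σ (σ'.set r v) :=
  ⟨fun r' hr' => by rw [← h.reg r' hr']; exact Function.update_of_ne (by omega) _ _, h.arr, h.swaps, h.lookups⟩

theorem frame_set_iff {σ σ' : MemState} {r : ℕ} (hr : 20 ≤ r) (v : ℕ) :
    Frame σ (σ'.set r v) ↔ Frame σ σ' :=
  ⟨fun h => ⟨fun r' hr' => by rw [← h.reg r' hr']; exact (Function.update_of_ne (by omega) _ _).symm,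
    h.arr, h.swaps, h.lookups⟩, fun h => h.set hr v⟩

@[simp] theorem MemState.set_reg (σ : MemState) (r v r' : ℕ) :
    (σ.set r v).reg r' = if r' = r then v else σ.reg r' := Function.update_apply _ _ _ _

@[simp] theorem MemState.set_arr (σ : MemState) (r v : ℕ) : (σ.set r v).arr = σ.arr := rfl

@[simp] theorem MemState.set_swaps (σ : MemState) (r v : ℕ) : (σ.set r v).swaps = σ.swaps := rfl

@[simp] theorem MemState.set_lookups (σ : MemState) (r v : ℕ) : (σ.set r v).lookups = σ.lookups := rfl

/-- The increment of the counter when one more entry is scanned: an entry counts if it is smaller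
than `c`, or equal to `c` and before `p`. -/
theorem lfc_take_succ {A : List ℕ} {i : ℕ} (hi : i < A.length) (c p : ℕ) :
    lfc (A.take (i + 1)) c p = lfc (A.take i) c p +
      if A.getD i 0 < c ∨ A.getD i 0 = c ∧ i < p then 1 else 0 := by
  rw [List.take_succ_eq_append_getElem hi, List.getD_eq_getElem _ _ hi]
  generalize A[i] = a
  have hl : (A.take i).length = i := by rw [List.length_take]; omega
  unfold lfc rank
  rw [List.countP_append, List.take_append, List.count_append, hl]
  rcases Nat.lt_or_ge i p with hp | hp
  · rw [List.take_of_length_le (l := [a]) (by simp; omega)]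
    simp only [List.countP_singleton, List.count_singleton, beq_iff_eq, decide_eq_true_eq]
    split_ifs <;> omega
  · rw [show p - i = 0 by omega]
    simp only [List.countP_singleton, List.take_zero, List.count_nil, decide_eq_true_eq]
    split_ifs <;> omega

theorem Spec.loop {W : ℕ} {r s : ℕ} {a : Com} {Q : MemState → Prop} (I : ℕ → MemState → Prop) (N : ℕ)
    (ha : ∀ i < N, ∀ σ, σ.Bounded W → I i σ → σ.reg r < σ.reg s ∧ a.Pre W (I (i + 1)) σ)
    (hfin : ∀ σ, σ.Bounded W → I N σ → ¬ σ.reg r < σ.reg s ∧ Q σ) {σ : MemState} (h0 : I 0 σ) :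
    Spec W (.whileLt r s a) σ (N * (a.size + 2) + 2) Q :=
  Spec.whileLt I N a.size (fun i hi σ hb h => ⟨(ha i hi σ hb h).1, Spec.block (ha i hi σ hb h).2⟩) hfin h0

/-- With `c`, `L`, `p`, `e` in registers `20`, ..., `23`, compute `lfc` of the first `L` entries at `p`
and at `e`. -/
def scan : Com :=
  (.op (.const 26 0) ;; .op (.const 24 0) ;; .op (.const 25 0) ;; .op (.const 28 1)) ;;
  .whileLt 26 21 (.op (.load 27 26) ;;
    .ifLt 27 20 (.op (.add 24 24 28) ;; .op (.add 25 25 28))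
      (.ifEq 27 20 (.ifLt 26 22 (.op (.add 24 24 28)) .skip ;; .ifLt 26 23 (.op (.add 25 25 28)) .skip) .skip) ;;
    .op (.add 26 26 28))

theorem scan_spec {W : ℕ} {σ : MemState} {A : List ℕ} {L c p e : ℕ} (hA : σ.arr = A) (hL : L ≤ A.length)
    (hW : A.length < W) (h20 : σ.reg 20 = c) (h21 : σ.reg 21 = L) (h22 : σ.reg 22 = p)
    (h23 : σ.reg 23 = e) : Spec W scan σ (20 * L + 6) fun σ' => Frame σ σ' ∧
      σ'.reg 24 = lfc (A.take L) c p ∧ σ'.reg 25 = lfc (A.take L) c e := by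
  have hle : ∀ i ≤ L, ∀ p, lfc (A.take i) c p ≤ i := fun i hi p =>
    (lfc_le _ _ _).trans (by rw [List.length_take]; omega)
  refine (Spec.seq (T := 4) (T' := L * (16 + 2) + 2) ((Spec.block ?_).mono (by decide) fun _ _ h => h)).mono
    (by omega) fun _ _ h => h
  simp only [Com.Pre, Instr.apply, Instr.Fits, Instr.IsOp, true_and]
  refine ⟨by omega, by omega, by omega, by omega, ?_⟩
  refine (Spec.loop (fun i σ' => Frame σ σ' ∧ σ'.reg 20 = c ∧ σ'.reg 21 = L ∧ σ'.reg 22 = p ∧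
      σ'.reg 23 = e ∧ σ'.reg 28 = 1 ∧ σ'.reg 26 = i ∧ σ'.reg 24 = lfc (A.take i) c p ∧
      σ'.reg 25 = lfc (A.take i) c e) L ?_ ?_ ?_).mono ?_ fun _ _ h => h
  · rintro i hi τ - ⟨hf, t20, t21, t22, t23, t28, t26, t24, t25⟩
    refine ⟨by omega, ?_⟩
    have hp := hle i hi.le p
    have he := hle i hi.le e
    have hs : ∀ p, lfc (A.take (i + 1)) c p = _ := lfc_take_succ (show i < A.length by omega) c
    simp only [Com.Pre, Instr.apply, Instr.Fits, Instr.IsOp, true_and, MemState.set_reg, hs,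
      t20, t21, t22, t23, t24, t25, t26, t28, hf.arr, hA,
      Nat.reduceEqDiff, Nat.reduceLeDiff, frame_set_iff, if_true, if_false, hf]
    repeat' first | apply And.intro | intro
    all_goals first | omega | (split_ifs <;> omega)
  · rintro τ - ⟨hf, t20, t21, t22, t23, t28, t26, t24, t25⟩
    exact ⟨by omega, hf, t24, t25⟩
  · simp only [MemState.set_reg, Nat.reduceEqDiff, if_true, if_false, h20, h21, h22, h23, true_and]
    refine ⟨(((((Frame.refl σ).set ?_ _).set ?_ _).set ?_ _).set ?_ _), ?_⟩ <;> simp [lfc, rank]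
  · simp only [Com.size]; omega

/-- The exchanges that move the entry at `p` to position `q`. -/
def rotate : Com := .op (.const 28 1) ;;
  .whileLt 20 21 (.op (.add 24 20 28) ;; .op (.swap 20 24) ;; .op (.move 20 24))

theorem rotate_spec {W : ℕ} {σ : MemState} {p q : ℕ} (h20 : σ.reg 20 = p) (h21 : σ.reg 21 = q)
    (hW : q ≤ W) (hW1 : 1 ≤ W) : Spec W rotate σ (5 * q + 3) fun σ' =>
      Frame { σ with arr := exchanges σ.arr (swapRun p (q - p)), swaps := σ.swaps ++ swapRun p (q - p) } σ' := by
  refine (Spec.seq (T := 1) (T' := (q - p) * (3 + 2) + 2)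
    ((Spec.block ?_).mono (by decide) fun _ _ h => h)).mono (by omega) fun _ _ h => h
  simp only [Com.Pre, Instr.apply, Instr.Fits, Instr.IsOp, true_and]
  refine ⟨hW1, Spec.loop (fun i σ' => Frame { σ with
    arr := exchanges σ.arr (swapRun p i), swaps := σ.swaps ++ swapRun p i } σ' ∧
    σ'.reg 20 = p + i ∧ σ'.reg 21 = q ∧ σ'.reg 28 = 1) (q - p) ?_ ?_ ?_⟩
  · rintro i hi τ - ⟨hf, t20, t21, t28⟩
    refine ⟨by omega, ?_⟩
    simp only [Com.Pre, Instr.apply, Instr.Fits, Instr.IsOp, true_and, MemState.set_reg, MemState.set_arr,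
      MemState.set_swaps, t20, t21, t28, Nat.reduceEqDiff, Nat.reduceLeDiff, frame_set_iff, if_true, if_false,
      and_true]
    refine ⟨by omega, ⟨fun r hr => ?_, ?_, ?_, hf.lookups⟩, by omega⟩
    · rw [← hf.reg r hr]; simp [show r ≠ 24 by omega]
    · simp only [hf.arr, swapRun_succ_last, exchanges_append]; rfl
    · simp only [hf.swaps, swapRun_succ_last, List.append_assoc]
  · rintro τ - ⟨hf, t20, t21, -⟩
    exact ⟨by omega, hf⟩
  · simp only [MemState.set_reg, Nat.reduceEqDiff, Nat.reduceLeDiff, frame_set_iff, if_true, if_false, h20, h21]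
    exact ⟨⟨fun _ _ => rfl, rfl, (List.append_nil _).symm, rfl⟩, by simp⟩

/-- Find the position of the only `0` of the array. -/
def findZero : Com := (.op (.const 26 0) ;; .op (.const 28 1) ;; .op (.const 29 0)) ;;
  .whileLt 26 0 (.op (.load 27 26) ;; .ifEq 27 29 (.op (.move 24 26)) .skip ;; .op (.add 26 26 28))

theorem findZero_spec {W : ℕ} {σ : MemState} {A : List ℕ} {d : ℕ} (hA : σ.arr = A)
    (h0 : σ.reg 0 = A.length) (hW : A.length < W) (hd : d < A.length)
    (h : ∀ i < A.length, A.getD i 0 = 0 ↔ i = d) :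
    Spec W findZero σ (7 * A.length + 5) fun σ' => Frame σ σ' ∧ σ'.reg 24 = d := by
  refine (Spec.seq (T := 3) (T' := A.length * (5 + 2) + 2)
    ((Spec.block ?_).mono (by decide) fun _ _ h => h)).mono (by omega) fun _ _ h => h
  simp only [Com.Pre, Instr.apply, Instr.Fits, Instr.IsOp, true_and]
  refine ⟨by omega, by omega, by omega, ?_⟩
  refine (Spec.loop (fun i σ' => Frame σ σ' ∧ σ'.reg 28 = 1 ∧ σ'.reg 29 = 0 ∧ σ'.reg 26 = i ∧
    (d < i → σ'.reg 24 = d)) A.length ?_ ?_ ?_)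
  · rintro i hi τ - ⟨hf, t28, t29, t26, t24⟩
    have t0 := hf.reg 0 (by omega)
    have e := h i hi
    refine ⟨by omega, ?_⟩
    simp only [Com.Pre, Instr.apply, Instr.Fits, Instr.IsOp, true_and, MemState.set_reg,
      t26, t28, t29, hf.arr, hA, e, Nat.reduceEqDiff, Nat.reduceLeDiff, frame_set_iff, if_true, if_false, hf]
    repeat' first | apply And.intro | intro
    all_goals omega
  · rintro τ - ⟨hf, t28, t29, t26, t24⟩
    have t0 := hf.reg 0 (by omega)
    exact ⟨by omega, hf, t24 hd⟩
  · simp [frame_set_iff, Frame.refl]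

/-- `scan` with the arguments in the registers `c`, `l`, `p`, `e`. -/
def callScan (c l p e : ℕ) : Com :=
  (.op (.move 20 c) ;; .op (.move 21 l) ;; .op (.move 22 p) ;; .op (.move 23 e)) ;; scan

theorem callScan_spec {W : ℕ} {σ : MemState} {A : List ℕ} {c l p e : ℕ} (hA : σ.arr = A)
    (hL : σ.reg l ≤ A.length) (hW : A.length < W) (hl : l < 20) (hp : p < 20) (he : e < 20) :
    Spec W (callScan c l p e) σ (20 * A.length + 10) fun σ' => Frame σ σ' ∧
      σ'.reg 24 = lfc (A.take (σ.reg l)) (σ.reg c) (σ.reg p) ∧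
      σ'.reg 25 = lfc (A.take (σ.reg l)) (σ.reg c) (σ.reg e) := by
  refine (Spec.seq (T := 4) (T' := 20 * A.length + 6)
    ((Spec.block ?_).mono (by simp [Com.size]) fun _ _ h => h)).mono (by omega) fun _ _ h => h
  have h20 : ∀ r < 20, ∀ s ≥ 20, r ≠ s := by omega
  simp only [Com.Pre, Instr.apply, Instr.Fits, Instr.IsOp, true_and, MemState.set_reg, h20 l hl, h20 p hp, h20 e he,
    Nat.reduceLeDiff, if_false, ge_iff_le]
  refine (scan_spec (A := A) (L := σ.reg l) (c := σ.reg c) (p := σ.reg p) (e := σ.reg e) (by exact hA) hL hW ?_ ?_ ?_ ?_).mono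
    ?_ ?_
  · simp
  · simp
  · simp
  · simp
  · omega
  · rintro τ - ⟨hf, h1, h2⟩
    refine ⟨Frame.trans ?_ hf, h1, h2⟩
    simp [frame_set_iff, Frame.refl]

/-! ## The program for the conversion on the fly -/

/-- Registers `0`, `1`, `2`, `4`, `5`, `8` of the second program. -/
structure MainState (A : List ℕ) (d cand p m : ℕ) (S : List (ℕ × ℕ)) (l : ℕ) (σ : MemState) : Prop where
  arr : σ.arr = A
  reg0 : σ.reg 0 = A.length
  reg1 : σ.reg 1 = d
  reg2 : σ.reg 2 = cand
  reg4 : σ.reg 4 = p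
  reg5 : σ.reg 5 = m
  reg8 : σ.reg 8 = 1
  swaps : σ.swaps = S
  lookups : σ.lookups = l

theorem MainState.of_frame {A : List ℕ} {d cand p m : ℕ} {S : List (ℕ × ℕ)} {l : ℕ} {σ σ' : MemState}
    (h : MainState A d cand p m S l σ) (hf : Frame σ σ') : MainState A d cand p m S l σ' :=
  ⟨hf.arr.trans h.arr, (hf.reg 0 (by omega)).trans h.reg0, (hf.reg 1 (by omega)).trans h.reg1,
    (hf.reg 2 (by omega)).trans h.reg2, (hf.reg 4 (by omega)).trans h.reg4,
    (hf.reg 5 (by omega)).trans h.reg5, (hf.reg 8 (by omega)).trans h.reg8,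
    hf.swaps.trans h.swaps, hf.lookups.trans h.lookups⟩

theorem MainState.set {A : List ℕ} {d cand p m : ℕ} {S : List (ℕ × ℕ)} {l : ℕ} {σ : MemState}
    (h : MainState A d cand p m S l σ) {r : ℕ} (hr : r = 3 ∨ r = 6 ∨ r = 7 ∨ 9 ≤ r) (v : ℕ) :
    MainState A d cand p m S l (σ.set r v) := by
  have e : ∀ s, s ≠ r → (σ.set r v).reg s = σ.reg s := fun s hs => by rw [MemState.set_reg, if_neg hs]
  exact ⟨h.arr, (e 0 (by omega)).trans h.reg0, (e 1 (by omega)).trans h.reg1,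
    (e 2 (by omega)).trans h.reg2, (e 4 (by omega)).trans h.reg4,
    (e 5 (by omega)).trans h.reg5, (e 8 (by omega)).trans h.reg8, h.swaps, h.lookups⟩

theorem MainState.set1 {A : List ℕ} {d cand p m : ℕ} {S : List (ℕ × ℕ)} {l : ℕ} {σ : MemState}
    (h : MainState A d cand p m S l σ) (v : ℕ) : MainState A v cand p m S l (σ.set 1 v) :=
  ⟨h.arr, h.reg0, rfl, h.reg2, h.reg4, h.reg5, h.reg8, h.swaps, h.lookups⟩

theorem MainState.set2 {A : List ℕ} {d cand p m : ℕ} {S : List (ℕ × ℕ)} {l : ℕ} {σ : MemState}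
    (h : MainState A d cand p m S l σ) (v : ℕ) : MainState A d v p m S l (σ.set 2 v) :=
  ⟨h.arr, h.reg0, h.reg1, rfl, h.reg4, h.reg5, h.reg8, h.swaps, h.lookups⟩

theorem MainState.set4 {A : List ℕ} {d cand p m : ℕ} {S : List (ℕ × ℕ)} {l : ℕ} {σ : MemState}
    (h : MainState A d cand p m S l σ) (v : ℕ) : MainState A d cand v m S l (σ.set 4 v) :=
  ⟨h.arr, h.reg0, h.reg1, h.reg2, rfl, h.reg5, h.reg8, h.swaps, h.lookups⟩

theorem MainState.set5 {A : List ℕ} {d cand p m : ℕ} {S : List (ℕ × ℕ)} {l : ℕ} {σ : MemState}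
    (h : MainState A d cand p m S l σ) (v : ℕ) : MainState A d cand p v S l (σ.set 5 v) :=
  ⟨h.arr, h.reg0, h.reg1, h.reg2, h.reg4, rfl, h.reg8, h.swaps, h.lookups⟩

theorem lfc_lt_lfc {A : List ℕ} {c i j : ℕ} (hi : i < A.length) (h : A.getD i 0 = c) (hij : i < j) :
    lfc A c i < lfc A c j := by
  have h1 : rank A c (i + 1) = rank A c i + 1 := rank_succ hi h
  have h2 : rank A c (i + 1) ≤ rank A c j := (List.take_sublist_take_left (by omega)).count_le c
  unfold lfc
  omega

theorem lfc_succ {A : List ℕ} {c i : ℕ} (hi : i < A.length) :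
    lfc A c (i + 1) = lfc A c i + if A.getD i 0 = c then 1 else 0 := by
  unfold lfc
  split_ifs with h
  · rw [rank_succ hi h]; rfl
  · unfold rank
    rw [List.take_succ_eq_append_getElem hi, List.count_append, List.getD_eq_getElem _ _ hi] at *
    simp [h]

/-- The forward step from register `4`. -/
def flStep : Com :=
  -- After the lookup of `c`, scanning with position `0` yields the start of the block of `c` in the
  -- first column. The second scan counts occurrences of `c` from there until the counter meets the
  -- given position.
  (.op (.first 11 4) ;; .op (.const 12 0)) ;; callScan 11 0 12 12 ;; (.op (.const 26 0) ;; .op (.const 28 1)) ;;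
  .whileLt 26 0 (.op (.load 27 26) ;;
    .ifEq 27 11 (.ifEq 24 4 (.op (.move 25 26)) .skip ;; .op (.add 24 24 28)) .skip ;;
    .op (.add 26 26 28)) ;; .op (.move 4 25)

theorem flStep_spec {W : ℕ} {σ : MemState} {A : List ℕ} {d cand p m c j l : ℕ} {S : List (ℕ × ℕ)}
    (h : MainState A d cand p m S l σ) (hW : A.length < W) (hj : j < A.length) (hc : A.getD j 0 = c)
    (hp : lfc A c j = p) : Spec W flStep σ (30 * A.length + 17) fun σ' =>
      MainState A d cand j m S (l + 1) σ' := by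
  have hfc : (firstColumn A).getD p 0 = c := by rw [← hp]; exact firstColumn_lfc hj hc
  refine (Spec.seq (T := 2) (T' := (20 * A.length + 10) + (2 + ((A.length * (8 + 2) + 2) + 1)))
    ((Spec.block ?_).mono (by simp [Com.size]) fun _ _ h => h)).mono (by omega) fun _ _ h => h
  simp only [Com.Pre, Instr.apply, Instr.Fits, Instr.IsOp, true_and]
  refine ⟨by omega, ?_⟩
  have h0 : MainState A d cand p m S (l + 1)
      { σ.set 11 ((firstColumn σ.arr).getD (σ.reg 4) 0) with lookups := σ.lookups + 1 } :=
    ⟨h.arr, h.reg0, h.reg1, h.reg2, h.reg4, h.reg5, h.reg8, h.swaps, congrArg (· + 1) h.lookups⟩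
  have h1 := h0.set (r := 12) (by omega) 0
  have h11 : (MemState.set { σ.set 11 ((firstColumn σ.arr).getD (σ.reg 4) 0) with lookups := σ.lookups + 1 }
      12 0).reg 11 = c := by
    rw [MemState.set_reg, if_neg (by omega)]
    change (σ.set 11 ((firstColumn σ.arr).getD (σ.reg 4) 0)).reg 11 = c
    rw [h.arr, h.reg4, hfc, MemState.set_reg, if_pos rfl]
  have h12 : (MemState.set { σ.set 11 ((firstColumn σ.arr).getD (σ.reg 4) 0) with lookups := σ.lookups + 1 }
      12 0).reg 12 = 0 := by rw [MemState.set_reg, if_pos rfl]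
  generalize MemState.set { σ.set 11 ((firstColumn σ.arr).getD (σ.reg 4) 0) with lookups := σ.lookups + 1 }
    12 0 = σ1 at h1 h11 h12 ⊢
  refine Spec.seq ((callScan_spec h1.arr h1.reg0.le hW (by omega) (by omega) (by omega)).mono
    le_rfl ?_)
  rintro σ2 - ⟨hf, h24, -⟩
  rw [h1.reg0, h11, h12, List.take_length] at h24
  have h2 := h1.of_frame hf
  rw [← hf.reg 11 (by omega)] at h11
  clear hf h1 h12
  refine Spec.seq ((Spec.block ?_).mono (by simp [Com.size]) fun _ _ h => h)
  simp only [Com.Pre, Instr.apply, Instr.Fits, Instr.IsOp, true_and]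
  refine ⟨by omega, by omega, Spec.seq (Spec.loop (fun i τ => MainState A d cand p m S (l + 1) τ ∧
    τ.reg 11 = c ∧ τ.reg 28 = 1 ∧ τ.reg 26 = i ∧ τ.reg 24 = lfc A c i ∧ (j < i → τ.reg 25 = j)) A.length
    ?_ ?_ ?_)⟩
  · rintro i hi τ - ⟨hm, t11, t28, t26, t24, t25⟩
    refine ⟨by rw [t26, hm.reg0]; exact hi, ?_⟩
    have t4 := hm.reg4
    have hs1 : A.getD i 0 = c → lfc A c (i + 1) = lfc A c i + 1 := fun h => by rw [lfc_succ hi, if_pos h]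
    have hs2 : ¬ A.getD i 0 = c → lfc A c (i + 1) = lfc A c i ∧ i ≠ j := fun h =>
      ⟨by rw [lfc_succ hi, if_neg h]; rfl, fun e => h (e ▸ hc)⟩
    have hle := lfc_le A c (i + 1)
    -- Among occurrences of `c` the counter is strictly increasing, so it equals `p` at `j` only.
    have hij : A.getD i 0 = c → (lfc A c i = p ↔ i = j) := fun hi' => by
      rw [← hp]
      constructor
      · intro e
        rcases lt_trichotomy i j with h | h | h
        · have := lfc_lt_lfc hi hi' h; omega
        · exact h
        · have := lfc_lt_lfc hj hc h; omega
      · rintro rfl; rfl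
    simp only [Com.Pre, Instr.apply, Instr.Fits, Instr.IsOp, true_and, MemState.set_reg,
      t26, t28, hm.arr, t24, t11, t4, Nat.reduceEqDiff, Nat.reduceLeDiff, if_true, if_false]
    repeat' first | apply And.intro | intro
    all_goals first | omega | (apply_rules [MainState.set, hm] <;> omega)
  · rintro τ - ⟨hm, t11, t28, t26, t24, t25⟩
    refine ⟨by rw [t26, hm.reg0]; omega, (Spec.block ?_).mono (by simp [Com.size]) fun _ _ h => h⟩
    refine ⟨trivial, trivial, ?_⟩
    simp only [Instr.apply, t25 hj]
    exact hm.set4 j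
  · simp [MainState.set, h2, h11, h24, lfc, rank]

/-! ### Backward steps in the partially converted array -/

namespace CutContext

variable {ws : List (List ℕ)} {w V : List ℕ} (h : CutContext ws w V)
include h

omit h in
theorem mem_cutRows {k : ℕ} (hk : k < w.length) : (oldKey w V k, rowLabel w k) ∈ cutRows ws w V (k + 1) := by
  refine Multiset.mem_cons_of_mem (Multiset.mem_add.2 (Or.inr (Multiset.mem_map.2 ⟨k, Multiset.mem_range.2 hk, ?_⟩)))
  rw [mixedKey, if_pos (by omega)]

theorem cutRows_label {k : ℕ} (hk : k < w.length) :
    ∀ b ∈ cutRows ws w V (k + 1), b.1 = oldKey w V k → b.2 = rowLabel w k := by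
  intro b hb e
  rw [cutRows, ← Multiset.cons_add] at hb
  rcases Multiset.mem_add.1 hb with hb | hb
  · exact absurd e (h.restRows_ne hk hb)
  · obtain ⟨j, hj, rfl⟩ := Multiset.mem_map.1 hb
    rw [Multiset.mem_range] at hj
    simp only [mixedKey] at e
    split_ifs at e with hjk
    · rcases eq_or_ne k j with rfl | hne
      · rfl
      · exact absurd e (h.oldKey_ne hj.le hk.le hne)
    · exact absurd e (h.newKey_ne_dollarKey hj _)

variable {B : List ℕ} {k : ℕ} (h1 : 1 ≤ k) (hk : k < w.length) (hB : SortedArr (cutRows ws w V (k + 1)) B)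
include h1 hk hB

theorem getD_rowPos_of_cutRows : B.getD (rowPos ws w V k) 0 = w.getD (k - 1) 0 := by
  have e : rowLabel w k = w.getD (k - 1) 0 := if_neg (by omega)
  rw [← e]
  apply hB.getD_eq (h.cutRows_label hk)
  · rw [h.keyCount_cutRows_lt hk]
  · rw [← h.keyCount_cutRows_lt hk]
    exact pcount_lt (fun _ _ hb => le_of_lt hb) (mem_cutRows hk) (lt_irrefl _) le_rfl

/-- The program computes the next positions in the current array, where the exchange and some moves
have been done; the counts still agree with those in the original array. -/
theorem lfc_rowPos_of_cutRows : lfc B (w.getD (k - 1) 0) (rowPos ws w V k) = rowPos ws w V (k - 1) := by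
  rw [← h.keyCount_cutRows_lt hk, hB.lfc_keyCount _ (isLowerKey_lt _), h.labelCount_cutRows_lt _ h1 hk,
    ← keyCount_stageRows_lt _ _ (h.getD_mem_pos (by omega)), rowPos]
  congr 1
  rw [h.oldKey_eq_scons (k := k - 1) (by omega), Nat.sub_add_cancel h1]

theorem lfc_rowEnd_of_cutRows : lfc B (w.getD (k - 1) 0) (rowEnd ws w V k) = rowEnd ws w V (k - 1) := by
  rw [← h.keyCount_cutRows_le (k + 1) hk, hB.lfc_keyCount _ (isLowerKey_le _), h.labelCount_cutRows_le _ h1 hk,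
    ← keyCount_stageRows_le _ _ (h.getD_mem_pos (by omega)), rowEnd]
  congr 1
  rw [newKey_eq_scons (k := k - 1) (by omega), Nat.sub_add_cancel h1]

end CutContext

theorem exchange_length (A : List ℕ) (i j : ℕ) : (exchange A i j).length = A.length := by
  unfold exchange; split_ifs <;> simp

theorem exchanges_length (A : List ℕ) (S : List (ℕ × ℕ)) : (exchanges A S).length = A.length := by
  unfold exchanges
  induction S generalizing A with
  | nil => rfl
  | cons s S ih => rw [List.foldl_cons, ih, exchange_length]

theorem keyCount_stageRows_le_card (ws : List (List ℕ)) (w V : List ℕ) :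
    w.length < (stageRows ws (w ++ V)).card := by
  simp [stageRows, restRows, textRest]
  omega

/-- Follow the forward steps until the position is smaller than that of the delimiter. -/
def forward : Com :=
  (.op (.move 4 1) ;; .op (.const 5 0) ;; .op (.const 7 0)) ;;
  .whileLt 7 8 (flStep ;; .op (.add 5 5 8) ;; .ifLt 4 1 (.op (.const 7 1)) (.op (.const 7 0)))

/-- One round of backward steps with the characters of the factor, from register `6` to `10`. -/
def pass : Com :=
  -- The factor is not stored. Register `9` walks backward through its rows and supplies the
  -- characters as entries of the array, so a pass needs no lookup in the first column.
  (.op (.move 9 4) ;; .op (.move 10 6) ;; .op (.const 7 0)) ;;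
  .whileLt 7 5 (.op (.load 11 9) ;; callScan 11 0 9 10 ;;
    .op (.move 9 24) ;; .op (.move 10 25) ;; .op (.add 7 7 8))

/-- Compute the number of rows up to the infinite power of the factor in register `2`. -/
def findEnd : Com :=
  .op (.move 6 2) ;; pass ;;
  -- If the candidate from the preceding factor is a fixed point, the factor is repeated and the
  -- candidate is the answer; otherwise the iteration starts with the number of rows below `wV$`,
  -- the position of the delimiter.
  .ifEq 6 10 .skip (.op (.move 6 1) ;; pass ;; .whileLt 6 10 (.op (.move 6 10) ;; pass)) ;;
  .op (.move 2 10)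

/-- The exchanges cutting out the factor. -/
def cut : Com :=
  -- The first backward step precedes the exchange: afterwards the delimiter would stand where the
  -- last character of the factor is read.
  (.op (.move 9 4) ;; .op (.move 10 2) ;; .op (.load 11 9) ;; .op (.const 7 0)) ;; callScan 11 0 9 10 ;;
  (.op (.move 9 24) ;; .op (.move 10 25) ;; .op (.swap 4 1)) ;;
  .whileLt 7 5 (.op (.load 11 9) ;; callScan 11 0 9 10 ;;
    (.op (.move 20 9) ;; .op (.sub 21 10 8) ;; .op (.move 9 24) ;; .op (.move 10 25)) ;; rotate ;;
    .op (.add 7 7 8)) ;;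
  .op (.move 1 4)

/-! ### Correctness of the steps for one factor -/

namespace CutContext

variable {ws : List (List ℕ)} {w V : List ℕ} (h : CutContext ws w V) {A : List ℕ}
  (hA : SortedArr (stageRows ws (w ++ V)) A) {W : ℕ} (hW : A.length < W) {σ : MemState} {cand l : ℕ}
  {S : List (ℕ × ℕ)}
include h hA hW

omit h hW in
theorem _root_.SortedArr.length_lt : w.length < A.length := by
  rw [hA.length]; exact keyCount_stageRows_le_card ws w V

theorem forward_spec {p m : ℕ} (hσ : MainState A (rowPos ws w V 0) cand p m S l σ) :
    Spec W forward σ (w.length * ((30 * A.length + 22) + 2) + 5) fun σ' =>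
      MainState A (rowPos ws w V 0) cand (rowPos ws w V w.length) w.length S (l + w.length) σ' := by
  have hl := hA.length_lt
  have hw := h.length_pos
  refine (Spec.seq (T := 3) (T' := w.length * ((30 * A.length + 22) + 2) + 2)
    ((Spec.block ?_).mono (by decide) fun _ _ h => h)).mono (by omega) fun _ _ h => h
  simp only [Com.Pre, Instr.apply, Instr.Fits, Instr.IsOp, true_and]
  refine ⟨by omega, by omega, Spec.whileLt (fun i τ => MainState A (rowPos ws w V 0) cand (rowPos ws w V i) i S
    (l + i) τ ∧ τ.reg 7 = if i = w.length then 1 else 0) w.length _ ?_ ?_ ?_⟩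
  · rintro i hi τ - ⟨hm, t7⟩
    rw [if_neg (by omega)] at t7
    refine ⟨by rw [t7, hm.reg8]; omega, ?_⟩
    refine (Spec.seq (T := 30 * A.length + 17) (T' := 5) ((flStep_spec hm hW
      (h.rowPos_lt_length hA (k := i + 1) hi) ?_ (h.lfc_rowPos hA hi)).mono le_rfl ?_)).mono le_rfl
      fun _ _ h => h
    · rw [h.getD_rowPos hA hi, if_neg (by omega)]; rfl
    rintro τ' - hm'
    refine (Spec.block ?_).mono (by simp [Com.size]) fun _ _ h => h
    have e4 : rowPos ws w V (i + 1) < rowPos ws w V 0 ↔ i + 1 = w.length := by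
      constructor
      · intro hlt
        by_contra hc
        exact lt_asymm hlt (h.rowPos_zero_lt (by omega) (by omega))
      · intro e; rw [e]; exact h.rowPos_length_lt
    have hm2 := hm'.set5 (i + 1)
    simp only [Com.Pre, Instr.apply, Instr.Fits, Instr.IsOp, true_and, MemState.set_reg, hm'.reg5, hm'.reg8,
      hm'.reg4, hm'.reg1, Nat.reduceEqDiff, if_true, if_false, e4]
    refine ⟨by omega, fun e => ⟨by omega, hm2.set (by omega) _, by simp [e]⟩,
      fun e => ⟨by omega, hm2.set (by omega) _, by simp [e]⟩⟩
  · rintro τ - ⟨hm, t7⟩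
    rw [if_pos rfl] at t7
    exact ⟨by rw [t7, hm.reg8]; omega, hm⟩
  · refine ⟨?_, by simp; omega⟩
    rw [hσ.reg1]
    exact ((hσ.set4 _).set5 _).set (by omega) _

theorem pass_spec {d e : ℕ} (hσ : MainState A d cand (rowPos ws w V w.length) w.length S l σ)
    (h6 : σ.reg 6 = e) :
    Spec W pass σ (w.length * ((20 * A.length + 14) + 2) + 5) fun σ' =>
      MainState A d cand (rowPos ws w V w.length) w.length S l σ' ∧ σ'.reg 6 = e ∧
        σ'.reg 10 = backward A w e := by
  have hl := hA.length_lt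
  refine (Spec.seq (T := 3) (T' := w.length * ((20 * A.length + 14) + 2) + 2)
    ((Spec.block ?_).mono (by decide) fun _ _ h => h)).mono (by omega) fun _ _ h => h
  simp only [Com.Pre, Instr.apply, Instr.Fits, Instr.IsOp, true_and]
  refine ⟨by omega, Spec.whileLt (fun i τ => MainState A d cand (rowPos ws w V w.length) w.length S
    l τ ∧ τ.reg 6 = e ∧ τ.reg 7 = i ∧ τ.reg 9 = rowPos ws w V (w.length - i) ∧
    τ.reg 10 = backward A (w.drop (w.length - i)) e) w.length _ ?_ ?_ ?_⟩
  · rintro i hi τ - ⟨hm, t6, t7, t9, t10⟩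
    refine ⟨by rw [t7, hm.reg5]; omega, ?_⟩
    refine (Spec.seq (T := 1) (T' := (20 * A.length + 10) + 3) ((Spec.block ?_).mono (by decide)
      fun _ _ h => h)).mono (by omega) fun _ _ h => h
    obtain ⟨k, hk⟩ : ∃ k, w.length - i = k + 1 := ⟨w.length - i - 1, by omega⟩
    rw [hk] at t9 t10
    have hc : A.getD (rowPos ws w V (k + 1)) 0 = w.getD k 0 := by
      rw [h.getD_rowPos hA (by omega), if_neg (by omega), Nat.add_sub_cancel]
    simp only [Com.Pre, Instr.apply, Instr.Fits, Instr.IsOp, true_and, hm.arr, t9, hc]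
    have hm1 := hm.set (r := 11) (by omega) (w.getD k 0)
    refine Spec.seq ((callScan_spec hm1.arr hm1.reg0.le hW (by omega) (by omega) (by omega)).mono le_rfl ?_)
    rintro τ' - ⟨hf, h24, h25⟩
    have f6 := hf.reg 6 (by omega)
    have f7 := hf.reg 7 (by omega)
    rw [hm1.reg0, List.take_length] at h24 h25
    simp only [MemState.set_reg, Nat.reduceEqDiff, if_true, if_false, t6, t7, t9, t10] at h24 h25 f6 f7
    rw [h.lfc_rowPos hA (by omega)] at h24
    have hm2 := hm1.of_frame hf
    refine (Spec.block ?_).mono (by decide) fun _ _ h => h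
    simp only [Com.Pre, Instr.apply, Instr.Fits, Instr.IsOp, true_and, MemState.set_reg, hm2.reg8,
      Nat.reduceEqDiff, if_true, if_false, f6, f7, h24, h25]
    refine ⟨by omega, ((hm2.set (by omega) _).set (by omega) _).set (by omega) _, ?_, ?_⟩
    · rw [show w.length - (i + 1) = k by omega]
    · rw [show w.length - (i + 1) = k by omega, List.drop_eq_getElem_cons (show k < w.length by omega),
        List.getD_eq_getElem _ _ (show k < w.length by omega)]
      rfl
  · rintro τ - ⟨hm, t6, t7, t9, t10⟩
    rw [Nat.sub_self, List.drop_zero] at t10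
    exact ⟨by rw [t7, hm.reg5]; omega, hm, t6, t10⟩
  · refine ⟨((hσ.set (by omega) _).set (by omega) _).set (by omega) _, ?_⟩
    simp [h6, hσ.reg4, backward]

end CutContext

namespace CutContext

variable {ws : List (List ℕ)} {w V : List ℕ} (h : CutContext ws w V) {A : List ℕ}
  (hA : SortedArr (stageRows ws (w ++ V)) A) {W : ℕ} (hW : A.length < W) {σ : MemState} {cand l : ℕ}
  {S : List (ℕ × ℕ)}
include h hA hW

/-- Either the candidate is confirmed by one pass, or the iteration takes `passCount` rounds; the
factor `K + 2` covers the test and the initial pass. -/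
theorem findEnd_spec (K : ℕ)
    (hcand : backward A w cand = cand ∧ cand = rowEnd ws w V 0 ∨ backward A w cand ≠ cand ∧
      (∀ b ∈ stageRows ws (w ++ V), b.1 ≠ omegaKey w) ∧ passCount ws w V ≤ K)
    (hσ : MainState A (rowPos ws w V 0) cand (rowPos ws w V w.length) w.length S l σ) :
    Spec W findEnd σ ((K + 2) * (w.length * (20 * A.length + 16) + 9)) fun σ' =>
      MainState A (rowPos ws w V 0) (rowEnd ws w V 0) (rowPos ws w V w.length) w.length S l σ' := by
  set P := w.length * (20 * A.length + 16) + 5 with hP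
  have hpass : ∀ {σ : MemState} {e : ℕ},
      MainState A (rowPos ws w V 0) cand (rowPos ws w V w.length) w.length S l σ → σ.reg 6 = e →
      Spec W pass σ P _ := fun hσ h6 => (h.pass_spec hA hW hσ h6).mono (le_of_eq (by rw [hP])) fun _ _ h => h
  refine (Spec.seq (T := 1) (T' := P + ((1 + (P + (K * ((1 + P) + 2) + 2)) + 2) + 1)) ((Spec.block ?_).mono (by decide) fun _ _ h => h)).mono
    ?_ fun _ _ h => h
  swap
  · rw [show w.length * (20 * A.length + 16) + 9 = P + 4 by omega]
    ring_nf; omega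
  simp only [Com.Pre, Instr.apply, Instr.Fits, Instr.IsOp, true_and]
  refine Spec.seq ((hpass (e := cand) (hσ.set (by omega) _) (by simp [hσ.reg2])).mono le_rfl ?_)
  rintro τ - ⟨hm, t6, t10⟩
  refine Spec.seq (Spec.mono (T := (1 + (P + (K * ((1 + P) + 2) + 2)) + 2)) (Q := fun τ => τ.reg 10 = rowEnd ws w V 0 ∧
    MainState A (rowPos ws w V 0) cand (rowPos ws w V w.length) w.length S l τ) ?_ le_rfl ?_)
  · rcases hcand with ⟨e1, e2⟩ | ⟨e1, e2, e3⟩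
    · refine Spec.ifEq (fun _ => (Spec.block ?_).mono (Nat.zero_le _) fun _ _ h => h) fun hc => ?_
      · exact ⟨by rw [t10, e1, e2], hm⟩
      · exact absurd (by rw [t6, t10, e1]) hc
    · refine Spec.ifEq (fun hc => ?_) fun _ => ?_
      · rw [t6, t10] at hc
        exact absurd hc.symm e1
      · refine Spec.seq ((Spec.block ?_).mono (by decide) fun _ _ h => h)
        simp only [Com.Pre, Instr.apply, Instr.Fits, Instr.IsOp, true_and, hm.reg1]
        refine Spec.seq ((hpass (e := rowPos ws w V 0) (hm.set (by omega) _) (by simp)).mono le_rfl ?_)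
        rintro τ - ⟨hm, t6, t10⟩
        rw [← powPos_one] at t6 t10
        rw [h.backward_powPos hA] at t10
        refine (Spec.whileLt (fun j τ => MainState A (rowPos ws w V 0) cand (rowPos ws w V w.length) w.length S l τ ∧
          τ.reg 6 = powPos ws w V (j + 1) ∧ τ.reg 10 = powPos ws w V (j + 2)) (passCount ws w V) (1 + P)
          ?_ ?_ ⟨hm, t6, t10⟩).mono ?_ fun _ _ h => h
        · rintro j hj τ - ⟨hm, t6, t10⟩
          refine ⟨by rw [t6, t10]; exact h.powPos_lt hj, ?_⟩
          refine Spec.seq ((Spec.block ?_).mono (by decide) fun _ _ h => h)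
          simp only [Com.Pre, Instr.apply, Instr.Fits, Instr.IsOp, true_and, t10]
          refine (hpass (e := powPos ws w V (j + 2)) (hm.set (by omega) _) (by simp)).mono le_rfl ?_
          rintro τ - ⟨hm, t6, t10⟩
          rw [h.backward_powPos hA] at t10
          exact ⟨hm, t6, t10⟩
        · rintro τ - ⟨hm, t6, t10⟩
          rw [t6, t10, h.powPos_passCount_eq hA e2, ← h.powPos_passCount, h.powPos_passCount_eq hA e2]
          exact ⟨lt_irrefl _, rfl, hm⟩
        · gcongr
  · rintro τ - ⟨h10, hm⟩
    refine (Spec.block ?_).mono (by decide) fun _ _ h => h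
    simp only [Com.Pre, Instr.apply, Instr.Fits, Instr.IsOp, true_and, h10]
    exact hm.set2 _

omit h hA hW in
theorem _root_.MainState.of_arr {d p m : ℕ} (hσ : MainState A d cand p m S l σ) {A' : List ℕ}
    (hA' : A'.length = A.length) (S' : List (ℕ × ℕ)) :
    MainState A' d cand p m S' l { σ with arr := A', swaps := S' } :=
  ⟨rfl, hσ.reg0.trans hA'.symm, hσ.reg1, hσ.reg2, hσ.reg4, hσ.reg5, hσ.reg8, rfl, hσ.lookups⟩

theorem cut_spec
    (hσ : MainState A (rowPos ws w V 0) (rowEnd ws w V 0) (rowPos ws w V w.length) w.length S l σ) :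
    Spec W cut σ (20 * A.length + (w.length * (25 * A.length + 21) + 20)) fun σ' =>
      MainState (exchanges A (cutSwaps ws w V w.length)) (rowPos ws w V w.length) (rowEnd ws w V 0)
        (rowPos ws w V w.length) w.length (S ++ cutSwaps ws w V w.length) l σ' := by
  have hl := hA.length_lt
  have hw := h.length_pos
  refine (Spec.seq (T := 4) (T' := (20 * A.length + 10) + (3 + ((w.length * ((25 * A.length + 19) + 2) + 2) + 1)))
    ((Spec.block ?_).mono (by decide) fun _ _ h => h)).mono (by rw [show 25 * A.length + 19 + 2 = 25 * A.length + 21 by omega]; omega) fun _ _ h => h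
  have hc : A.getD (rowPos ws w V w.length) 0 = w.getD (w.length - 1) 0 := by
    rw [h.getD_rowPos hA le_rfl, if_neg (by omega)]
  simp only [Com.Pre, Instr.apply, Instr.Fits, Instr.IsOp, true_and, MemState.set_reg, MemState.set_arr, hσ.arr,
    hσ.reg4, hσ.reg2, Nat.reduceEqDiff, if_true, if_false, hc]
  refine ⟨Nat.zero_le _, ?_⟩
  have hm1 := (((hσ.set (r := 9) (by omega) (rowPos ws w V w.length)).set (r := 10) (by omega)
    (rowEnd ws w V 0)).set (r := 11) (by omega) (w.getD (w.length - 1) 0)).set (r := 7) (by omega) 0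
  refine Spec.seq ((callScan_spec hm1.arr hm1.reg0.le hW (by omega) (by omega) (by omega)).mono le_rfl ?_)
  rintro τ - ⟨hf, h24, h25⟩
  have t7 := hf.reg 7 (by omega)
  rw [hm1.reg0, List.take_length] at h24 h25
  simp only [MemState.set_reg, Nat.reduceEqDiff, if_true, if_false] at h24 h25 t7
  have e1 := h.lfc_rowPos hA (k := w.length - 1) (by omega)
  have e2 := h.lfc_rowEnd hA (k := w.length - 1) (by omega)
  rw [Nat.sub_add_cancel hw] at e1 e2
  rw [h.rowEnd_length] at e2
  rw [e1] at h24
  rw [e2] at h25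
  have hm2 := hm1.of_frame hf
  clear hm1 hf
  refine Spec.seq ((Spec.block ?_).mono (by decide) fun _ _ h => h)
  simp only [Com.Pre, Instr.apply, Instr.Fits, Instr.IsOp, true_and, MemState.set_reg, MemState.set_arr, hm2.arr,
    hm2.reg4, hm2.reg1, h24, h25, Nat.reduceEqDiff, if_false, MemState.set_swaps, hm2.swaps]
  have hm3 := ((hm2.set (r := 9) (by omega) (rowPos ws w V (w.length - 1))).set (r := 10) (by omega)
    (rowEnd ws w V (w.length - 1))).of_arr (exchange_length A (rowPos ws w V w.length) (rowPos ws w V 0))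
    (S ++ [(rowPos ws w V w.length, rowPos ws w V 0)])
  -- After `i` rounds the rows from `|w| - i` on have been moved. Nothing is claimed about the two
  -- positions after the last round, where there is no further row.
  refine Spec.seq (Spec.whileLt (fun i τ => MainState (exchanges A (cutSwaps ws w V i)) (rowPos ws w V 0)
    (rowEnd ws w V 0) (rowPos ws w V w.length) w.length (S ++ cutSwaps ws w V i) l τ ∧ τ.reg 7 = i ∧
    (i < w.length → τ.reg 9 = rowPos ws w V (w.length - 1 - i) ∧
      τ.reg 10 = rowEnd ws w V (w.length - 1 - i))) w.length _ ?_ ?_ ⟨hm3, t7, fun _ => ⟨rfl, rfl⟩⟩)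
  · rintro i hi τ - ⟨hm, t7, t9⟩
    obtain ⟨t9, t10⟩ := t9 hi
    have hlen := exchanges_length A (cutSwaps ws w V i)
    have hB := h.sortedArr_cutSwaps hA hi.le
    obtain ⟨k, hk⟩ : ∃ k, w.length = i + (k + 1) := ⟨w.length - i - 1, by omega⟩
    have hS := cutSwaps_succ ws w V i
    rw [show w.length - 1 - i = k by omega] at t9 t10 hS
    rw [show w.length - i = k + 1 by omega] at hB
    rw [cutRun] at hS
    have hle := h.rowEnd_le_length hA k
    refine ⟨by rw [t7, hm.reg5]; omega, ?_⟩
    refine (Spec.seq (T := 1) (T' := (20 * A.length + 10) + (4 + ((5 * A.length + 3) + 1)))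
      ((Spec.block ?_).mono (by decide) fun _ _ h => h)).mono (by omega) fun _ _ h => h
    simp only [Com.Pre, Instr.apply, Instr.Fits, Instr.IsOp, true_and, hm.arr, t9]
    have hm1 := hm.set (r := 11) (by omega) ((exchanges A (cutSwaps ws w V i)).getD (rowPos ws w V k) 0)
    refine Spec.seq ((callScan_spec hm1.arr hm1.reg0.le (by omega) (by omega) (by omega) (by omega)).mono
      (by omega) ?_)
    rintro τ' - ⟨hf, h24, h25⟩
    rw [hm1.reg0, List.take_length] at h24 h25
    have f7 := hf.reg 7 (by omega)
    have f9 := hf.reg 9 (by omega)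
    have f10 := hf.reg 10 (by omega)
    simp only [MemState.set_reg, Nat.reduceEqDiff, if_true, if_false, t7, t9, t10] at h24 h25 f7 f9 f10
    have hm2 := hm1.of_frame hf
    clear hm1 hf
    refine Spec.seq ((Spec.block ?_).mono (by decide) fun _ _ h => h)
    simp only [Com.Pre, Instr.apply, Instr.Fits, Instr.IsOp, true_and, MemState.set_reg, hm2.reg8,
      f9, f10, h24, h25, Nat.reduceEqDiff, if_false]
    have hm3 := (((hm2.set (r := 20) (by omega) (rowPos ws w V k)).set (r := 21) (by omega)
      (rowEnd ws w V k - 1)).set (r := 9) (by omega)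
      (lfc (exchanges A (cutSwaps ws w V i)) ((exchanges A (cutSwaps ws w V i)).getD (rowPos ws w V k) 0)
        (rowPos ws w V k))).set (r := 10) (by omega)
      (lfc (exchanges A (cutSwaps ws w V i)) ((exchanges A (cutSwaps ws w V i)).getD (rowPos ws w V k) 0)
        (rowEnd ws w V k))
    refine Spec.seq ((rotate_spec (p := rowPos ws w V k) (q := rowEnd ws w V k - 1) ?_ ?_
      (by omega) (by omega)).mono (by omega) ?_)
    · simp
    · simp
    rintro τ'' - hf
    rw [hm3.arr, hm3.swaps] at hf
    have hm4 := (hm3.of_arr (exchanges_length _ (swapRun (rowPos ws w V k) (rowEnd ws w V k - 1 - rowPos ws w V k)))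
      (S ++ cutSwaps ws w V i ++ swapRun (rowPos ws w V k) (rowEnd ws w V k - 1 - rowPos ws w V k))).of_frame hf
    rw [List.append_assoc, ← exchanges_append, ← hS] at hm4
    have g7 := hf.reg 7 (by omega)
    have g9 := hf.reg 9 (by omega)
    have g10 := hf.reg 10 (by omega)
    simp only [MemState.set_reg, Nat.reduceEqDiff, if_true, if_false, f7] at g7 g9 g10
    refine (Spec.block ?_).mono (by decide) fun _ _ h => h
    simp only [Com.Pre, Instr.apply, Instr.Fits, Instr.IsOp, true_and, MemState.set_reg, hm4.reg8, g7, g9, g10,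
      Nat.reduceEqDiff, if_true, if_false]
    refine ⟨by omega, hm4.set (by omega) _, fun hi' => ?_⟩
    rw [h.getD_rowPos_of_cutRows (by omega) (by omega) hB, h.lfc_rowPos_of_cutRows (by omega) (by omega) hB,
      h.lfc_rowEnd_of_cutRows (by omega) (by omega) hB, show w.length - 1 - (i + 1) = k - 1 by omega]
    exact ⟨rfl, rfl⟩
  · rintro τ - ⟨hm, t7, -⟩
    refine ⟨by rw [t7, hm.reg5]; exact lt_irrefl _, (Spec.block ?_).mono (by decide) fun _ _ h => h⟩
    simp only [Com.Pre, Instr.apply, Instr.Fits, Instr.IsOp, true_and, hm.reg4]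
    exact hm.set1 _

end CutContext

/-! ### The stages as states of the conversion -/

namespace TextFactors

variable {fs : List (List ℕ)} (h : TextFactors fs)

/-- The rows of a stage. -/
noncomputable def _root_.rowsAt (fs : List (List ℕ)) (x : ℕ) : Multiset (InfWord × ℕ) :=
  stageRows (fs.take x) (fs.drop x).flatten

/-- The position of the delimiter in a stage. -/
noncomputable def _root_.dollarPos (fs : List (List ℕ)) (x : ℕ) : ℕ :=
  keyCount (· < dollarKey (fs.drop x).flatten) (rowsAt fs x)

/-- The number of rows up to the infinite power of the last factor that has been cut out. -/
noncomputable def _root_.prevEnd (fs : List (List ℕ)) (x : ℕ) : ℕ :=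
  if x = 0 then 0 else keyCount (· ≤ omegaKey (fs.getD (x - 1) [])) (rowsAt fs x)

/-- The exchanges cutting out the `x`-th factor. -/
noncomputable def _root_.swapsAt (fs : List (List ℕ)) (x : ℕ) : List (ℕ × ℕ) :=
  cutSwaps (fs.take x) (fs.getD x []) (laterText fs x) (fs.getD x []).length

include h

theorem sortedArr_stage (x : ℕ) : SortedArr (rowsAt fs x) (stage fs x) :=
  ebwt_dollar_sortedArr h.pos_take h.pos_flatten

theorem stage_length (x : ℕ) : (stage fs x).length = fs.flatten.length + 1 := by
  rw [(h.sortedArr_stage x).length, rowsAt, stageRows, restRows, Multiset.card_cons, Multiset.card_add]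
  congr 1
  have e1 : (textRest (fs.drop x).flatten).card = (fs.drop x).flatten.length := by simp [textRest]
  have e2 : ∀ ws : List (List ℕ), (wordsRows ws).card = ws.flatten.length := by
    intro ws
    unfold wordsRows
    induction ws with
    | nil => rfl
    | cons w ws ih =>
      rw [List.map_cons, List.sum_cons, Multiset.card_add, ih, List.flatten_cons, List.length_append]
      simp [wordRows]
  rw [e1, e2, ← List.length_append, ← List.flatten_append, List.take_append_drop]

variable {x : ℕ} (hx : x < fs.length)
include hx

omit h in
theorem rowsAt_eq : rowsAt fs x = stageRows (fs.take x) (fs.getD x [] ++ laterText fs x) := by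
  rw [rowsAt, flatten_drop_eq hx]

theorem sortedArr : SortedArr (stageRows (fs.take x) (fs.getD x [] ++ laterText fs x)) (stage fs x) := by
  rw [← rowsAt_eq hx]; exact h.sortedArr_stage x

omit h in
theorem dollarPos_eq : dollarPos fs x = rowPos (fs.take x) (fs.getD x []) (laterText fs x) 0 := by
  rw [dollarPos, rowsAt_eq hx, flatten_drop_eq hx]; rfl

omit h in
theorem rowsAt_succ : rowsAt fs (x + 1) = stageRows (fs.take x ++ [fs.getD x []]) (laterText fs x) := by
  rw [rowsAt, take_succ_getD hx]; rfl

/-- Neither old nor new keys of `w` lie below `V$`, so the delimiter stays where the exchange has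
put it. -/
theorem dollarPos_succ : dollarPos fs (x + 1) =
    rowPos (fs.take x) (fs.getD x []) (laterText fs x) (fs.getD x []).length := by
  have hc := h.cutContext hx
  rw [dollarPos, rowsAt_succ hx, ← cutRows_zero, rowPos, ← hc.keyCount_cutRows_length, oldKey_length]
  refine pcount_cutRows (fun _ => Iff.rfl) fun j hj => ?_
  have h1 : dollarKey (laterText fs x) ≤ oldKey (fs.getD x []) (laterText fs x) j := by
    have h0 := hc.oldKey_length_lt_zero
    rw [oldKey_length] at h0
    rcases Nat.eq_zero_or_pos j with rfl | hj0
    · exact h0.le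
    · exact (h0.trans (hc.oldKey_zero_lt hj0 hj)).le
  have h2 : dollarKey (laterText fs x) ≤ mixedKey (fs.getD x []) (laterText fs x) 0 j := by
    rw [mixedKey, if_neg (by omega)]
    exact h1.trans (hc.oldKey_lt_newKey j).le
  exact iff_of_false (not_lt.2 h2) (not_lt.2 h1)

theorem prevEnd_succ : prevEnd fs (x + 1) = rowEnd (fs.take x) (fs.getD x []) (laterText fs x) 0 := by
  have hc := h.cutContext hx
  rw [← hc.finalEnd_eq_rowEnd hc.length_pos, prevEnd, if_neg (by omega), rowsAt_succ hx, finalEnd,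
    newKey_zero hc.lyndon.1]
  rfl

theorem stage_succ : stage fs (x + 1) = exchanges (stage fs x) (swapsAt fs x) := by
  have h1 := h.sortedArr_stage (x + 1)
  rw [rowsAt_succ hx] at h1
  exact (h.cutContext hx).eq_exchanges (h.sortedArr hx) h1

theorem isCut : IsCut (stage fs x) (fs.getD x []) (swapsAt fs x) (stage fs (x + 1)) := by
  have h1 := h.sortedArr_stage (x + 1)
  rw [rowsAt_succ hx] at h1
  exact (h.cutContext hx).isCut h1 (h.sortedArr hx)

/-- The dichotomy the program tests: a repeated factor, with the right candidate at hand, or a first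
occurrence, for which no row has the key `w^ω`. -/
theorem prevEnd_spec :
    backward (stage fs x) (fs.getD x []) (prevEnd fs x) = prevEnd fs x ∧
      prevEnd fs x = rowEnd (fs.take x) (fs.getD x []) (laterText fs x) 0 ∨
    backward (stage fs x) (fs.getD x []) (prevEnd fs x) ≠ prevEnd fs x ∧
      (∀ b ∈ stageRows (fs.take x) (fs.getD x [] ++ laterText fs x), b.1 ≠ omegaKey (fs.getD x [])) ∧
      passCount (fs.take x) (fs.getD x []) (laterText fs x) ≤ passes fs x := by
  have hc := h.cutContext hx
  have hA := h.sortedArr hx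
  have hl := h.le_take hx
  have hiff := h.mem_take_iff hx
  have hprev : ∀ (_ : 0 < x), (backward (stage fs x) (fs.getD x []) (prevEnd fs x) = prevEnd fs x ↔
      fs.getD (x - 1) [] = fs.getD x []) := by
    intro h0
    have hmem : fs.getD (x - 1) [] ∈ fs.take x := by
      rw [List.getD_eq_getElem _ _ (by omega), List.mem_take_iff_getElem]
      exact ⟨x - 1, by omega, rfl⟩
    rw [prevEnd, if_neg (by omega), rowsAt_eq hx]
    exact hc.backward_prev_eq_iff hA hmem (hl _ hmem).1 (hl _ hmem).2
  by_cases hw : fs.getD x [] ∈ fs.take x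
  · obtain ⟨h0, e⟩ := hiff.1 hw
    refine Or.inl ⟨(hprev h0).2 e, ?_⟩
    rw [prevEnd, if_neg (by omega), rowsAt_eq hx, e, hc.keyCount_omegaKey]
  · refine Or.inr ⟨?_, hc.ne_omegaKey hl hw, ?_⟩
    · rcases Nat.eq_zero_or_pos x with rfl | h0
      · rw [prevEnd, if_pos rfl]
        exact hc.backward_zero_ne hA
      · exact fun e => hw (hiff.2 ⟨h0, (hprev h0).1 e⟩)
    · rw [passes, if_neg hw]

theorem dollarPos_pos : 0 < dollarPos fs x := by
  rw [dollarPos_eq hx]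
  exact (Nat.zero_le _).trans_lt (h.cutContext hx).rowPos_length_lt

omit h hx in
-- The padded empty text is the least key. Position `0` of the delimiter thus signals that nothing
-- is left to cut.
theorem _root_.dollarPos_length (fs : List (List ℕ)) : dollarPos fs fs.length = 0 := by
  rw [dollarPos, List.drop_length]
  exact pcount_eq_zero fun a _ => not_lt.2 (zeroWord_le _)

end TextFactors

/-- Cut out the first factor. -/
def convertStep : Com := forward ;; findEnd ;; cut ;; .op (.const 3 0)

/-- The conversion on the fly. -/
def convert : Com := .op (.const 8 1) ;; findZero ;; .op (.move 1 24) ;; .whileLt 3 1 convertStep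

/-- One factor of length `m` with `P` passes costs a multiple of `N m` plus a multiple of `N P m`;
lower-order terms are absorbed using `m ≥ 1` and `N ≥ 2`. -/
theorem convert_time (m N P : ℕ) (hm : 1 ≤ m) (hN : 2 ≤ N) :
    (m * ((30 * N + 22) + 2) + 5) + ((P + 2) * (m * (20 * N + 16) + 9) +
      ((20 * N + (m * (25 * N + 21) + 20)) + 1)) + 2 ≤ N * (200 * m + 40 * (P * m)) := by
  have h1 : N ≤ m * N := Nat.le_mul_of_pos_left _ hm
  have h2 : 2 * m ≤ m * N := by rw [Nat.mul_comm]; exact Nat.mul_le_mul_left _ hN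
  have h3 : P * 2 ≤ P * (m * N) := Nat.mul_le_mul_left _ (by omega)
  have h4 : P * (2 * m) ≤ P * (m * N) := Nat.mul_le_mul_left _ h2
  have e1 : m * (30 * N + 22 + 2) = 30 * (m * N) + 12 * (2 * m) := by ring
  have e2 : (P + 2) * (m * (20 * N + 16) + 9) = 20 * (P * (m * N)) + 8 * (P * (2 * m)) + 9 * P +
      40 * (m * N) + 16 * (2 * m) + 18 := by ring
  have e3 : m * (25 * N + 21) = 25 * (m * N) + 21 * m := by ring
  have e4 : N * (200 * m + 40 * (P * m)) = 200 * (m * N) + 40 * (P * (m * N)) := by ring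
  rw [e1, e2, e3, e4]
  omega

theorem TextFactors.convertStep_spec {fs : List (List ℕ)} (h : TextFactors fs) {x : ℕ} (hx : x < fs.length)
    {W N : ℕ} (hN : (stage fs x).length = N) (hN2 : 2 ≤ N) (hW : N < W) {p m l : ℕ} {S : List (ℕ × ℕ)}
    {σ : MemState} (hσ : MainState (stage fs x) (dollarPos fs x) (prevEnd fs x) p m S l σ) :
    Spec W convertStep σ
      (N * (200 * (fs.getD x []).length + 40 * (passes fs x * (fs.getD x []).length)) - 2) fun σ' =>
        (∃ p m, MainState (stage fs (x + 1)) (dollarPos fs (x + 1)) (prevEnd fs (x + 1)) p m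
          (S ++ swapsAt fs x) (l + (fs.getD x []).length) σ') ∧ σ'.reg 3 = 0 := by
  have hc := h.cutContext hx
  have hA := h.sortedArr hx
  have hp := h.prevEnd_spec hx
  have htime := convert_time (fs.getD x []).length N (passes fs x) hc.length_pos hN2
  rw [h.stage_succ hx, h.dollarPos_succ hx, h.prevEnd_succ hx, swapsAt]
  rw [dollarPos_eq hx] at hσ
  subst hN
  refine Spec.mono (Spec.seq ((hc.forward_spec hA hW hσ).mono le_rfl ?_)) (Nat.le_sub_of_add_le htime)
    fun _ _ h => h
  rintro τ - hm
  refine Spec.seq ((hc.findEnd_spec hA hW _ hp hm).mono le_rfl ?_)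
  rintro τ - hm
  refine Spec.seq ((hc.cut_spec hA hW hm).mono le_rfl ?_)
  rintro τ - hm
  refine (Spec.block ?_).mono (by decide) fun _ _ h => h
  exact ⟨trivial, Nat.zero_le _, ⟨_, _, hm.set (by omega) _⟩, rfl⟩

theorem TextFactors.convert_spec {fs : List (List ℕ)} (h : TextFactors fs) (h0 : fs ≠ []) {W : ℕ}
    (hW : fs.flatten.length + 1 < W) :
    Spec W convert (startState (stage fs 0)) (300 * ((fs.flatten.length + 1) * (fs.flatten.length + 1))) fun σ =>
      σ.arr = stage fs fs.length ∧ σ.lookups = fs.flatten.length ∧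
        σ.swaps = ((List.range fs.length).map (swapsAt fs)).flatten := by
  have hlen := h.stage_length
  generalize hN : fs.flatten.length + 1 = N at *
  have ht : 0 < fs.length := List.length_pos_iff.2 h0
  have hn : 1 ≤ fs.flatten.length := by
    rw [← List.drop_zero (l := fs), flatten_drop_eq ht, List.length_append]
    have := (h.cutContext ht).length_pos
    omega
  -- The factor lengths sum to `n` and the weighted passes to at most `2n`, whence `280 = 200 + 2 ·
  -- 40`.
  have hsum : ∑ x ∈ Finset.range fs.length, (N * (200 * (fs.getD x []).length +
      40 * (passes fs x * (fs.getD x []).length))) ≤ N * (280 * fs.flatten.length) := by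
    rw [← Finset.mul_sum, Finset.sum_add_distrib, ← Finset.mul_sum, ← Finset.mul_sum, sum_length_getD]
    have := h.sum_passes_le
    exact Nat.mul_le_mul_left _ (by omega)
  refine (Spec.seq (T := 1) (T' := (7 * N + 5) + (1 + (N * (280 * fs.flatten.length) + 2)))
    ((Spec.block ?_).mono (by decide) fun _ _ h => h)).mono ?_ fun _ _ h => h
  swap
  · have : N * (280 * fs.flatten.length) + 280 * N = 280 * (N * N) := by rw [← hN]; ring
    have : 2 * N ≤ N * N := Nat.mul_le_mul_right _ (by omega)
    omega
  simp only [Com.Pre, Instr.apply, Instr.Fits, Instr.IsOp, true_and]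
  refine ⟨by omega, ?_⟩
  have hz := h.cutContext ht
  have hA := h.sortedArr ht
  refine Spec.seq (Spec.mono (findZero_spec (A := stage fs 0) (d := dollarPos fs 0) ?_ ?_ ?_ ?_ ?_)
    (by rw [hlen]) ?_)
  · rfl
  · rfl
  · rw [hlen]; exact hW
  · rw [dollarPos_eq ht]; exact hz.rowPos_lt_length hA (Nat.zero_le _)
  · intro i hi
    rw [dollarPos_eq ht]
    refine ⟨fun h0 => hz.eq_rowPos_zero hA hi h0, ?_⟩
    rintro rfl
    rw [hz.getD_rowPos hA (Nat.zero_le _), if_pos rfl]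
  rintro τ - ⟨hf, h24⟩
  refine Spec.seq ((Spec.block ?_).mono (by decide) fun _ _ h => h)
  simp only [Com.Pre, Instr.apply, Instr.Fits, Instr.IsOp, true_and, h24]
  have hm0 : MainState (stage fs 0) (dollarPos fs 0) 0 0 0 [] 0 (τ.set 1 (dollarPos fs 0)) :=
    ⟨hf.arr, hf.reg 0 (by omega), rfl, hf.reg 2 (by omega), hf.reg 4 (by omega), hf.reg 5 (by omega),
      hf.reg 8 (by omega), hf.swaps, hf.lookups⟩
  refine (Spec.whileLt_sum (fun x τ => (∃ p m, MainState (stage fs x) (dollarPos fs x) (prevEnd fs x) p m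
      ((List.range x).map (swapsAt fs)).flatten (fs.take x).flatten.length τ) ∧ τ.reg 3 = 0) fs.length
    (fun x => N * (200 * (fs.getD x []).length + 40 * (passes fs x * (fs.getD x []).length)) - 2) ?_ ?_
    ⟨⟨0, 0, hm0⟩, hf.reg 3 (by omega)⟩).mono ?_ fun _ _ h => h
  · rintro x hx τ - ⟨⟨p, m, hm⟩, t3⟩
    refine ⟨by rw [t3, hm.reg1]; exact h.dollarPos_pos hx, ?_⟩
    refine (h.convertStep_spec hx (hlen x) (by omega) hW hm).mono le_rfl ?_
    rintro τ - ⟨⟨p, m, hm⟩, t3⟩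
    rw [List.range_succ, List.map_append, List.flatten_append, take_succ_getD hx, List.flatten_append,
      List.length_append]
    refine ⟨⟨p, m, ?_⟩, t3⟩
    simpa using hm
  · rintro τ - ⟨⟨p, m, hm⟩, t3⟩
    rw [dollarPos_length, List.take_length] at hm
    exact ⟨by rw [t3, hm.reg1]; exact lt_irrefl _, hm.arr, hm.lookups, hm.swaps⟩
  · refine Nat.add_le_add_right (le_trans (Finset.sum_le_sum fun x hx => ?_) hsum) _
    have hc := h.cutContext (Finset.mem_range.1 hx)
    have htime := convert_time (fs.getD x []).length N (passes fs x) hc.length_pos (by omega)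
    omega

/-! ## Decoding the transform -/

/-- The rows of `T$` starting at positions up to `k`. -/
def firstRows (T : List ℕ) (k : ℕ) : Multiset (InfWord × ℕ) := (Multiset.range (k + 1)).map (textRow T)

theorem firstRows_succ (T : List ℕ) (k : ℕ) :
    firstRows T (k + 1) = textRow T (k + 1) ::ₘ firstRows T k := by
  rw [firstRows, Multiset.range_succ, Multiset.map_cons]; rfl

theorem firstRows_length (T : List ℕ) : firstRows T T.length = stageRows [] T := by
  rw [firstRows, range_succ_map, stageRows, restRows, wordsRows, List.map_nil, List.sum_nil, zero_add]
  rfl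

theorem textRow_succ_scons {T : List ℕ} {k : ℕ} (hk : k < T.length) :
    scons (T.getD k 0) (textRow T (k + 1)).1 = (textRow T k).1 := by
  simp only [textRow, dollarKey]
  exact scons_getD_app_drop hk _

section decode

variable {T : List ℕ} (hT : ∀ c ∈ T, 1 ≤ c) {k : ℕ} (hk : k < T.length)
include hT hk

theorem firstRows_ne : ∀ b ∈ firstRows T k, b.1 ≠ (textRow T (k + 1)).1 := by
  intro b hb e
  obtain ⟨j, hj, rfl⟩ := Multiset.mem_map.1 hb
  rw [Multiset.mem_range] at hj
  have := textRow_fst_inj hT (by omega) (by omega) e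
  omega

/-- Row `j + 1` with its label prepended is row `j`, so only rows up to `k` are counted. The extra
one is row `0`, whose label is the delimiter. -/
theorem labelCount_firstRows :
    labelCount (T.getD k 0) (· < (textRow T (k + 1)).1) (firstRows T (k + 1)) =
      keyCount (· < (textRow T k).1) (firstRows T k) + 1 := by
  have hpos : ∀ j < T.length, 1 ≤ T.getD j 0 := fun j hj => by
    rw [List.getD_eq_getElem _ _ hj]; exact hT _ (List.getElem_mem hj)
  rw [firstRows, range_succ_map, labelCount, pcount_cons_pos (by
    left
    change 0 < _
    have := hpos k hk
    omega), pcount_map, keyCount, firstRows, pcount_map]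
  congr 1
  apply pcount_congr
  intro j hj
  rw [Multiset.mem_range] at hj
  rw [← textRow_succ_scons hk, ← textRow_succ_scons (k := j) (by omega), scons_lt_scons]
  simp [textRow]

/-- One step of the decoding. -/
theorem decode_step {Z : List ℕ} (hZ : SortedArr (firstRows T (k + 1)) Z) :
    ∃ Z1 Z2, Z = Z1 ++ T.getD k 0 :: Z2 ∧ Z1.length = keyCount (· < (textRow T (k + 1)).1) (firstRows T (k + 1)) ∧
      SortedArr (firstRows T k) (Z1 ++ Z2) ∧
      lfc Z (T.getD k 0) Z1.length = keyCount (· < (textRow T k).1) (firstRows T k) + 1 := by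
  have h1 := hZ
  rw [firstRows_succ] at h1
  obtain ⟨Z1, Z2, h2, h3, h4⟩ := h1.split (firstRows_ne hT hk)
  have h5 : keyCount (· < (textRow T (k + 1)).1) (firstRows T (k + 1)) =
      keyCount (· < (textRow T (k + 1)).1) (firstRows T k) := by
    rw [firstRows_succ, keyCount_cons_neg (D := (· < (textRow T (k + 1)).1)) (lt_irrefl _)]
  refine ⟨Z1, Z2, ?_, by rw [h3, h5], h4, ?_⟩
  · rw [h2]; simp [textRow]
  · rw [h3, ← h5, hZ.lfc_keyCount _ (isLowerKey_lt _), labelCount_firstRows hT hk]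

end decode

/-! ## Inserting a factor -/

/-- The rows when the last `i` characters of `w` have been inserted. -/
noncomputable def insertRows (ws : List (List ℕ)) (w : List ℕ) (i : ℕ) : Multiset (InfWord × ℕ) :=
  stageRows ws [] + (Multiset.range i).map fun j => (newKey w (w.length - j), w.getD (w.length - 1 - j) 0)

theorem insertRows_zero (ws : List (List ℕ)) (w : List ℕ) : insertRows ws w 0 = stageRows ws [] := by
  simp [insertRows]

theorem insertRows_succ (ws : List (List ℕ)) (w : List ℕ) (i : ℕ) : insertRows ws w (i + 1) =
    (newKey w (w.length - i), w.getD (w.length - 1 - i) 0) ::ₘ insertRows ws w i := by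
  rw [insertRows, Multiset.range_succ, Multiset.map_cons, Multiset.add_cons]; rfl

theorem range_reflect_map {α : Type*} (f : ℕ → α) (n : ℕ) :
    (Multiset.range n).map (fun j => f (n - 1 - j)) = (Multiset.range n).map f := by
  induction n with
  | zero => rfl
  | succ n ih =>
    rw [range_succ_map, Multiset.range_succ, Multiset.map_cons, ← ih]
    congr 1
    apply Multiset.map_congr rfl
    intro j _
    rw [show n + 1 - 1 - (j + 1) = n - 1 - j by omega]

/-- The first inserted row has the key at `|w|`, which is the key at `0`; so after `|w|` insertions
each conjugate is present once. -/
theorem insertRows_length (ws : List (List ℕ)) {w : List ℕ} (hw : w ≠ []) :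
    insertRows ws w w.length = stageRows (ws ++ [w]) [] := by
  obtain ⟨m, hm⟩ : ∃ m, w.length = m + 1 := ⟨w.length - 1, by have := List.length_pos_iff.2 hw; omega⟩
  have e1 : wordRows w = (Multiset.range w.length).map
      fun j => (newKey w (w.length - j), w.getD (w.length - 1 - j) 0) := by
    unfold wordRows
    have e2 : ((Multiset.range w.length).map fun j => (newKey w (w.length - j), w.getD (w.length - 1 - j) 0)) =
        (Multiset.range w.length).map fun j => (newKey w (j + 1), w.getD j 0) := by
      rw [← range_reflect_map (fun j => (newKey w (j + 1), w.getD j 0))]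
      apply Multiset.map_congr rfl
      intro j hj
      rw [Multiset.mem_range] at hj
      rw [show w.length - j = w.length - 1 - j + 1 by omega]
    rw [e2, hm, range_succ_map, Multiset.range_succ, Multiset.map_cons]
    congr 1
    · rw [wordRow_eq, newKey_zero hw, ← newKey_length, hm, rowLabel, if_pos rfl, getLastD_eq_getD, hm]; rfl
  rw [insertRows, ← e1, stageRows, stageRows, restRows, restRows, wordsRows, wordsRows, List.map_append, List.sum_append,
    List.map_singleton, List.sum_singleton, Multiset.cons_add, add_right_comm]

section insert

variable {ws : List (List ℕ)} {w : List ℕ} (hw : IsLyndon w) (hpos : ∀ c ∈ w, 1 ≤ c)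

include hw hpos in
-- All earlier factors are at least `w`, so their conjugates have keys at least `w^ω`; only the
-- delimiter precedes the first inserted row.
theorem keyCount_insertRows_zero (hws : ∀ u ∈ ws, IsLyndon u ∧ w ≤ u) :
    keyCount (· < newKey w w.length) (insertRows ws w 0) = 1 := by
  rw [insertRows_zero, newKey_length, stageRows, keyCount_cons_pos]
  · rw [keyCount, pcount_eq_zero]
    intro b hb
    rw [restRows] at hb
    rcases Multiset.mem_add.1 hb with hb | hb
    · obtain ⟨u, hu, k, hk, rfl⟩ := mem_wordsRows.1 hb
      obtain ⟨hu1, hu2⟩ := hws u hu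
      have h3 : omegaKey u ≤ app (u.drop k) (omegaKey u) := by
        rcases Nat.eq_zero_or_pos k with rfl | hk0
        · rw [List.drop_zero, ← omegaKey_eq_app hu1.1]
        · conv_lhs => rw [omegaKey_eq_app hu1.1]
          exact ((hu1.strongLt_drop hk0 hk).1 _ _).le
      exact not_lt.2 ((hw.omegaKey_le_omegaKey hu1 hu2).trans h3)
    · simp [textRest] at hb
  · refine lt_of_le_of_ne (zeroWord_le _) fun e => omegaKey_apply_ne_zero hw.1 hpos 0 ?_
    rw [← e]; rfl

include hw hpos in
-- The rows present are not closed under prepending labels. The row `w^ω` is smaller than the next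
-- key but is not yet the image of any row, which explains the `+ 1`; the image of the newest row is
-- the next key itself and is not strictly below it.
theorem labelCount_insertRows {i : ℕ} (hi : i + 1 < w.length) :
    labelCount (w.getD (w.length - 1 - i) 0) (· < newKey w (w.length - i)) (insertRows ws w (i + 1)) + 1 =
      keyCount (· < newKey w (w.length - (i + 1))) (insertRows ws w (i + 1)) := by
  have hc : ∀ j < w.length, scons (w.getD (w.length - 1 - j) 0) (newKey w (w.length - j)) =
      newKey w (w.length - 1 - j) := by
    intro j hj
    rw [CutContext.newKey_eq_scons (k := w.length - 1 - j) (by omega), show w.length - 1 - j + 1 = w.length - j by omega]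
  have h1 : labelCount (w.getD (w.length - 1 - i) 0) (· < newKey w (w.length - i)) (insertRows ws w (i + 1)) =
      keyCount (· < newKey w (w.length - 1 - i)) (stageRows ws []) +
        pcount (fun j => newKey w (w.length - 1 - j) < newKey w (w.length - 1 - i)) (Multiset.range (i + 1)) := by
    rw [insertRows, labelCount, pcount_add, pcount_map]
    congr 1
    · rw [← hc i (by omega), keyCount_stageRows_lt]
      · rfl
      · rw [List.getD_eq_getElem _ _ (by omega)]; exact hpos _ (List.getElem_mem _)
    · apply pcount_congr
      intro j hj
      rw [Multiset.mem_range] at hj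
      rw [← hc i (by omega), ← hc j (by omega), scons_lt_scons]
  have h2 : keyCount (· < newKey w (w.length - (i + 1))) (insertRows ws w (i + 1)) =
      keyCount (· < newKey w (w.length - 1 - i)) (stageRows ws []) +
        pcount (fun j => newKey w (w.length - j) < newKey w (w.length - 1 - i)) (Multiset.range (i + 1)) := by
    rw [insertRows, keyCount, pcount_add, pcount_map, show w.length - (i + 1) = w.length - 1 - i by omega]
    rfl
  have h3 : pcount (fun j => newKey w (w.length - 1 - j) < newKey w (w.length - 1 - i)) (Multiset.range (i + 1)) =
      pcount (fun j => newKey w (w.length - 1 - j) < newKey w (w.length - 1 - i)) (Multiset.range i) := by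
    rw [Multiset.range_succ, pcount_cons_neg (P := fun j => newKey w (w.length - 1 - j) <
      newKey w (w.length - 1 - i)) (lt_irrefl _)]
  have h4 : pcount (fun j => newKey w (w.length - j) < newKey w (w.length - 1 - i)) (Multiset.range (i + 1)) =
      pcount (fun j => newKey w (w.length - 1 - j) < newKey w (w.length - 1 - i)) (Multiset.range i) + 1 := by
    have := range_succ_map (fun j => j) i
    rw [Multiset.map_id'] at this
    rw [this, pcount_cons_pos, pcount_map]
    · congr 1
      apply pcount_congr
      intro j hj
      rw [show w.length - (j + 1) = w.length - 1 - j by omega]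
    · rw [Nat.sub_zero, newKey_length, ← newKey_zero hw.1]
      exact (hw.strongLt_drop (by omega) (by omega)).1 _ _
  omega

include hw hpos in
/-- One step of the insertion. -/
theorem insert_step {i : ℕ} {Z : List ℕ} (hZ : SortedArr (insertRows ws w i) Z) {p : ℕ}
    (hp : p = keyCount (· < newKey w (w.length - i)) (insertRows ws w i)) :
    p ≤ Z.length ∧
      SortedArr (insertRows ws w (i + 1)) (Z.take p ++ w.getD (w.length - 1 - i) 0 :: Z.drop p) ∧
      (i + 1 < w.length → lfc (Z.take p ++ w.getD (w.length - 1 - i) 0 :: Z.drop p)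
        (w.getD (w.length - 1 - i) 0) p + 1 =
        keyCount (· < newKey w (w.length - (i + 1))) (insertRows ws w (i + 1))) := by
  have h1 := hZ.insert_lt (newKey w (w.length - i), w.getD (w.length - 1 - i) 0)
  rw [← insertRows_succ] at h1
  simp only [← hp] at h1
  refine ⟨by rw [hp, hZ.length]; exact pcount_le_card _ _, h1, fun hi => ?_⟩
  rw [← labelCount_insertRows hw hpos hi, ← h1.lfc_keyCount _ (isLowerKey_lt _), insertRows_succ,
    keyCount_cons_neg (D := (· < newKey w (w.length - i))) (lt_irrefl _), ← hp]

end insert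

/-! ## Comparing suffixes -/

/-- The comparison loop stops at the first mismatch or at the end of `u`. As `u` is shorter, running
off its end means that `u` is a proper prefix and hence smaller. -/
theorem exists_mismatch : ∀ {u v : List ℕ}, u.length < v.length → ∃ j ≤ u.length,
    (∀ i < j, u.getD i 0 = v.getD i 0) ∧ (j < u.length → u.getD j 0 ≠ v.getD j 0) ∧
      (u < v ↔ j = u.length ∨ u.getD j 0 < v.getD j 0)
  | [], v, h => ⟨0, le_rfl, by simp, by simp, by
      cases v with
      | nil => simp at h
      | cons d v => simp⟩
  | c :: u, [], h => by simp at h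
  | c :: u, d :: v, h => by
    by_cases hcd : c = d
    · subst hcd
      obtain ⟨j, h1, h2, h3, h4⟩ := exists_mismatch (u := u) (v := v) (by simpa using h)
      refine ⟨j + 1, by simpa using h1, ?_, by simpa using h3, ?_⟩
      · rintro (- | i) hi
        · rfl
        · simpa using h2 i (by omega)
      · rw [List.cons_lt_cons_iff]
        simp only [lt_irrefl, true_and, false_or, List.length_cons, Nat.add_right_cancel_iff, List.getD_cons_succ]
        exact h4
    · refine ⟨0, Nat.zero_le _, by simp, by simpa using hcd, ?_⟩
      rw [List.cons_lt_cons_iff]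
      simp [hcd]

theorem exchange_append (u mid v : List ℕ) (a b : ℕ) :
    exchange (u ++ a :: (mid ++ b :: v)) u.length (u.length + mid.length + 1) =
      u ++ b :: (mid ++ a :: v) := by
  unfold exchange
  rw [if_pos (by simp; omega)]
  simp [List.getD_eq_getElem?_getD, Nat.add_assoc]

/-- Move the entry at the position in register `21` up to the position in register `20`. -/
def rotateUp : Com := .op (.const 28 1) ;;
  .whileLt 20 21 (.op (.swap 20 21) ;; .op (.add 20 20 28))

theorem rotateUp_spec {W : ℕ} {σ : MemState} {u mid v : List ℕ} {x : ℕ} (hA : σ.arr = u ++ mid ++ x :: v)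
    (h20 : σ.reg 20 = u.length) (h21 : σ.reg 21 = u.length + mid.length) (hW : σ.arr.length < W) :
    Spec W rotateUp σ (4 * σ.arr.length + 3) fun σ' =>
      ∃ S, Frame { σ with arr := u ++ x :: mid ++ v, swaps := S } σ' := by
  have hl : σ.arr.length = u.length + mid.length + v.length + 1 := by rw [hA]; simp; omega
  refine (Spec.seq (T := 1) (T' := mid.length * (2 + 2) + 2)
    ((Spec.block ?_).mono (by decide) fun _ _ h => h)).mono (by omega) fun _ _ h => h
  simp only [Com.Pre, Instr.apply, Instr.Fits, Instr.IsOp, true_and]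
  -- The place at the far end serves as temporary storage: it holds the entry displaced by the
  -- previous exchange, which goes to the next place.
  refine ⟨by omega, Spec.loop (fun i σ' => ∃ S u' mid' x', Frame { σ with
    arr := u' ++ mid' ++ x' :: v, swaps := S } σ' ∧ u' ++ x' :: mid' = u ++ x :: mid ∧
    u'.length = u.length + i ∧ σ'.reg 20 = u'.length ∧ σ'.reg 21 = u.length + mid.length ∧ σ'.reg 28 = 1)
      mid.length ?_ ?_ ?_⟩
  · rintro i hi τ - ⟨S, u', mid', x', hf, he, hu, t20, t21, t28⟩
    have hlen := congrArg List.length he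
    simp only [List.length_append, List.length_cons] at hlen
    refine ⟨by omega, ?_⟩
    cases mid' with
    | nil => simp at hlen; omega
    | cons a mid' =>
      simp only [List.length_cons] at hlen
      simp only [Com.Pre, Instr.apply, Instr.Fits, Instr.IsOp, true_and, MemState.set_reg, 
        t20, t21, t28, Nat.reduceEqDiff, if_true, if_false, and_true]
      refine ⟨by omega, τ.swaps ++ [(u'.length, u.length + mid.length)], u' ++ [x'], mid', a, ?_, by simpa using he,
        by simp; omega, by simp⟩
      rw [frame_set_iff (by omega)]
      refine ⟨hf.reg, ?_, rfl, hf.lookups⟩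
      simp only [hf.arr]
      rw [show u.length + mid.length = u'.length + mid'.length + 1 by omega]
      simpa using exchange_append u' mid' v a x'
  · rintro τ - ⟨S, u', mid', x', hf, he, hu, t20, t21, t28⟩
    have hlen := congrArg List.length he
    simp only [List.length_append, List.length_cons] at hlen
    refine ⟨by omega, S, ?_⟩
    have : mid' = [] := List.eq_nil_of_length_eq_zero (by omega)
    subst this
    rw [← he]
    simpa using hf
  · refine ⟨σ.swaps, u, mid, x, ?_, rfl, by simp, by simp [h20], by simp [h21], by simp⟩
    rw [frame_set_iff (by omega), ← hA]
    exact Frame.refl σ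

/-! ## Decoding -/

/-- The entry at the current row is the next character from the right. It is moved to the end of the
shrinking zone of rows, where it precedes the text decoded so far. The position of the next row is
the backward step minus one, by `labelCount_firstRows`. -/
def decodeStep : Com := .op (.load 11 4) ;; callScan 11 3 4 4 ;;
  (.op (.sub 5 3 8) ;; .op (.move 20 4) ;; .op (.move 21 5) ;; .op (.sub 4 24 8)) ;; rotate ;;
  .op (.move 3 5)

/-- The text behind position `k` has been decoded; the other rows are still in the array. -/
structure DecodeState (T : List ℕ) (k : ℕ) (σ : MemState) : Prop where
  arr : ∃ Z, σ.arr = Z ++ T.drop k ∧ SortedArr (firstRows T k) Z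
  reg0 : σ.reg 0 = T.length + 1
  reg3 : σ.reg 3 = k + 1
  reg4 : σ.reg 4 = keyCount (· < (textRow T k).1) (firstRows T k)
  reg8 : σ.reg 8 = 1

theorem card_firstRows (T : List ℕ) (k : ℕ) : (firstRows T k).card = k + 1 := by simp [firstRows]

theorem DecodeState.step {T : List ℕ} (hT : ∀ c ∈ T, 1 ≤ c) {k : ℕ} (hk : k < T.length) {W : ℕ}
    (hW : T.length + 1 < W) {σ : MemState} (h : DecodeState T (k + 1) σ) :
    Spec W decodeStep σ (25 * T.length + 50) (DecodeState T k) := by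
  obtain ⟨Z, hA, hZ⟩ := h.arr
  have hZl := hZ.length
  rw [card_firstRows] at hZl
  obtain ⟨Z1, Z2, hZe, h1, h2, h3⟩ := decode_step hT hk hZ
  have hl : σ.arr.length = T.length + 1 := by rw [hA]; simp; omega
  have hl2 : Z1.length + Z2.length = k + 1 := by rw [hZe] at hZl; simp at hZl; omega
  have h4 : σ.reg 4 = Z1.length := h.reg4.trans h1.symm
  have h3' := h.reg3
  have h8 := h.reg8
  have hc : σ.arr.getD (σ.reg 4) 0 = T.getD k 0 := by
    rw [hA, hZe, h4]; simp [List.getD_eq_getElem?_getD]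
  refine (Spec.seq (T := 1) (T' := (20 * (T.length + 1) + 10) + (4 + ((5 * (k + 1) + 3) + 1)))
    ((Spec.block ?_).mono (by decide) fun _ _ h => h)).mono (by omega) fun _ _ h => h
  simp only [Com.Pre, Instr.apply, Instr.Fits, Instr.IsOp, true_and, hc]
  refine Spec.seq ((callScan_spec (σ := σ.set 11 (T.getD k 0)) (c := 11) (l := 3) (p := 4) (e := 4) (A := σ.arr) rfl ?_ ?_ (by omega) (by omega)
    (by omega)).mono (by rw [hl]) ?_)
  · simp only [MemState.set_reg, Nat.reduceEqDiff, if_false, h3']; omega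
  · omega
  simp only [MemState.set_reg, Nat.reduceEqDiff, if_false, if_true, h3', h4]
  rw [show σ.arr.take (k + 1 + 1) = Z by rw [hA, ← hZl, List.take_left], h3]
  rintro τ - ⟨hf, h24, -⟩
  have hreg : ∀ r < 20, r ≠ 11 → τ.reg r = σ.reg r := fun r hr hr' => by rw [hf.reg r hr]; simp [hr']
  have e3 := hreg 3 (by omega) (by omega)
  have e8 := hreg 8 (by omega) (by omega)
  have e4 := hreg 4 (by omega) (by omega)
  have e0 := hreg 0 (by omega) (by omega)
  refine Spec.seq ((Spec.block ?_).mono (by decide) fun _ _ h => h)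
  simp only [Com.Pre, Instr.apply, Instr.Fits, Instr.IsOp, true_and, MemState.set_reg, Nat.reduceEqDiff, if_false,
    if_true, e3, e4, e8, h3', h4, h8, h24, Nat.add_sub_cancel]
  refine Spec.seq ((rotate_spec (p := Z1.length) (q := k + 1) (by simp) (by simp) (by omega) (by omega)).mono
    (by omega) ?_)
  rintro ρ - hf'
  refine (Spec.block ?_).mono (by decide) fun _ _ h => h
  have r3 := hf'.reg 5 (by omega)
  have r4 := hf'.reg 4 (by omega)
  have r8 := hf'.reg 8 (by omega)
  have r0 := hf'.reg 0 (by omega)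
  simp at r3 r4 r8 r0
  simp only [Com.Pre, Instr.apply, Instr.Fits, Instr.IsOp, true_and]
  refine ⟨⟨Z1 ++ Z2, ?_, h2⟩, ?_, ?_, ?_, ?_⟩
  · rw [MemState.set_arr, hf'.arr]
    simp only [MemState.set_arr, hf.arr, hA, hZe]
    rw [show k + 1 - Z1.length = Z2.length by omega]
    have := exchanges_swapRun Z1 Z2 (T.drop (k + 1)) (T.getD k 0)
    rw [List.drop_eq_getElem_cons hk, ← List.getD_eq_getElem _ 0 hk]
    simpa using this
  · simp [r0, e0, h.reg0]
  · simp [r3]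
  · simp [r4]
  · simp [r8, e8, h8]

/-- Decode the text. -/
def decode : Com := (.op (.const 8 1) ;; .op (.move 3 0)) ;; .whileLt 8 3 decodeStep

theorem firstRows_zero_eq {T Z : List ℕ} (h : SortedArr (firstRows T 0) Z) : Z = [0] := by
  obtain ⟨Y, hY, -, rfl⟩ := h
  rw [show firstRows T 0 = {textRow T 0} by simp [firstRows]] at hY
  rw [Multiset.coe_eq_singleton.1 hY]
  rfl

theorem decode_spec {T : List ℕ} (hT : ∀ c ∈ T, 1 ≤ c) {W : ℕ} (hW : T.length + 1 < W) {A : List ℕ}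
    (hA : SortedArr (stageRows [] T) A) :
    Spec W decode (startState A) (T.length * (25 * T.length + 52) + 4) fun σ =>
      σ.arr = 0 :: T ∧ σ.reg 0 = T.length + 1 ∧ σ.reg 8 = 1 := by
  rw [← firstRows_length] at hA
  have hl := hA.length
  rw [card_firstRows] at hl
  refine (Spec.seq (T := 2) (T' := T.length * ((25 * T.length + 50) + 2) + 2)
    ((Spec.block ?_).mono (by decide) fun _ _ h => h)).mono (by rw [Nat.add_comm, Nat.add_assoc]) fun _ _ h => h
  simp only [Com.Pre, Instr.apply, Instr.Fits, Instr.IsOp, true_and]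
  refine ⟨by omega, ?_⟩
  refine Spec.whileLt (fun i σ => DecodeState T (T.length - i) σ) T.length _ ?_ ?_ ?_
  · rintro i hi σ - h
    rw [show T.length - i = T.length - (i + 1) + 1 by omega] at h
    refine ⟨by rw [h.reg3, h.reg8]; omega, h.step hT (by omega) hW⟩
  · rintro σ - h
    rw [Nat.sub_self] at h
    obtain ⟨Z, h1, h2⟩ := h.arr
    rw [firstRows_zero_eq h2] at h1
    exact ⟨by rw [h.reg3, h.reg8]; omega, by simpa using h1, h.reg0, h.reg8⟩
  · have h0 : keyCount (· < (textRow T T.length).1) (firstRows T T.length) = 0 :=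
      pcount_eq_zero fun a _ => not_lt.2 (by
        simp only [textRow, List.drop_length]; exact zeroWord_le _)
    exact ⟨⟨A, by simp [startState], hA⟩, by simp [startState, hl], by simp [startState, hl],
      by rw [Nat.sub_zero, h0]; simp [startState], by simp⟩

/-! ## Factorizing the text and inserting the factors -/

/-- Put `1` into register `7` if the suffix at distance `k` (register `5`) behind the position `s`
(register `1`) is smaller than the suffix at `s`, and `0` otherwise. -/
def compareSuffix : Com :=
  (.op (.const 7 0) ;; .op (.add 10 1 5) ;; .op (.move 11 1) ;; .op (.const 9 0)) ;;
  .whileLt 9 8 (.ifLt 10 0 ((.op (.load 12 10) ;; .op (.load 13 11)) ;;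
      .ifEq 12 13 (.op (.add 10 10 8) ;; .op (.add 11 11 8))
        (.op (.const 9 1) ;; .ifLt 12 13 (.op (.const 7 1)) .skip))
    (.op (.const 9 1) ;; .op (.const 7 1)))

/-- The part of the state that is left unchanged by the search for the end of a factor. -/
structure SuffixState (A : List ℕ) (s k : ℕ) (σ : MemState) : Prop where
  arr : σ.arr = A
  reg0 : σ.reg 0 = A.length
  reg1 : σ.reg 1 = s
  reg5 : σ.reg 5 = k
  reg8 : σ.reg 8 = 1

theorem SuffixState.set {A : List ℕ} {s k : ℕ} {σ : MemState} (h : SuffixState A s k σ) {r : ℕ}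
    (hr : r ≠ 0 ∧ r ≠ 1 ∧ r ≠ 5 ∧ r ≠ 8) (v : ℕ) : SuffixState A s k (σ.set r v) := by
  refine ⟨h.arr, ?_, ?_, ?_, ?_⟩ <;> rw [MemState.set_reg, if_neg (by omega)]
  · exact h.reg0
  · exact h.reg1
  · exact h.reg5
  · exact h.reg8

theorem SuffixState.set5 {A : List ℕ} {s k : ℕ} {σ : MemState} (h : SuffixState A s k σ) (v : ℕ) :
    SuffixState A s v (σ.set 5 v) := by
  refine ⟨h.arr, ?_, ?_, ?_, ?_⟩ <;> rw [MemState.set_reg]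
  · exact h.reg0
  · exact h.reg1
  · rfl
  · exact h.reg8

open Classical in
-- Register `9` is the stop flag. The later suffix is shorter, so reaching the end of the array
-- decides in its favour.
theorem compareSuffix_spec {W : ℕ} {A : List ℕ} {s k : ℕ} {σ : MemState} (h : SuffixState A s k σ) (hk : 1 ≤ k)
    (hs : s + k ≤ A.length) (hW : A.length < W) :
    Spec W compareSuffix σ (20 * A.length + 30) fun σ' =>
      SuffixState A s k σ' ∧ σ'.reg 7 = if A.drop (s + k) < A.drop s then 1 else 0 := by
  obtain ⟨j, hj, h1, h2, h3⟩ := exists_mismatch (u := A.drop (s + k)) (v := A.drop s) (by simp; omega)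
  simp only [List.length_drop] at hj h2 h3
  have e1 : ∀ i, (A.drop (s + k)).getD i 0 = A.getD (s + k + i) 0 := fun i => by simp [List.getD_eq_getElem?_getD]
  have e2 : ∀ i, (A.drop s).getD i 0 = A.getD (s + i) 0 := fun i => by simp [List.getD_eq_getElem?_getD]
  simp only [e1, e2] at h1 h2 h3
  refine (Spec.seq (T := 4) (T' := (j + 1) * (14 + 2) + 2)
    ((Spec.block ?_).mono (by decide) fun _ _ h => h)).mono (by omega) fun _ _ h => h
  simp only [Com.Pre, Instr.apply, Instr.Fits, Instr.IsOp, true_and, MemState.set_reg, Nat.reduceEqDiff,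
    if_false, h.reg1, h.reg5]
  refine ⟨by omega, by omega, by omega, ?_⟩
  refine Spec.loop (fun i τ => SuffixState A s k τ ∧
    (i ≤ j → τ.reg 9 = 0 ∧ τ.reg 7 = 0 ∧ τ.reg 10 = s + k + i ∧ τ.reg 11 = s + i) ∧
    (i = j + 1 → τ.reg 9 = 1 ∧ τ.reg 7 = if A.drop (s + k) < A.drop s then 1 else 0)) (j + 1) ?_ ?_ ?_
  · rintro i hi τ - ⟨hst, hle, -⟩
    obtain ⟨t9, t7, t10, t11⟩ := hle (by omega)
    refine ⟨by rw [t9, hst.reg8]; omega, ?_⟩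
    rcases (Nat.lt_succ_iff.1 hi).lt_or_eq with hij | rfl
    · have he := h1 i hij
      simp only [Com.Pre, Instr.apply, Instr.Fits, Instr.IsOp, true_and, MemState.set_reg, MemState.set_arr,
        Nat.reduceEqDiff, if_true, if_false, t9, t7, t10, t11, hst.arr, hst.reg0, hst.reg8, he]
      refine ⟨fun _ => ⟨fun _ => ⟨by omega, by omega, ?_, fun _ => by omega, by omega⟩, by simp⟩, by omega⟩
      exact (((hst.set (by omega) _).set (by omega) _).set (by omega) _).set (by omega) _
    · simp only [Com.Pre, Instr.apply, Instr.Fits, Instr.IsOp, true_and, MemState.set_reg, MemState.set_arr,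
        Nat.reduceEqDiff, if_true, if_false, t9, t7, t10, t11, hst.arr, hst.reg0, hst.reg8, h3]
      refine ⟨fun hlt => ⟨fun he => absurd he (h2 (by omega)), fun _ => ⟨by omega, fun hl => ?_, fun hl => ?_⟩⟩,
        fun hlt => ?_⟩
      · refine ⟨by omega, ?_, by omega, fun _ => ?_⟩
        · exact (((hst.set (by omega) _).set (by omega) _).set (by omega) _).set (by omega) _
        · rw [if_pos (Or.inr hl)]
      · refine ⟨?_, by omega, fun _ => ?_⟩
        · exact ((hst.set (by omega) _).set (by omega) _).set (by omega) _
        · rw [if_neg (by omega)]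
      · refine ⟨by omega, by omega, ?_, by omega, fun _ => ?_⟩
        · exact (hst.set (by omega) _).set (by omega) _
        · rw [if_pos (Or.inl (by omega))]
  · rintro τ - ⟨hst, -, he⟩
    obtain ⟨t9, t7⟩ := he rfl
    exact ⟨by rw [t9, hst.reg8]; omega, hst, t7⟩
  · refine ⟨?_, fun _ => by simp, by omega⟩
    exact (((h.set (by omega) _).set (by omega) _).set (by omega) _).set (by omega) _

/-- Put the distance to the next smaller suffix into register `5`. -/
def findLength : Com := (.op (.const 5 0) ;; .op (.const 7 0)) ;;
  .whileLt 7 8 (.op (.add 5 5 8) ;; compareSuffix)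

theorem findLength_spec {W : ℕ} {A : List ℕ} {s k m : ℕ} {σ : MemState} (h : SuffixState A s k σ) (hm : 1 ≤ m)
    (hs : s + m ≤ A.length) (hW : A.length < W) (hlt : A.drop (s + m) < A.drop s)
    (hgt : ∀ k, 1 ≤ k → k < m → ¬ A.drop (s + k) < A.drop s) :
    Spec W findLength σ (m * (20 * A.length + 33) + 4) (SuffixState A s m) := by
  refine (Spec.seq (T := 2) (T' := m * ((1 + (20 * A.length + 30)) + 2) + 2)
    ((Spec.block ?_).mono (by decide) fun _ _ h => h)).mono
    (by rw [show 1 + (20 * A.length + 30) + 2 = 20 * A.length + 33 by omega]; omega) fun _ _ h => h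
  simp only [Com.Pre, Instr.apply, Instr.Fits, Instr.IsOp, true_and]
  refine ⟨by omega, by omega, ?_⟩
  refine Spec.whileLt (fun i τ => SuffixState A s i τ ∧ τ.reg 7 = if i = m then 1 else 0) m _ ?_ ?_ ?_
  · rintro i hi τ - ⟨hst, t7⟩
    rw [if_neg (by omega)] at t7
    refine ⟨by rw [t7, hst.reg8]; omega, ?_⟩
    refine Spec.seq ((Spec.block ?_).mono (by decide) fun _ _ h => h)
    simp only [Com.Pre, Instr.apply, Instr.Fits, Instr.IsOp, true_and, hst.reg5, hst.reg8]
    refine ⟨by omega, ?_⟩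
    refine (compareSuffix_spec (hst.set5 (i + 1)) (by omega) (by omega) hW).mono le_rfl ?_
    rintro ρ - ⟨hst', r7⟩
    refine ⟨hst', r7.trans ?_⟩
    rcases Nat.lt_or_ge (i + 1) m with hlt' | hge
    · rw [if_neg (hgt _ (by omega) hlt'), if_neg (by omega)]
    · rw [show i + 1 = m by omega, if_pos hlt, if_pos rfl]
  · rintro τ - ⟨hst, t7⟩
    rw [if_pos rfl] at t7
    exact ⟨by rw [t7, hst.reg8]; omega, hst⟩
  · refine ⟨(h.set5 0).set (by omega) _, ?_⟩
    rw [if_neg (by omega)]; simp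

/-- Register `2` stays at the last place of the factor: moving the character there to the front zone
shifts the preceding character of the factor into that place. -/
def insertStep : Com := (.op (.load 11 2) ;; .op (.move 20 4) ;; .op (.move 21 2)) ;; rotateUp ;;
  .op (.add 3 3 8) ;; callScan 11 3 4 4 ;; (.op (.add 4 24 8) ;; .op (.add 6 6 8))

/-- Insert the rows of the factor of length `m` (register `5`) at the position `s` (register `1`). -/
def insertFactor : Com := (.op (.add 2 1 5) ;; .op (.sub 2 2 8) ;; .op (.move 3 1) ;; .op (.const 4 1) ;;
  .op (.const 6 0)) ;; .whileLt 6 5 insertStep ;; .op (.move 1 3)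

/-- The last `i` characters of `w` have been inserted in front of the text. -/
structure InsertState (ws : List (List ℕ)) (w V : List ℕ) (N i : ℕ) (σ : MemState) : Prop where
  arr : ∃ Z, σ.arr = Z ++ (w.take (w.length - i) ++ V) ∧ SortedArr (insertRows ws w i) Z ∧ Z.length = σ.reg 3
  length : σ.arr.length = N
  reg0 : σ.reg 0 = N
  reg2 : σ.reg 2 + i + 1 = σ.reg 3 + w.length
  reg4 : i < w.length → σ.reg 4 = keyCount (· < newKey w (w.length - i)) (insertRows ws w i)
  reg5 : σ.reg 5 = w.length
  reg6 : σ.reg 6 = i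
  reg8 : σ.reg 8 = 1

theorem InsertState.step {ws : List (List ℕ)} {w V : List ℕ} (hw : IsLyndon w) (hpos : ∀ c ∈ w, 1 ≤ c)
    {N i W : ℕ} (hi : i < w.length) (hW : N < W) {σ : MemState} (h : InsertState ws w V N i σ) :
    Spec W insertStep σ (24 * N + 20) (InsertState ws w V N (i + 1)) := by
  obtain ⟨Z, hA, hZ, h3⟩ := h.arr
  have h4 := h.reg4 hi
  have h2 := h.reg2
  obtain ⟨hp, hZ', hlfc⟩ := insert_step hw hpos hZ h4
  obtain ⟨c, hc⟩ : ∃ c, c = w.getD (w.length - 1 - i) 0 := ⟨_, rfl⟩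
  obtain ⟨p, hpe⟩ : ∃ p, p = σ.reg 4 := ⟨_, rfl⟩
  obtain ⟨l, hl⟩ : ∃ l, l = Z.length := ⟨_, rfl⟩
  rw [← hc, ← hpe] at hZ' hlfc
  rw [← hpe, ← hl] at hp
  rw [← hl] at h3
  have ht : w.take (w.length - i) = w.take (w.length - (i + 1)) ++ [c] := by
    rw [hc, show w.length - i = w.length - (i + 1) + 1 by omega, List.take_succ_eq_append_getElem (by omega),
      List.getD_eq_getElem _ _ (by omega)]
    simp only [show w.length - 1 - i = w.length - (i + 1) by omega]
  have hN := h.length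
  have hil : i ≤ l := by rw [hl, hZ.length]; simp [insertRows]
  have hlN : l + 1 + (w.length - (i + 1)) + V.length = N := by
    rw [← hN, hA, ht]; simp; omega
  have hA' : σ.arr = Z.take p ++ (Z.drop p ++ w.take (w.length - (i + 1))) ++ c :: V := by
    rw [hA, ht, ← List.append_assoc (Z.take p), List.take_append_drop]; simp
  have hload : σ.arr.getD (σ.reg 2) 0 = c := by
    have e : Z.take p ++ (Z.drop p ++ w.take (w.length - (i + 1))) ++ c :: V =
      (Z ++ w.take (w.length - (i + 1))) ++ c :: V := by
      rw [← List.append_assoc (Z.take p), List.take_append_drop]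
    rw [hA', e, show σ.reg 2 = (Z ++ w.take (w.length - (i + 1))).length by simp; omega]
    simp [List.getD_eq_getElem?_getD]
  refine (Spec.seq (T := 3) (T' := (4 * N + 3) + (1 + ((20 * N + 10) + 2)))
    ((Spec.block ?_).mono (by decide) fun _ _ h => h)).mono (by omega) fun _ _ h => h
  simp only [Com.Pre, Instr.apply, Instr.Fits, Instr.IsOp, true_and, MemState.set_reg, Nat.reduceEqDiff, if_false,
    hload]
  refine Spec.seq ((rotateUp_spec (σ := ((σ.set 11 c).set 20 (σ.reg 4)).set 21 (σ.reg 2)) (u := Z.take p) (mid := Z.drop p ++ w.take (w.length - (i + 1))) (v := V) (x := c)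
    hA' ?_ ?_ ?_).mono ?_ ?_)
  · simp; omega
  · simp; omega
  · simpa [hN] using hW
  · simp [hN]
  rintro τ - ⟨S, hf⟩
  have r0 := hf.reg 0 (by omega)
  have r2 := hf.reg 2 (by omega)
  have r3 := hf.reg 3 (by omega)
  have r4 := hf.reg 4 (by omega)
  have r5 := hf.reg 5 (by omega)
  have r6 := hf.reg 6 (by omega)
  have r8 := hf.reg 8 (by omega)
  have r11 := hf.reg 11 (by omega)
  simp only [MemState.set_reg, Nat.reduceEqDiff, if_false, if_true, h.reg0, ← h3, ← hpe, h.reg5, h.reg6, h.reg8] at r0 r2 r3 r4 r5 r6 r8 r11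
  refine Spec.seq ((Spec.block ?_).mono (by decide) fun _ _ h => h)
  simp only [Com.Pre, Instr.apply, Instr.Fits, Instr.IsOp, true_and, r3, r8]
  have hτ : τ.arr = (Z.take p ++ c :: Z.drop p) ++ (w.take (w.length - (i + 1)) ++ V) := by
    rw [hf.arr]; simp
  have hZl : (Z.take p ++ c :: Z.drop p).length = l + 1 := by simp; omega
  have hτN : τ.arr.length = N := by rw [hτ, List.length_append, hZl]; simp; omega
  refine ⟨by omega, Spec.seq ((callScan_spec (σ := τ.set 3 (l + 1)) (c := 11) (l := 3) (p := 4) (e := 4)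
    (A := τ.arr) rfl ?_ ?_ (by omega) (by omega) (by omega)).mono (by rw [hτN]) ?_)⟩
  · simp; omega
  · omega
  simp only [MemState.set_reg, Nat.reduceEqDiff, if_false, if_true, r11, r4]
  rw [show τ.arr.take (l + 1) = Z.take p ++ c :: Z.drop p by rw [hτ, ← hZl, List.take_left]]
  rintro ρ - ⟨hg, h24, -⟩
  have q0 := hg.reg 0 (by omega)
  have q2 := hg.reg 2 (by omega)
  have q3 := hg.reg 3 (by omega)
  have q5 := hg.reg 5 (by omega)
  have q6 := hg.reg 6 (by omega)
  have q8 := hg.reg 8 (by omega)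
  simp only [MemState.set_reg, Nat.reduceEqDiff, if_false, if_true, r0, r2, r5, r6, r8] at q0 q2 q3 q5 q6 q8
  have hle := lfc_le (Z.take p ++ c :: Z.drop p) c p
  rw [hZl, ← h24] at hle
  refine (Spec.block ?_).mono (by decide) fun _ _ h => h
  simp only [Com.Pre, Instr.apply, Instr.Fits, Instr.IsOp, true_and, MemState.set_reg, Nat.reduceEqDiff, if_false,
    q8, q6]
  refine ⟨by omega, by omega, ⟨_, hg.arr.trans hτ, hZ', ?_⟩, ?_, ?_, ?_, fun hi' => ?_, ?_, ?_, ?_⟩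
  · rw [hZl]; simp [q3]
  · simp [hg.arr, hτN]
  · simpa using q0
  · simp [q2, q3]; omega
  · simp only [MemState.set_reg, Nat.reduceEqDiff, if_false, if_true, h24]; exact hlfc hi'
  · simpa using q5
  · simp
  · simpa using q8

/-- The factors in `ws` have been inserted; the text behind them is `V`. -/
structure ZoneState (ws : List (List ℕ)) (V : List ℕ) (N : ℕ) (σ : MemState) : Prop where
  arr : ∃ Z, σ.arr = Z ++ V ∧ SortedArr (stageRows ws []) Z ∧ Z.length = σ.reg 1
  length : σ.arr.length = N
  reg0 : σ.reg 0 = N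
  reg8 : σ.reg 8 = 1

theorem insertFactor_spec {ws : List (List ℕ)} {w V : List ℕ} (hw : IsLyndon w) (hpos : ∀ c ∈ w, 1 ≤ c)
    (hws : ∀ u ∈ ws, IsLyndon u ∧ w ≤ u) {N W : ℕ} (hW : N < W) {σ : MemState} (h : ZoneState ws (w ++ V) N σ)
    (h5 : σ.reg 5 = w.length) :
    Spec W insertFactor σ (w.length * (24 * N + 22) + 8) (ZoneState (ws ++ [w]) V N) := by
  obtain ⟨Z, hA, hZ, h1⟩ := h.arr
  have hm := List.length_pos_iff.2 hw.1
  have hN := h.length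
  have hl : Z.length + w.length + V.length = N := by rw [← hN, hA]; simp; omega
  refine (Spec.seq (T := 5) (T' := (w.length * ((24 * N + 20) + 2) + 2) + 1)
    ((Spec.block ?_).mono (by decide) fun _ _ h => h)).mono
    (by rw [show 24 * N + 20 + 2 = 24 * N + 22 by omega]; omega) fun _ _ h => h
  simp only [Com.Pre, Instr.apply, Instr.Fits, Instr.IsOp, true_and, MemState.set_reg, Nat.reduceEqDiff, if_false,
    if_true, h5, h.reg8, ← h1]
  refine ⟨by omega, by omega, by omega, ?_⟩
  refine Spec.seq (Spec.whileLt (InsertState ws w V N) w.length _ ?_ ?_ ?_)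
  · exact fun i hi τ _ hst => ⟨by rw [hst.reg5, hst.reg6]; exact hi, hst.step hw hpos hi hW⟩
  · rintro τ - hst
    obtain ⟨Z', h2, h3, h4⟩ := hst.arr
    rw [insertRows_length ws hw.1] at h3
    refine ⟨by rw [hst.reg5, hst.reg6]; omega, (Spec.block ?_).mono (by decide) fun _ _ h => h⟩
    simp only [Com.Pre, Instr.apply, Instr.Fits, Instr.IsOp, true_and]
    exact ⟨⟨Z', by simpa using h2, h3, by simpa using h4⟩, hst.length, by simpa using hst.reg0,
      by simpa using hst.reg8⟩
  · refine ⟨⟨Z, by simpa using hA, by rwa [insertRows_zero], by simp⟩, by simpa using hN, by simp [h.reg0], ?_,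
      fun _ => ?_, by simp [h5], by simp, by simp [h.reg8]⟩
    · simp; omega
    · rw [Nat.sub_zero, keyCount_insertRows_zero hw hpos hws]; simp

/-- The conversion by decoding the text and inserting one factor after the other. -/
def rebuild : Com := decode ;; .op (.const 1 1) ;; .whileLt 1 0 (findLength ;; insertFactor)

/-- A factor of length `m` takes `m` suffix comparisons and `m` insertions, each linear in `N`, so
the factors together cost quadratic time. -/
theorem TextFactors.rebuildStep_spec {fs : List (List ℕ)} (h : TextFactors fs) {x : ℕ} (hx : x < fs.length)
    {W N : ℕ} (hW : N < W) {σ : MemState} (hσ : ZoneState (fs.take x) (fs.drop x).flatten N σ) :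
    σ.reg 1 < σ.reg 0 ∧ Spec W (findLength ;; insertFactor) σ ((fs.getD x []).length * (44 * N + 70))
      (ZoneState (fs.take (x + 1)) (fs.drop (x + 1)).flatten N) := by
  have hc := h.cutContext hx
  have hm := hc.length_pos
  have hns := h.nextSmaller.drop x
  rw [flatten_drop_eq hx] at hσ
  rw [getD_cons_drop hx] at hns
  rw [take_succ_getD hx]
  obtain ⟨Z, hA, hZ, h1⟩ := hσ.arr
  have hN := hσ.length
  have hl : Z.length + (fs.getD x []).length + (laterText fs x).length = N := by rw [← hN, hA]; simp; omega
  refine ⟨by rw [hσ.reg0, ← h1]; omega, ?_⟩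
  have hst : SuffixState σ.arr Z.length (σ.reg 5) σ := ⟨rfl, by rw [hσ.reg0, hN], h1.symm, rfl, hσ.reg8⟩
  have hdrop : ∀ k ≤ (fs.getD x []).length, σ.arr.drop (Z.length + k) = (fs.getD x []).drop k ++ laterText fs x := by
    intro k hk
    rw [hA, List.drop_append, List.drop_append_of_le_length (by omega)]
    simp
  have h0 := hdrop 0 (Nat.zero_le _)
  rw [Nat.add_zero, List.drop_zero] at h0
  refine Spec.mono (Spec.seq (T := (fs.getD x []).length * (20 * N + 33) + 4)
    (T' := (fs.getD x []).length * (24 * N + 22) + 8) ((findLength_spec hst hm ?_ ?_ ?_ ?_).mono (by rw [hN]) ?_)) ?_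
    fun _ _ h => h
  · omega
  · omega
  · rw [hdrop _ le_rfl, h0, List.drop_length]; exact hns.2.1
  · intro k hk1 hk2
    rw [hdrop _ hk2.le, h0]; exact lt_asymm (hns.2.2.1 k hk1 hk2)
  · rintro τ - ht
    refine insertFactor_spec hc.lyndon hc.pos_w (h.le_take hx) hW ⟨⟨Z, ht.arr.trans hA, hZ, ht.reg1.symm⟩, ?_, ?_,
      ht.reg8⟩ ht.reg5
    · rw [ht.arr, hN]
    · rw [ht.reg0, hN]
  · have : (fs.getD x []).length * (20 * N + 33) + (fs.getD x []).length * (24 * N + 22) +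
      15 * (fs.getD x []).length = (fs.getD x []).length * (44 * N + 70) := by ring
    omega

theorem TextFactors.rebuild_spec {fs : List (List ℕ)} (h : TextFactors fs) {W : ℕ}
    (hW : fs.flatten.length + 1 < W) :
    Spec W rebuild (startState (stage fs 0)) (300 * ((fs.flatten.length + 1) * (fs.flatten.length + 1))) fun σ =>
      σ.arr = stage fs fs.length := by
  have hpos : ∀ c ∈ fs.flatten, 1 ≤ c := by simpa using h.pos_flatten (x := 0)
  have hsum : ∑ x ∈ Finset.range fs.length, ((fs.getD x []).length * (44 * (fs.flatten.length + 1) + 70) + 2) ≤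
      fs.flatten.length * (44 * (fs.flatten.length + 1) + 72) := by
    rw [Finset.sum_add_distrib, ← Finset.sum_mul, sum_length_getD]
    have : ∑ x ∈ Finset.range fs.length, 2 ≤ fs.flatten.length * 2 := by
      rw [← sum_length_getD, Finset.sum_mul]
      refine Finset.sum_le_sum fun x hx => ?_
      have := (h.cutContext (Finset.mem_range.1 hx)).length_pos
      omega
    have e : fs.flatten.length * (44 * (fs.flatten.length + 1) + 72) =
      fs.flatten.length * (44 * (fs.flatten.length + 1) + 70) + fs.flatten.length * 2 := by ring
    omega
  refine (Spec.seq (T := fs.flatten.length * (25 * fs.flatten.length + 52) + 4)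
    (T' := 1 + (fs.flatten.length * (44 * (fs.flatten.length + 1) + 72) + 2)) ?_).mono
    (by nlinarith) fun _ _ h => h
  have hA := h.sortedArr_stage 0
  rw [rowsAt, List.take_zero, List.drop_zero] at hA
  refine (decode_spec hpos hW hA).mono le_rfl ?_
  rintro σ - ⟨ha, r0, r8⟩
  refine Spec.seq ((Spec.block ?_).mono (by decide) fun _ _ h => h)
  simp only [Com.Pre, Instr.apply, Instr.Fits, Instr.IsOp, true_and]
  refine ⟨by omega, ?_⟩
  refine (Spec.whileLt_sum (fun x σ => ZoneState (fs.take x) (fs.drop x).flatten (fs.flatten.length + 1) σ) fs.length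
    (fun x => (fs.getD x []).length * (44 * (fs.flatten.length + 1) + 70)) ?_ ?_ ?_).mono
    (Nat.add_le_add_right hsum _) fun _ _ h => h
  · exact fun x hx τ _ ht => h.rebuildStep_spec hx hW ht
  · rintro τ - ht
    obtain ⟨Z, h1, h2, h3⟩ := ht.arr
    have hA := h.sortedArr_stage fs.length
    rw [rowsAt, List.drop_length, List.flatten_nil] at hA
    rw [List.drop_length, List.flatten_nil, List.append_nil] at h1
    refine ⟨by rw [ht.reg0, ← ht.length, h1, h3]; exact lt_irrefl _, h1.trans (h2.unique hA (stageRows_label ?_ (by simp)))⟩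
    exact h.pos_take
  · refine ⟨⟨[0], by simpa using ha, ?_, by simp⟩, by simp [ha], by simp [r0], by simp [r8]⟩
    exact ⟨[(dollarKey [], 0)], by simp [stageRows, restRows, textRest, wordsRows], by simp, rfl⟩

/-! ## The theorem -/

def Instr.noLookup : Instr → Bool
  | .first _ _ => false
  | _ => true

def Com.noLookup : Com → Bool
  | .skip => true
  | .op i => i.noLookup
  | .seq a b => a.noLookup && b.noLookup
  | .ifLt _ _ a b => a.noLookup && b.noLookup
  | .ifEq _ _ a b => a.noLookup && b.noLookup
  | .whileLt _ _ a => a.noLookup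

theorem Com.elementary_compile {c : Com} (h : c.noLookup = true) (l : ℕ) :
    Program.Elementary (c.compile l) := by
  suffices H : ∀ i ∈ c.compile l, i.noLookup = true from fun r i hi => by simpa [Instr.noLookup] using H _ hi
  induction c generalizing l with
  | skip => simp [compile]
  | op i => simpa [compile, noLookup] using h
  | seq a b iha ihb =>
    simp only [noLookup, Bool.and_eq_true] at h
    simp only [compile, List.mem_append]
    rintro i (hi | hi)
    · exact iha h.1 _ i hi
    · exact ihb h.2 _ i hi
  | ifLt r s a b iha ihb =>
    simp only [noLookup, Bool.and_eq_true] at h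
    simp only [compile, List.mem_cons, List.mem_append]
    rintro i (rfl | hi | rfl | hi)
    · rfl
    · exact ihb h.2 _ i hi
    · rfl
    · exact iha h.1 _ i hi
  | ifEq r s a b iha ihb =>
    simp only [noLookup, Bool.and_eq_true] at h
    simp only [compile, List.mem_cons, List.mem_append]
    rintro i (rfl | hi | rfl | hi)
    · rfl
    · exact ihb h.2 _ i hi
    · rfl
    · exact iha h.1 _ i hi
  | whileLt r s a iha =>
    simp only [noLookup] at h
    simp only [compile, List.mem_cons, List.mem_append, List.not_mem_nil, or_false]
    rintro i (rfl | rfl | hi | rfl)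
    · rfl
    · rfl
    · exact iha h _ i hi
    · rfl

/-! ### Input, output and bounds of the machine -/

theorem isLyndon_singleton (c : ℕ) : IsLyndon [c] := by
  refine ⟨by simp, fun s hs h0 h1 => ?_⟩
  exact absurd (hs.eq_of_length_le (List.length_pos_iff.2 h0)) h1

theorem singleton_zero_le {w : List ℕ} (h : w ≠ []) : [0] ≤ w := by
  cases w with
  | nil => exact absurd rfl h
  | cons c w =>
    rw [← not_lt, List.cons_lt_cons_iff]
    simp

/-- The delimiter is a Lyndon word below every nonempty word, so it is simply one more, last factor.
-/
theorem IsLyndonFactorization.append_dollar {T : List ℕ} {fs : List (List ℕ)} (h : IsLyndonFactorization T fs) :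
    IsLyndonFactorization (T ++ [0]) (fs ++ [[0]]) := by
  obtain ⟨h1, h2, h3⟩ := h
  refine ⟨by simp [h1], fun w hw => ?_, ?_⟩
  · rcases List.mem_append.1 hw with hw | hw
    · exact h2 w hw
    · rw [List.mem_singleton.1 hw]; exact isLyndon_singleton 0
  · refine List.pairwise_append.2 ⟨h3, by simp, fun u hu v hv => ?_⟩
    rw [List.mem_singleton.1 hv]
    exact singleton_zero_le (h2 u hu).1

theorem stage_zero (fs : List (List ℕ)) : stage fs 0 = bwt (fs.flatten ++ [0]) := by
  rw [bwt_eq_ebwt (by simp), stage]; rfl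

theorem stage_eq_ebwt (fs : List (List ℕ)) : stage fs fs.length = ebwt (fs ++ [[0]]) := by
  rw [stage, List.take_length, List.drop_length]; rfl

theorem TextFactors.isOutput {fs : List (List ℕ)} (h : TextFactors fs) :
    IsOutput fs.flatten (stage fs fs.length) := by
  have hf := h.nextSmaller.isLyndonFactorization
  rw [stage_eq_ebwt]
  exact ⟨⟨_, hf.append_dollar, rfl⟩, _, ebwt_append_dollar h.pos, _, hf, rfl⟩

theorem mem_of_mem_bwt {w : List ℕ} {c : ℕ} (h : c ∈ bwt w) : c ∈ w := by
  unfold bwt conjugates at h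
  obtain ⟨u, hu, rfl⟩ := List.mem_map.1 h
  rw [List.mem_mergeSort] at hu
  obtain ⟨k, hk, rfl⟩ := List.mem_map.1 hu
  have h0 : w.rotate k ≠ [] := by
    rw [Ne, List.rotate_eq_nil_iff]
    rintro rfl
    simp at hk
  rw [List.getLastD_eq_getLast?, List.getLast?_eq_getLast_of_ne_nil h0]
  exact List.mem_rotate.1 (List.getLast_mem h0)

theorem IsText.exists_textFactors {κ : ℕ} {T : List ℕ} (h : IsText κ T) :
    ∃ fs, fs.flatten = T ∧ TextFactors fs ∧ fs ≠ [] := by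
  obtain ⟨fs, rfl, hfs⟩ := exists_nextSmallerFactors T
  refine ⟨fs, rfl, ⟨hfs, fun u hu c hc => (h.2 c (List.mem_flatten.2 ⟨u, hu, hc⟩)).1⟩, ?_⟩
  rintro rfl
  exact h.1 rfl

/-- A structured program that is correct on the first stages computes within the bounds of the model. -/
theorem Spec.computes_bwt {κ : ℕ} {fs : List (List ℕ)} (hT : IsText κ fs.flatten) (hfs : TextFactors fs) {c : Com}
    {Q : MemState → Prop} {R : Config → Prop}
    (h : ∀ W, fs.flatten.length + 1 < W → Spec W c (startState (stage fs 0))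
      (300 * ((fs.flatten.length + 1) * (fs.flatten.length + 1))) Q) (hR : ∀ s : Config, Q s.mem → R s) :
    Program.Computes (c.compile 0) (bwt (fs.flatten ++ [0])) (1200 * fs.flatten.length ^ 2)
      ((fs.flatten.length + 1) ^ (κ + 1200)) R := by
  have hl := hfs.stage_length 0
  have hmem : ∀ x ∈ stage fs 0, x ≤ (fs.flatten.length + 1) ^ κ := by
    intro x hx
    rw [stage_zero] at hx
    rcases List.mem_append.1 (mem_of_mem_bwt hx) with hx | hx
    · exact (hT.2 x hx).2
    · rw [List.mem_singleton.1 hx]; exact Nat.zero_le _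
  rw [← stage_zero]
  have hn : 1 ≤ fs.flatten.length := List.length_pos_iff.2 hT.1
  generalize fs.flatten.length = n at *
  -- The register bound must strictly exceed the length `n + 1` of the array, so that loop counters
  -- fit; this needs `n ≥ 1`.
  have hW : n + 1 < (n + 1) ^ (κ + 1200) := by
    conv_lhs => rw [← pow_one (n + 1)]
    exact Nat.pow_lt_pow_right (by omega) (by omega)
  refine ((h _ hW).mono (T' := 1200 * n ^ 2) ?_ fun _ _ h => h).computes (by omega) (fun x hx => ?_) hR
  -- For `n ≥ 1` the time bound `300 (n + 1)^2` is at most `1200 n^2`, which fixes the constant of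
  -- the theorem.
  · have : (n + 1) * (n + 1) ≤ (2 * n) * (2 * n) := Nat.mul_le_mul (by omega) (by omega)
    have e : 300 * ((2 * n) * (2 * n)) = 1200 * n ^ 2 := by ring
    omega
  · exact (hmem x hx).trans (Nat.pow_le_pow_right (by omega) (by omega))

theorem mainTheorem3 :
    -- in-place conversion in quadratic time by elementary instructions only
    (∃ (P : Program) (C : ℕ), P.Elementary ∧ ∀ (κ : ℕ) (T : List ℕ), IsText κ T →
      P.Computes (bwt (T ++ [0])) (C * T.length ^ 2) ((T.length + 1) ^ (κ + C))
        (fun s => IsOutput T s.arr)) ∧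
    -- conversion on the fly, one Lyndon factor after the other
    (∃ (P : Program) (C : ℕ), ∀ (κ : ℕ) (T : List ℕ), IsText κ T →
      P.Computes (bwt (T ++ [0])) (C * T.length ^ 2) ((T.length + 1) ^ (κ + C))
        (fun s => IsOutput T s.arr ∧ s.lookups ≤ C * T.length ∧
          ∃ fs : List (List ℕ), IsLyndonFactorization T fs ∧
            stage fs 0 = bwt (T ++ [0]) ∧ stage fs fs.length = s.arr ∧
            ∃ S : List (List (ℕ × ℕ)), S.length = fs.length ∧ s.swaps = S.flatten ∧
              ∀ x < fs.length,
                IsCut (stage fs x) (fs.getD x []) (S.getD x []) (stage fs (x + 1)))) := by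
  refine ⟨⟨rebuild.compile 0, 1200, Com.elementary_compile (by decide) 0, fun κ T hT => ?_⟩,
    convert.compile 0, 1200, fun κ T hT => ?_⟩
  · obtain ⟨fs, rfl, hfs, -⟩ := hT.exists_textFactors
    refine Spec.computes_bwt hT hfs (fun W hW => hfs.rebuild_spec hW) fun s hs => ?_
    rw [show s.arr = stage fs fs.length from hs]
    exact hfs.isOutput
  · obtain ⟨fs, rfl, hfs, h0⟩ := hT.exists_textFactors
    refine Spec.computes_bwt hT hfs (fun W hW => hfs.convert_spec h0 hW) fun s hs => ?_
    obtain ⟨h1, h2, h3⟩ := hs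
    replace h1 : s.arr = stage fs fs.length := h1
    replace h2 : s.lookups = fs.flatten.length := h2
    rw [h1, h2]
    refine ⟨hfs.isOutput, by omega, fs, hfs.nextSmaller.isLyndonFactorization, stage_zero fs, rfl,
      (List.range fs.length).map (swapsAt fs), by simp, h3, fun x hx => ?_⟩
    have e : ((List.range fs.length).map (swapsAt fs)).getD x [] = swapsAt fs x := by
      simp [List.getD_eq_getElem?_getD, hx]
    rw [e]
    exact hfs.isCut hx
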